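/- **Setting.** Let $\Omega\subset\mathbb R^3$ be an exterior Lipschitz domain: an open set with bounded complement whose boundary $\Gamma=\partial\Omega$ is locally the graph of a Lipschitz function with $\Omega$ on one side. $H^{1/2}(\Gamma)$ carries the norm $\|\psi\|_{H^{1/2}}^2=\int_\Gamma|\psi|^2+\int_\Gamma\int_\Gamma\frac{|\psi(x)-\psi(y)|^2}{|x-y|^3}$, and $\nabla_\Gamma$ is the weak tangential gradient. For a complex space $X$ embedded in $H^{1/2}(\Gamma)$ and equipped with a seminorm $|\cdot|_X$, let $X'$ be its anti-dual, with the pairing $\langle\cdot,\cdot\rangle$ (anti-linear in the first argument) that extends the $L^2(\Gamma)$ inner product; elements of $L^2(\Gamma)$, and so of $X$, are regarded as elements of $X'$. Call $X$ *admissible* if it is a Hilbert space, densely and continuously embedded in $H^{1/2}(\Gamma)$, with norm $\|\psi\|_X^2=\|\psi\|_{H^{1/2}}^2+|\psi|_X^2$. An analytic family $F(s):X\to X'$, $\mathrm{Re}\,s>0$, of bounded linear operators is *polynomially bounded with exponent $\mu$* if for every $\sigma>0$ there is $M_\sigma<\infty$ with $\|F(s)\|_{X'\leftarrow X}\le M_\sigma|s|^\mu$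 for $\mathrm{Re}\,s\ge\sigma$. It *satisfies the positivity condition with abscissa $\sigma_0\ge0$* if for every $\sigma>\sigma_0$ there is $c_\sigma>0$ with $\mathrm{Re}\,\langle\psi,F(s)\psi\rangle\ge c_\sigma|s^{-1}\psi|_X^2$ for all $\psi\in X$ and $\mathrm{Re}\,s\ge\sigma$. If $F$ has exponent $\mu$, $n>\mu+1$ is a natural number, and $g:\mathbb R\to X$ is of class $C^n$ and vanishes for $t\le0$, the temporal convolution $F(\partial_t)g=(\mathcal L^{-1}F)*g$ is $$\bigl(F(\partial_t)g\bigr)(t)=\int_0^tK(t-\tau)\,g^{(n)}(\tau)\,d\tau,\qquad K(t)=\frac1{2\pi i}\int_{\sigma+i\mathbb R}e^{st}s^{-n}F(s)\,ds\quad(\sigma>0).$$ A relation between Dirichlet data $u$ (with values in $X$) and Neumann data $\partial_nu$ (with values in $X'$) on $\Gamma\times[0,T]$ is a *generalized impedance condition with transfer operator $F$* if, for all natural $n>\mu+1$, all $\sigma,T>0$, all $u:\mathbb R\to X$ of class $C^{n+1}$ that vanish for $t\le0$, and all $\partial_nu$, it holds if and only if $\partial_nu=F(\partial_t)\partial_tu$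 on $[0,T]$. **Lemma.** Let $\varepsilon>0$, $\kappa\ge0$, $m>0$, $\alpha\ge0$, $k>0$. Each of the following boundary conditions on $\Gamma\times[0,T]$, understood as an identity in $X'$, is a generalized impedance condition with the stated transfer operator $F(s)$. The stated space $X$ is admissible, and $F$ is an analytic family of bounded operators $X\to X'$, polynomially bounded with the stated exponent $\mu$, and satisfies the positivity condition with the stated $\sigma_0$. * (A) Thin coating, $\partial_nu=\varepsilon(\partial_t^2u-\Delta_\Gamma u)$, where $\langle v,\Delta_\Gamma u\rangle=-(\nabla_\Gamma v,\nabla_\Gamma u)_{L^2(\Gamma)^3}$: $X=H^1(\Gamma)$ (all $\psi\in L^2(\Gamma)$ with $\nabla_\Gamma\psi\in L^2(\Gamma)^3$), $|\psi|_X=\varepsilon^{1/2}\|\nabla_\Gamma\psi\|_{L^2(\Gamma)^3}$, $F(s)=\varepsilon(s-\Delta_\Gamma s^{-1})$, $\mu=1$, $\sigma_0=0$. * (B1) Absorption of order 1, $\partial_nu=\frac1\varepsilon\partial_t^{1/2}u$, with the Riemann–Liouville derivative $\partial_t^{1/2}u(t)=\frac{d}{dt}\int_0^t\frac{u(\tau)}{\sqrt{\pi(t-\tau)}}\,d\tau$: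 $X=H^{1/2}(\Gamma)$, $|\psi|_X=\kappa\|\psi\|_{L^2(\Gamma)}$ (in particular $|\cdot|_X=0$, or $|\psi|_X=\varepsilon^{-1/2}\|\psi\|_{L^2(\Gamma)}$), $F(s)=\varepsilon^{-1}s^{-1/2}$, $\mu=0$, $\sigma_0=0$. * (B2) Absorption of order 2, $\partial_nu=\frac1\varepsilon\partial_t^{1/2}u-\mathcal Hu$, where $\Gamma$ is smooth and $\mathcal H$ is its mean curvature (half the sum of the principal curvatures, positive for a sphere): $X$ and $|\cdot|_X$ as in (B1), $F(s)=\varepsilon^{-1}s^{-1/2}-\mathcal Hs^{-1}$, $\mu=0$, $\sigma_0=\bigl(\varepsilon\max(0,\max_\Gamma\mathcal H)\bigr)^2$. * (C) Acoustic condition, $m\partial_t^2\delta+\alpha\partial_t\delta+k\delta+\partial_tu=0$ and $\partial_t\delta=-\partial_nu$ for some $\delta$ with $\delta(0)=\partial_t\delta(0)=0$: $X=H^{1/2}(\Gamma)$, $|\cdot|_X=0$, $F(s)=(ms+\alpha+ks^{-1})^{-1}$, $\mu=-1$, $\sigma_0=0$. -/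

import Mathlib

open MeasureTheory Set Filter Topology
open scoped ENNReal NNReal ContDiff

noncomputable section

namespace Gibc

/-! ### The exterior domain, its boundary and the surface measure -/

abbrev E2 : Type := EuclideanSpace ℝ (Fin 2)

abbrev E3 : Type := EuclideanSpace ℝ (Fin 3)

/-- The parametrization `y ↦ (y, g y)` of the graph of `g`, in the orthonormal frame `e`. -/
def graphMap (e : E3 ≃ₗᵢ[ℝ] WithLp 2 (E2 × ℝ)) (g : E2 → ℝ) (y : E2) : E3 :=
  e.symm (WithLp.toLp 2 (y, g y))

/-- The normal vector `(-∇g(y), 1)` to the graph of `g`, in the orthonormal frame `e`. -/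
def graphNormal (e : E3 ≃ₗᵢ[ℝ] WithLp 2 (E2 × ℝ)) (g : E2 → ℝ) (y : E2) : E3 :=
  e.symm (WithLp.toLp 2 (-gradient g y, 1))

/-- Inside the open set `U` and in the orthonormal frame `e`, the set `Ω` is the part above the
graph of the Lipschitz function `g`. -/
structure IsGraphChart (Ω : Set E3) (e : E3 ≃ₗᵢ[ℝ] WithLp 2 (E2 × ℝ)) (g : E2 → ℝ)
    (U : Set E3) : Prop where
  isOpen : IsOpen U
  lipschitz : ∃ K : ℝ≥0, LipschitzWith K g
  above : ∀ x ∈ U, x ∈ Ω ↔ g (e x).fst < (e x).snd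

/-- `Ω` is the open complement of a bounded set, and its boundary is locally a Lipschitz graph
with `Ω` on one side. -/
structure IsLipschitzExteriorDomain (Ω : Set E3) : Prop where
  isOpen : IsOpen Ω
  bounded_compl : Bornology.IsBounded Ωᶜ
  lipschitz : ∀ x ∈ frontier Ω, ∃ e g U, x ∈ U ∧ IsGraphChart Ω e g U

/-- The surface measure on `Γ = ∂Ω`: the two-dimensional Hausdorff measure, normalized to agree
with the area on planes. -/
def surfaceMeasure (Ω : Set E3) : Measure E3 :=
  (Measure.euclideanHausdorffMeasure 2 : Measure E3).restrict (frontier Ω)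

/-- `L²(Γ)`. -/
abbrev L2 (Ω : Set E3) : Type := Lp ℂ 2 (surfaceMeasure Ω)

/-- `L²(Γ)³`. -/
abbrev L2Vec (Ω : Set E3) : Type := Lp (EuclideanSpace ℂ (Fin 3)) 2 (surfaceMeasure Ω)

/-! ### The space `H^{1/2}(Γ)` -/

/-- `H^{1/2}(Γ)` with the Sobolev-Slobodeckij norm
`‖ψ‖² = ∫ |ψ|² + ∫∫ |ψ(x) - ψ(y)|² / |x - y|³`. A function `ψ` is represented by the pair of `ψ` and
its difference quotient `(ψ(x) - ψ(y)) / |x - y|^{3/2}`, which has to be in `L²(Γ × Γ)`. -/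
def halfSubmodule (Ω : Set E3) :
    Submodule ℂ (WithLp 2 (L2 Ω × Lp ℂ 2 ((surfaceMeasure Ω).prod (surfaceMeasure Ω)))) where
  carrier := {p | ∀ᵐ z ∂((surfaceMeasure Ω).prod (surfaceMeasure Ω)),
    p.snd z = ((‖z.1 - z.2‖ ^ (-(3 / 2) : ℝ) : ℝ) : ℂ) * (p.fst z.1 - p.fst z.2)}
  add_mem' := by
    intro a b ha hb
    have h1 := Measure.quasiMeasurePreserving_fst (μ := surfaceMeasure Ω) (ν := surfaceMeasure Ω)
      |>.ae (Lp.coeFn_add a.fst b.fst)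
    have h2 := Measure.quasiMeasurePreserving_snd (μ := surfaceMeasure Ω) (ν := surfaceMeasure Ω)
      |>.ae (Lp.coeFn_add a.fst b.fst)
    filter_upwards [ha, hb, h1, h2, Lp.coeFn_add a.snd b.snd] with z ha hb h1 h2 h3
    simp only [WithLp.add_fst, WithLp.add_snd, h1, h2, h3, Pi.add_apply, ha, hb]
    ring
  zero_mem' := by
    have h1 := Measure.quasiMeasurePreserving_fst (μ := surfaceMeasure Ω) (ν := surfaceMeasure Ω)
      |>.ae (Lp.coeFn_zero ℂ 2 (surfaceMeasure Ω))
    have h2 := Measure.quasiMeasurePreserving_snd (μ := surfaceMeasure Ω) (ν := surfaceMeasure Ω)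
      |>.ae (Lp.coeFn_zero ℂ 2 (surfaceMeasure Ω))
    filter_upwards [h1, h2,
      Lp.coeFn_zero ℂ 2 ((surfaceMeasure Ω).prod (surfaceMeasure Ω))] with z h1 h2 h3
    change ((0 : Lp ℂ 2 _) : E3 × E3 → ℂ) z =
      _ * (((0 : L2 Ω) : E3 → ℂ) z.1 - ((0 : L2 Ω) : E3 → ℂ) z.2)
    rw [h1, h2, h3]
    simp
  smul_mem' := by
    intro c a ha
    have h1 := Measure.quasiMeasurePreserving_fst (μ := surfaceMeasure Ω) (ν := surfaceMeasure Ω)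
      |>.ae (Lp.coeFn_smul c a.fst)
    have h2 := Measure.quasiMeasurePreserving_snd (μ := surfaceMeasure Ω) (ν := surfaceMeasure Ω)
      |>.ae (Lp.coeFn_smul c a.fst)
    filter_upwards [ha, h1, h2, Lp.coeFn_smul c a.snd] with z ha h1 h2 h3
    simp only [WithLp.smul_fst, WithLp.smul_snd, h1, h2, h3, Pi.smul_apply, ha, smul_eq_mul]
    ring

/-- `H^{1/2}(Γ)`. -/
def HHalf (Ω : Set E3) : Type := halfSubmodule Ω

instance (Ω : Set E3) : NormedAddCommGroup (HHalf Ω) :=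
  inferInstanceAs (NormedAddCommGroup (halfSubmodule Ω))

instance (Ω : Set E3) : InnerProductSpace ℂ (HHalf Ω) :=
  inferInstanceAs (InnerProductSpace ℂ (halfSubmodule Ω))

/-- For a space `X` of pairs `(ψ, Dψ)` with `ψ ∈ H`: the map `ψ : X → H`. -/
def graphFst {H K : Type*} [NormedAddCommGroup H] [InnerProductSpace ℂ H] [NormedAddCommGroup K]
    [InnerProductSpace ℂ K] (X : Submodule ℂ (WithLp 2 (H × K))) : X →L[ℂ] H :=
  (WithLp.fstL 2 ℂ H K).comp X.subtypeL

/-- For a space `X` of pairs `(ψ, Dψ)` with `Dψ ∈ K`: the operator `D : X → K`. -/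
def graphSnd {H K : Type*} [NormedAddCommGroup H] [InnerProductSpace ℂ H] [NormedAddCommGroup K]
    [InnerProductSpace ℂ K] (X : Submodule ℂ (WithLp 2 (H × K))) : X →L[ℂ] K :=
  (WithLp.sndL 2 ℂ H K).comp X.subtypeL

/-- The embedding of `H^{1/2}(Γ)` in `L²(Γ)`. -/
def HHalf.toL2 (Ω : Set E3) : HHalf Ω →L[ℂ] L2 Ω := graphFst (halfSubmodule Ω)

/-! ### The weak tangential gradient -/

/-- `q` is the weak tangential gradient of `f`: almost everywhere on `Γ` the vector `q` is
tangential, and in each local graph parametrization `G` one has `∂ᵥ(f ∘ G) = (q ∘ G) · ∂ᵥG` in the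
sense of weak derivatives. -/
structure IsWeakTangentialGradient (Ω : Set E3) (f : E3 → ℂ)
    (q : E3 → EuclideanSpace ℂ (Fin 3)) : Prop where
  tangential : ∀ e g U, IsGraphChart Ω e g U → ∀ᵐ y : E2, graphMap e g y ∈ U →
    ∑ i, q (graphMap e g y) i * (graphNormal e g y i : ℂ) = 0
  weak : ∀ e g U, IsGraphChart Ω e g U → ∀ η : E2 → ℝ, ContDiff ℝ ∞ η → HasCompactSupport η →
    tsupport η ⊆ graphMap e g ⁻¹' U → ∀ v : E2,
      ∫ y, f (graphMap e g y) * (fderiv ℝ η y v : ℂ) =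
        -∫ y, (∑ i, q (graphMap e g y) i * (fderiv ℝ (graphMap e g) y v i : ℂ)) * (η y : ℂ)

theorem continuous_graphMap {Ω : Set E3} {e g U} (h : IsGraphChart Ω e g U) :
    Continuous (graphMap e g) := by
  obtain ⟨K, hK⟩ := h.lipschitz
  unfold graphMap
  have := hK.continuous
  fun_prop

theorem graphMap_mem_frontier {Ω : Set E3} {e g U} (h : IsGraphChart Ω e g U) {y : E2}
    (hy : graphMap e g y ∈ U) : graphMap e g y ∈ frontier Ω := by
  have h1 : graphMap e g y ∉ Ω := by
    rw [h.above _ hy]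
    simp [graphMap]
  refine ⟨?_, fun hi => h1 (interior_subset hi)⟩
  let c : ℝ → E3 := fun t => e.symm (WithLp.toLp 2 (y, g y + t))
  have hc : Continuous c := by
    simp only [c]
    fun_prop
  have hc0 : c 0 = graphMap e g y := by simp [c, graphMap]
  have hlim : Tendsto c (𝓝[>] 0) (𝓝 (graphMap e g y)) := by
    rw [← hc0]
    exact (hc.tendsto 0).mono_left nhdsWithin_le_nhds
  refine mem_closure_of_tendsto hlim ?_
  filter_upwards [hlim (h.isOpen.mem_nhds hy), self_mem_nhdsWithin] with t ht ht0
  rw [h.above _ ht]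
  simpa [c] using ht0

theorem map_graphMap_le {Ω : Set E3} {e g U} (h : IsGraphChart Ω e g U) :
    (volume.restrict (graphMap e g ⁻¹' U)).map (graphMap e g) ≤ surfaceMeasure Ω := by
  have hG := continuous_graphMap h
  refine Measure.le_iff.2 fun A hA => ?_
  rw [Measure.map_apply hG.measurable hA, Measure.restrict_apply (hG.measurable hA),
    surfaceMeasure, Measure.restrict_apply hA]
  set B := graphMap e g ⁻¹' A ∩ graphMap e g ⁻¹' U
  let π : E3 → E2 := fun x => (e x).fst
  have hπ : LipschitzWith 1 π := by
    refine LipschitzWith.of_dist_le_mul fun x y => ?_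
    rw [NNReal.coe_one, one_mul, ← e.dist_map x y, dist_eq_norm, dist_eq_norm]
    exact WithLp.norm_fst_le _ (e x - e y)
  have hB : π '' (graphMap e g '' B) = B := by
    rw [Set.image_image]
    simp [π, graphMap]
  have hsub : graphMap e g '' B ⊆ A ∩ frontier Ω := by
    rintro _ ⟨y, hy, rfl⟩
    exact ⟨hy.1, graphMap_mem_frontier h hy.2⟩
  have hμ := hπ.hausdorffMeasure_image_le (d := 2) (by norm_num) (graphMap e g '' B)
  rw [hB] at hμ
  rw [← EuclideanSpace.euclideanHausdorffMeasure_eq_volume]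
  simp only [Measure.euclideanHausdorffMeasure_def, Measure.smul_apply]
  gcongr
  simp only [Nat.cast_ofNat]
  refine hμ.trans ?_
  simp only [ENNReal.coe_one, ENNReal.one_rpow, one_mul]
  exact measure_mono hsub

theorem ae_graphMap {Ω : Set E3} {e g U} (h : IsGraphChart Ω e g U) {P : E3 → Prop}
    (hP : ∀ᵐ x ∂surfaceMeasure Ω, P x) : ∀ᵐ y : E2, graphMap e g y ∈ U → P (graphMap e g y) := by
  have hG := continuous_graphMap h
  have h1 := ae_of_ae_map hG.measurable.aemeasurable (ae_mono (map_graphMap_le h) hP)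
  exact (ae_restrict_iff' (hG.measurable h.isOpen.measurableSet)).1 h1

/-- The integrals in the definition of the weak tangential gradient converge. -/
theorem integrable_graphMap {Ω : Set E3} {e g U} (h : IsGraphChart Ω e g U) {f : E3 → ℂ}
    (hf : MemLp f 2 (surfaceMeasure Ω)) {w : E2 → ℂ} (hw : MemLp w 2)
    (hsupp : ∀ y, graphMap e g y ∉ U → w y = 0) :
    Integrable fun y => f (graphMap e g y) * w y := by
  have hG := continuous_graphMap h
  have hm := hG.measurable h.isOpen.measurableSet
  have h1 : MemLp (f ∘ graphMap e g) 2 (volume.restrict (graphMap e g ⁻¹' U)) :=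
    (hf.mono_measure (map_graphMap_le h)).comp_of_map hG.measurable.aemeasurable
  have h2 : IntegrableOn (fun y => f (graphMap e g y) * w y) (graphMap e g ⁻¹' U) :=
    MemLp.integrable_mul h1 (hw.restrict _)
  refine (integrableOn_iff_integrable_of_support_subset ?_).1 h2
  intro y hy
  by_contra hn
  exact hy (by simp [hsupp y hn])

theorem memLp_mul_of_bounded {η : E2 → ℝ} (hη : Continuous η) (hc : HasCompactSupport η)
    {b : E2 → ℝ} (hb : Measurable b) {C : ℝ} (hC : ∀ y, ‖b y‖ ≤ C) :
    MemLp (fun y => (b y : ℂ) * (η y : ℂ)) 2 := by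
  have h1 : MemLp (fun y => (η y : ℂ)) 2 :=
    (Complex.continuous_ofReal.comp hη).memLp_of_hasCompactSupport
      (hc.comp_left Complex.ofReal_zero)
  have h2 : MemLp (fun y => (b y : ℂ)) ∞ :=
    memLp_top_of_bound (Complex.measurable_ofReal.comp hb).aestronglyMeasurable C
      (Eventually.of_forall fun y => by simpa using hC y)
  exact MemLp.mul' (p := ∞) (q := 2) (r := 2) h1 h2

theorem exists_lipschitz_graphMap {Ω : Set E3} {e g U} (h : IsGraphChart Ω e g U) :
    ∃ C : ℝ≥0, LipschitzWith C (graphMap e g) := by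
  obtain ⟨K, hK⟩ := h.lipschitz
  refine ⟨_, e.symm.lipschitz.comp
    ((WithLp.prod_lipschitzWith_toLp 2 E2 ℝ).comp (LipschitzWith.id.prodMk hK))⟩

theorem integrable_weak_left {Ω : Set E3} {e g U} (h : IsGraphChart Ω e g U) {f : E3 → ℂ}
    (hf : MemLp f 2 (surfaceMeasure Ω)) {η : E2 → ℝ} (hη : ContDiff ℝ ∞ η)
    (hc : HasCompactSupport η) (hs : tsupport η ⊆ graphMap e g ⁻¹' U) (v : E2) :
    Integrable fun y => f (graphMap e g y) * (fderiv ℝ η y v : ℂ) := by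
  refine integrable_graphMap h hf ?_ fun y hy => ?_
  · have hcont : Continuous fun y => fderiv ℝ η y v :=
      (hη.continuous_fderiv (by simp)).clm_apply continuous_const
    exact (Complex.continuous_ofReal.comp hcont).memLp_of_hasCompactSupport
      ((hc.fderiv_apply ℝ v).comp_left Complex.ofReal_zero)
  · have : y ∉ tsupport (fderiv ℝ η) := fun hy' => hy (hs (tsupport_fderiv_subset ℝ hy'))
    simp [image_eq_zero_of_notMem_tsupport this]

theorem integrable_weak_right {Ω : Set E3} {e g U} (h : IsGraphChart Ω e g U)
    {q : E3 → EuclideanSpace ℂ (Fin 3)} (hq : MemLp q 2 (surfaceMeasure Ω)) {η : E2 → ℝ}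
    (hη : ContDiff ℝ ∞ η) (hc : HasCompactSupport η) (hs : tsupport η ⊆ graphMap e g ⁻¹' U)
    (v : E2) :
    Integrable fun y =>
      (∑ i, q (graphMap e g y) i * (fderiv ℝ (graphMap e g) y v i : ℂ)) * (η y : ℂ) := by
  obtain ⟨C, hC⟩ := exists_lipschitz_graphMap h
  simp_rw [Finset.sum_mul, mul_assoc]
  refine integrable_finsetSum _ fun i _ => ?_
  refine integrable_graphMap (f := fun x => q x i) h ?_ ?_ fun y hy => ?_
  · exact hq.continuousLinearMap_comp (EuclideanSpace.proj (𝕜 := ℂ) i)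
  · refine memLp_mul_of_bounded (C := C * ‖v‖) hη.continuous hc ?_ fun y => ?_
    · have := measurable_fderiv_apply_const ℝ (graphMap e g) v
      exact (EuclideanSpace.proj (𝕜 := ℝ) i).continuous.measurable.comp this
    · refine (PiLp.norm_apply_le _ i).trans ((ContinuousLinearMap.le_opNorm _ _).trans ?_)
      gcongr
      exact norm_fderiv_le_of_lipschitz ℝ hC
  · have : y ∉ tsupport η := fun hy' => hy (hs hy')
    simp [image_eq_zero_of_notMem_tsupport this]

theorem IsWeakTangentialGradient.add {Ω : Set E3} {f₁ f₂ : L2 Ω} {q₁ q₂ : L2Vec Ω}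
    (h₁ : IsWeakTangentialGradient Ω f₁ q₁) (h₂ : IsWeakTangentialGradient Ω f₂ q₂) :
    IsWeakTangentialGradient Ω (f₁ + f₂ : L2 Ω) (q₁ + q₂ : L2Vec Ω) where
  tangential e g U h := by
    filter_upwards [h₁.tangential e g U h, h₂.tangential e g U h,
      ae_graphMap h (Lp.coeFn_add q₁ q₂)] with y h1 h2 h3 hy
    simp only [h3 hy, Pi.add_apply, PiLp.add_apply, add_mul, Finset.sum_add_distrib, h1 hy, h2 hy,
      add_zero]
  weak e g U h η hη hc hs v := by
    have hl : ∀ f : L2 Ω, _ := fun f => integrable_weak_left h (Lp.memLp f) hη hc hs v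
    have hr : ∀ q : L2Vec Ω, _ := fun q => integrable_weak_right h (Lp.memLp q) hη hc hs v
    have e1 : ∫ y, (f₁ + f₂ : L2 Ω) (graphMap e g y) * (fderiv ℝ η y v : ℂ) =
        ∫ y, (f₁ (graphMap e g y) * (fderiv ℝ η y v : ℂ) +
          f₂ (graphMap e g y) * (fderiv ℝ η y v : ℂ)) := by
      refine integral_congr_ae ?_
      filter_upwards [ae_graphMap h (Lp.coeFn_add f₁ f₂)] with y h3
      by_cases hy : graphMap e g y ∈ U
      · simp only [h3 hy, Pi.add_apply, add_mul]
      · have : y ∉ tsupport (fderiv ℝ η) := fun hy' => hy (hs (tsupport_fderiv_subset ℝ hy'))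
        simp [image_eq_zero_of_notMem_tsupport this]
    have e2 : ∫ y, (∑ i, (q₁ + q₂ : L2Vec Ω) (graphMap e g y) i *
          (fderiv ℝ (graphMap e g) y v i : ℂ)) * (η y : ℂ) =
        ∫ y, ((∑ i, q₁ (graphMap e g y) i * (fderiv ℝ (graphMap e g) y v i : ℂ)) * (η y : ℂ) +
          (∑ i, q₂ (graphMap e g y) i * (fderiv ℝ (graphMap e g) y v i : ℂ)) * (η y : ℂ)) := by
      refine integral_congr_ae ?_
      filter_upwards [ae_graphMap h (Lp.coeFn_add q₁ q₂)] with y h3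
      by_cases hy : graphMap e g y ∈ U
      · simp only [h3 hy, Pi.add_apply, PiLp.add_apply, add_mul, Finset.sum_add_distrib]
      · have : y ∉ tsupport η := fun hy' => hy (hs hy')
        simp [image_eq_zero_of_notMem_tsupport this]
    rw [e1, e2, integral_add (hl f₁) (hl f₂), integral_add (hr q₁) (hr q₂),
      h₁.weak e g U h η hη hc hs v, h₂.weak e g U h η hη hc hs v]
    ring

theorem IsWeakTangentialGradient.smul {Ω : Set E3} {f : L2 Ω} {q : L2Vec Ω} (c : ℂ)
    (h₁ : IsWeakTangentialGradient Ω f q) :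
    IsWeakTangentialGradient Ω (c • f : L2 Ω) (c • q : L2Vec Ω) where
  tangential e g U h := by
    filter_upwards [h₁.tangential e g U h, ae_graphMap h (Lp.coeFn_smul c q)] with y h1 h3 hy
    simp only [h3 hy, Pi.smul_apply, PiLp.smul_apply, smul_eq_mul, mul_assoc, ← Finset.mul_sum,
      h1 hy, mul_zero]
  weak e g U h η hη hc hs v := by
    have e1 : ∫ y, (c • f : L2 Ω) (graphMap e g y) * (fderiv ℝ η y v : ℂ) =
        ∫ y, c * (f (graphMap e g y) * (fderiv ℝ η y v : ℂ)) := by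
      refine integral_congr_ae ?_
      filter_upwards [ae_graphMap h (Lp.coeFn_smul c f)] with y h3
      by_cases hy : graphMap e g y ∈ U
      · simp only [h3 hy, Pi.smul_apply, smul_eq_mul, mul_assoc]
      · have : y ∉ tsupport (fderiv ℝ η) := fun hy' => hy (hs (tsupport_fderiv_subset ℝ hy'))
        simp [image_eq_zero_of_notMem_tsupport this]
    have e2 : ∫ y, (∑ i, (c • q : L2Vec Ω) (graphMap e g y) i *
          (fderiv ℝ (graphMap e g) y v i : ℂ)) * (η y : ℂ) =
        ∫ y, c * ((∑ i, q (graphMap e g y) i * (fderiv ℝ (graphMap e g) y v i : ℂ)) *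
          (η y : ℂ)) := by
      refine integral_congr_ae ?_
      filter_upwards [ae_graphMap h (Lp.coeFn_smul c q)] with y h3
      by_cases hy : graphMap e g y ∈ U
      · simp only [h3 hy, Pi.smul_apply, PiLp.smul_apply, smul_eq_mul, mul_assoc, ← Finset.mul_sum]
      · have : y ∉ tsupport η := fun hy' => hy (hs hy')
        simp [image_eq_zero_of_notMem_tsupport this]
    rw [e1, e2, integral_const_mul, integral_const_mul, h₁.weak e g U h η hη hc hs v]
    ring

theorem IsWeakTangentialGradient.zero (Ω : Set E3) :
    IsWeakTangentialGradient Ω (0 : L2 Ω) (0 : L2Vec Ω) := by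
  have hf := Lp.coeFn_zero ℂ 2 (surfaceMeasure Ω)
  have hq := Lp.coeFn_zero (EuclideanSpace ℂ (Fin 3)) 2 (surfaceMeasure Ω)
  refine ⟨fun e g U h => ?_, fun e g U h η hη hc hs v => ?_⟩
  · filter_upwards [ae_graphMap h hq] with y h3 hy
    simp only [h3 hy]
    simp
  · rw [integral_eq_zero_of_ae, integral_eq_zero_of_ae, neg_zero]
    · filter_upwards [ae_graphMap h hq] with y h3
      by_cases hy : graphMap e g y ∈ U
      · simp only [h3 hy]
        simp
      · have : y ∉ tsupport η := fun hy' => hy (hs hy')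
        simp [image_eq_zero_of_notMem_tsupport this]
    · filter_upwards [ae_graphMap h hf] with y h3
      by_cases hy : graphMap e g y ∈ U
      · simp only [h3 hy]
        simp
      · have : y ∉ tsupport (fderiv ℝ η) := fun hy' => hy (hs (tsupport_fderiv_subset ℝ hy'))
        simp [image_eq_zero_of_notMem_tsupport this]

/-! ### The spaces `X` -/

/-- The space `X = H¹(Γ)` with the norm `‖ψ‖² = ‖ψ‖²_{H^{1/2}} + ε ‖∇_Γ ψ‖²_{L²}`: a function `ψ` is
represented by the pair of `ψ` and `√ε ∇_Γ ψ`. -/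
def h1Submodule (Ω : Set E3) (ε : ℝ) : Submodule ℂ (WithLp 2 (HHalf Ω × L2Vec Ω)) where
  carrier := {p | IsWeakTangentialGradient Ω (HHalf.toL2 Ω p.fst)
    (((√ε)⁻¹ : ℂ) • p.snd : L2Vec Ω)}
  add_mem' := by
    intro a b ha hb
    simpa using IsWeakTangentialGradient.add ha hb
  zero_mem' := by
    simpa using IsWeakTangentialGradient.zero Ω
  smul_mem' := by
    intro c a ha
    simpa [smul_comm c] using IsWeakTangentialGradient.smul c ha

/-- The space `X = H^{1/2}(Γ)` with the norm `‖ψ‖² = ‖ψ‖²_{H^{1/2}} + κ² ‖ψ‖²_{L²}`: a function `ψ`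
is represented by the pair of `ψ` and `κ ψ`. -/
def halfWeightedSubmodule (Ω : Set E3) (κ : ℝ) : Submodule ℂ (WithLp 2 (HHalf Ω × L2 Ω)) where
  carrier := {p | p.snd = (κ : ℂ) • HHalf.toL2 Ω p.fst}
  add_mem' := by
    intro a b (ha : a.snd = _) (hb : b.snd = _)
    change (a + b).snd = (κ : ℂ) • HHalf.toL2 Ω (a + b).fst
    rw [WithLp.add_snd, WithLp.add_fst, map_add, smul_add, ha, hb]
  zero_mem' := by
    change (0 : L2 Ω) = (κ : ℂ) • HHalf.toL2 Ω 0
    rw [map_zero, smul_zero]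
  smul_mem' := by
    intro c a (ha : a.snd = _)
    change (c • a).snd = (κ : ℂ) • HHalf.toL2 Ω (c • a).fst
    rw [WithLp.smul_snd, WithLp.smul_fst, map_smul, smul_comm, ha]

/-- The space `X = H¹(Γ)`. -/
def H1 (Ω : Set E3) (ε : ℝ) : Type := h1Submodule Ω ε

instance (Ω : Set E3) (ε : ℝ) : NormedAddCommGroup (H1 Ω ε) :=
  inferInstanceAs (NormedAddCommGroup (h1Submodule Ω ε))

instance (Ω : Set E3) (ε : ℝ) : InnerProductSpace ℂ (H1 Ω ε) :=
  inferInstanceAs (InnerProductSpace ℂ (h1Submodule Ω ε))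

/-- The embedding of `H¹(Γ)` in `H^{1/2}(Γ)`. -/
def H1.embed (Ω : Set E3) (ε : ℝ) : H1 Ω ε →L[ℂ] HHalf Ω := graphFst (h1Submodule Ω ε)

/-- The tangential gradient `∇_Γ : H¹(Γ) → L²(Γ)³`. -/
def H1.grad (Ω : Set E3) (ε : ℝ) : H1 Ω ε →L[ℂ] L2Vec Ω :=
  ((√ε)⁻¹ : ℂ) • graphSnd (h1Submodule Ω ε)

/-- The seminorm `|ψ|_X = √ε ‖∇_Γ ψ‖_{L²}`. -/
def H1.seminorm (Ω : Set E3) (ε : ℝ) : Seminorm ℂ (H1 Ω ε) :=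
  (√ε).toNNReal • (normSeminorm ℂ (L2Vec Ω)).comp (H1.grad Ω ε).toLinearMap

/-- The embedding of `H¹(Γ)` in `L²(Γ)`. -/
def H1.toL2 (Ω : Set E3) (ε : ℝ) : H1 Ω ε →L[ℂ] L2 Ω := (HHalf.toL2 Ω).comp (H1.embed Ω ε)

/-- The space `X = H^{1/2}(Γ)` with the weighted norm. -/
def HHalfWeighted (Ω : Set E3) (κ : ℝ) : Type := halfWeightedSubmodule Ω κ

instance (Ω : Set E3) (κ : ℝ) : NormedAddCommGroup (HHalfWeighted Ω κ) :=
  inferInstanceAs (NormedAddCommGroup (halfWeightedSubmodule Ω κ))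

instance (Ω : Set E3) (κ : ℝ) : InnerProductSpace ℂ (HHalfWeighted Ω κ) :=
  inferInstanceAs (InnerProductSpace ℂ (halfWeightedSubmodule Ω κ))

/-- The identity, from `H^{1/2}(Γ)` with the weighted norm to `H^{1/2}(Γ)`. -/
def HHalfWeighted.embed (Ω : Set E3) (κ : ℝ) : HHalfWeighted Ω κ →L[ℂ] HHalf Ω :=
  graphFst (halfWeightedSubmodule Ω κ)

/-- The embedding of `H^{1/2}(Γ)`, with the weighted norm, in `L²(Γ)`. -/
def HHalfWeighted.toL2 (Ω : Set E3) (κ : ℝ) : HHalfWeighted Ω κ →L[ℂ] L2 Ω :=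
  (HHalf.toL2 Ω).comp (HHalfWeighted.embed Ω κ)

/-- The seminorm `|ψ|_X = κ ‖ψ‖_{L²}`. -/
def HHalfWeighted.seminorm (Ω : Set E3) (κ : ℝ) : Seminorm ℂ (HHalfWeighted Ω κ) :=
  κ.toNNReal • (normSeminorm ℂ (L2 Ω)).comp (HHalfWeighted.toL2 Ω κ).toLinearMap

/-! ### Generalized impedance boundary conditions -/

/-- The anti-dual space `X'`. The anti-duality `⟨ψ, φ⟩`, anti-linear in `ψ`, is `φ ψ`. -/
abbrev AntiDual (X : Type*) [NormedAddCommGroup X] [NormedSpace ℂ X] : Type _ := X →L⋆[ℂ] ℂ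

/-- For `j : X → L`, the operator `L → X'` that takes `v` to the functional `ψ ↦ (j ψ, v)_L`. -/
def antiPairing {X L : Type*} [NormedAddCommGroup X] [NormedSpace ℂ X] [NormedAddCommGroup L]
    [InnerProductSpace ℂ L] (j : X →L[ℂ] L) : L →L[ℂ] AntiDual X :=
  ((ContinuousLinearMap.compSL X L ℂ (RingHom.id ℂ) (starRingEnd ℂ)).flip j).comp
    (innerSL ℂ (E := L)).flip

theorem antiPairing_apply {X L : Type*} [NormedAddCommGroup X] [NormedSpace ℂ X]
    [NormedAddCommGroup L] [InnerProductSpace ℂ L] (j : X →L[ℂ] L) (v : L) (ψ : X) :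
    antiPairing j v ψ = inner ℂ (j ψ) v := rfl

section Framework

variable {X H : Type*} [NormedAddCommGroup X] [InnerProductSpace ℂ X] [NormedAddCommGroup H]
  [NormedSpace ℂ H]

/-- `X`, with the embedding `ι : X → H` and the seminorm `p`, is a complex Hilbert space that is
densely and continuously embedded in `H`, with `‖ψ‖²_X = ‖ψ‖²_H + |ψ|²_X`. -/
structure IsAdmissibleSpace (ι : X →L[ℂ] H) (p : Seminorm ℂ X) : Prop where
  complete : CompleteSpace X
  injective : Function.Injective ι
  dense : DenseRange ι
  norm_sq : ∀ ψ : X, ‖ψ‖ ^ 2 = ‖ι ψ‖ ^ 2 + p ψ ^ 2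

/-- `F` is an analytic family on the right half-plane that is polynomially bounded with the
exponent `μ` and satisfies the positivity condition for all `σ > σ₀`. -/
structure IsTransferOperator (p : Seminorm ℂ X) (F : ℂ → X →L[ℂ] AntiDual X) (μ σ₀ : ℝ) :
    Prop where
  analytic : AnalyticOnNhd ℂ F {s | 0 < s.re}
  bound : ∀ σ > 0, ∃ M : ℝ, ∀ s : ℂ, σ ≤ s.re → ‖F s‖ ≤ M * ‖s‖ ^ μ
  nonneg : 0 ≤ σ₀
  pos : ∀ σ > σ₀, ∃ c > 0, ∀ (ψ : X) (s : ℂ), σ ≤ s.re → c * p (s⁻¹ • ψ) ^ 2 ≤ (F s ψ ψ).re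

/-- The inverse Laplace transform of `s⁻ⁿ F(s)` at the time `t`, as an integral along the line
`Re s = σ`. -/
def laplaceKernel (F : ℂ → X →L[ℂ] AntiDual X) (n : ℕ) (σ t : ℝ) : X →L[ℂ] AntiDual X :=
  (2 * Real.pi : ℂ)⁻¹ • ∫ w : ℝ,
    (Complex.exp ((σ + w * Complex.I) * t) * ((σ + w * Complex.I) ^ n)⁻¹) •
      F (σ + w * Complex.I)

/-- The temporal convolution `F(∂ₜ) g = (ℒ⁻¹ F) * g` for a function `g` of class `Cⁿ` on `ℝ` that
vanishes for `t ≤ 0`, where `F` is polynomially bounded with an exponent `μ < n - 1`: then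
`ℒ⁻¹ F = ∂ₜⁿ K` with the continuous kernel `K = ℒ⁻¹ (s⁻ⁿ F(s))`, which vanishes for `t ≤ 0`, and
`(ℒ⁻¹ F) * g = K * ∂ₜⁿ g`. -/
def temporalConvolution (F : ℂ → X →L[ℂ] AntiDual X) (n : ℕ) (σ : ℝ) (g : ℝ → X) (t : ℝ) :
    AntiDual X :=
  ∫ τ in (0 : ℝ)..t, laplaceKernel F n σ (t - τ) (iteratedDeriv n g τ)

/-- A boundary condition on `[0, T]` is a relation between the Dirichlet data `u : ℝ → X` and the
Neumann data `∂ₙu : ℝ → X'`. It is a generalized impedance boundary condition, with the transfer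
operator `F`, if it is equivalent to `∂ₙu = F(∂ₜ) ∂ₜu` on `[0, T]` for all sufficiently regular `u`
that vanish for `t ≤ 0`, where `F`, on the admissible space `X`, has the exponent `μ` in the
polynomial bound and the abscissa `σ₀` in the positivity condition. -/
structure IsGeneralizedImpedanceCondition (ι : X →L[ℂ] H) (p : Seminorm ℂ X)
    (BC : ℝ → (ℝ → X) → (ℝ → AntiDual X) → Prop) (F : ℂ → X →L[ℂ] AntiDual X) (μ σ₀ : ℝ) :
    Prop where
  space : IsAdmissibleSpace ι p
  transfer : IsTransferOperator p F μ σ₀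
  equiv : ∀ (n : ℕ) (σ T : ℝ), μ + 1 < n → 0 < σ → 0 < T →
    ∀ (u : ℝ → X) (dnu : ℝ → AntiDual X), ContDiff ℝ (n + 1 : ℕ) u → (∀ t ≤ 0, u t = 0) →
      (BC T u dnu ↔ ∀ t ∈ Icc 0 T, dnu t = temporalConvolution F n σ (deriv u) t)

end Framework

/-! ### The boundary conditions (A), (B1), (B2) and (C) -/

/-- The Laplace-Beltrami operator `Δ_Γ : H¹(Γ) → H¹(Γ)'`,
`⟨v, Δ_Γ u⟩ = -(∇_Γ v, ∇_Γ u)_{L²(Γ)³}`. -/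
def laplaceBeltrami (Ω : Set E3) (ε : ℝ) : H1 Ω ε →L[ℂ] AntiDual (H1 Ω ε) :=
  -(antiPairing (H1.grad Ω ε)).comp (H1.grad Ω ε)

/-- The inclusion `H¹(Γ) ⊆ L²(Γ) ⊆ H¹(Γ)'`. -/
def H1.incl (Ω : Set E3) (ε : ℝ) : H1 Ω ε →L[ℂ] AntiDual (H1 Ω ε) :=
  (antiPairing (H1.toL2 Ω ε)).comp (H1.toL2 Ω ε)

/-- The inclusion `X ⊆ L²(Γ) ⊆ X'` for `X = H^{1/2}(Γ)`. -/
def HHalfWeighted.incl (Ω : Set E3) (κ : ℝ) :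
    HHalfWeighted Ω κ →L[ℂ] AntiDual (HHalfWeighted Ω κ) :=
  (antiPairing (HHalfWeighted.toL2 Ω κ)).comp (HHalfWeighted.toL2 Ω κ)

/-- The thin coating condition (A): `∂ₙu = ε (∂ₜ²u - Δ_Γ u)`. -/
def thinCoating (Ω : Set E3) (ε T : ℝ) (u : ℝ → H1 Ω ε) (dnu : ℝ → AntiDual (H1 Ω ε)) : Prop :=
  ∀ t ∈ Icc 0 T, dnu t = (ε : ℂ) • (H1.incl Ω ε (iteratedDeriv 2 u t) - laplaceBeltrami Ω ε (u t))

/-- `F(s) = ε (s - Δ_Γ s⁻¹)`. -/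
def thinCoatingTransfer (Ω : Set E3) (ε : ℝ) (s : ℂ) : H1 Ω ε →L[ℂ] AntiDual (H1 Ω ε) :=
  (ε : ℂ) • (s • H1.incl Ω ε - s⁻¹ • laplaceBeltrami Ω ε)

/-- The Riemann-Liouville derivative of order `1/2` of a function on `t ≥ 0`. -/
def halfDeriv {V : Type*} [NormedAddCommGroup V] [NormedSpace ℝ V] (u : ℝ → V) (t : ℝ) : V :=
  deriv (fun r : ℝ => ∫ τ in (0 : ℝ)..r, (√(Real.pi * (r - τ)))⁻¹ • u τ) t

/-- The absorbing condition (B1): `∂ₙu = ε⁻¹ ∂ₜ^{1/2} u`. -/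
def absorbing1 (Ω : Set E3) (κ ε T : ℝ) (u : ℝ → HHalfWeighted Ω κ)
    (dnu : ℝ → AntiDual (HHalfWeighted Ω κ)) : Prop :=
  ∀ t ∈ Icc 0 T, dnu t = (ε⁻¹ : ℂ) • HHalfWeighted.incl Ω κ (halfDeriv u t)

/-- `F(s) = ε⁻¹ s^{-1/2}`. -/
def absorbing1Transfer (Ω : Set E3) (κ ε : ℝ) (s : ℂ) :
    HHalfWeighted Ω κ →L[ℂ] AntiDual (HHalfWeighted Ω κ) :=
  ((ε⁻¹ : ℂ) * s ^ (-(1 / 2) : ℂ)) • HHalfWeighted.incl Ω κ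

/-- `ρ` is a smooth defining function of the open set `Ω`, which therefore has a smooth boundary:
`Ω = {ρ > 0}` and `∇ρ ≠ 0` on `∂Ω`. -/
structure IsSmoothDefiningFunction (Ω : Set E3) (ρ : E3 → ℝ) : Prop where
  smooth : ContDiff ℝ ∞ ρ
  pos_iff : ∀ x, x ∈ Ω ↔ 0 < ρ x
  gradient_ne_zero : ∀ x ∈ frontier Ω, gradient ρ x ≠ 0

/-- The unit normal field `∇ρ / |∇ρ|`, which on `∂Ω` points into `Ω`. -/
def unitNormal (ρ : E3 → ℝ) (x : E3) : E3 := ‖gradient ρ x‖⁻¹ • gradient ρ x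

/-- The mean curvature `ℋ = div(∇ρ / |∇ρ|) / 2` of `∂Ω`, which is half the sum of the principal
curvatures; it is `1 / R` where `Ω` is the exterior of a ball of radius `R`. -/
def meanCurvature (ρ : E3 → ℝ) (x : E3) : ℝ :=
  LinearMap.trace ℝ E3 (fderiv ℝ (unitNormal ρ) x).toLinearMap / 2

theorem isCompact_frontier {Ω : Set E3} (hΩ : IsLipschitzExteriorDomain Ω) :
    IsCompact (frontier Ω) := by
  rw [← frontier_compl]
  exact Metric.isCompact_of_isClosed_isBounded isClosed_frontier
    (hΩ.bounded_compl.closure.subset frontier_subset_closure)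

theorem continuousAt_meanCurvature {ρ : E3 → ℝ} (hρ : ContDiff ℝ ∞ ρ) {x : E3}
    (hx : gradient ρ x ≠ 0) : ContinuousAt (meanCurvature ρ) x := by
  have h1 : ContDiff ℝ ∞ (gradient ρ) :=
    (InnerProductSpace.toDual ℝ E3).symm.toContinuousLinearEquiv.contDiff.comp
      (hρ.fderiv_right (m := ∞) (by simp))
  have h2 : ContDiffAt ℝ ∞ (unitNormal ρ) x :=
    ((h1.contDiffAt.norm ℝ hx).inv (by simpa using hx)).smul h1.contDiffAt
  have h3 : ContinuousAt (fderiv ℝ (unitNormal ρ)) x :=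
    (h2.fderiv_right (m := 0) (by simp)).continuousAt
  have h4 : Continuous fun A : E3 →L[ℝ] E3 => LinearMap.trace ℝ E3 A.toLinearMap :=
    LinearMap.continuous_of_finiteDimensional
      ((LinearMap.trace ℝ E3).comp (ContinuousLinearMap.coeLM ℝ))
  exact (h4.continuousAt.comp h3).div_const 2

theorem memLp_meanCurvature {Ω : Set E3} (hΩ : IsLipschitzExteriorDomain Ω) {ρ : E3 → ℝ}
    (hρ : IsSmoothDefiningFunction Ω ρ) :
    MemLp (fun x => (meanCurvature ρ x : ℂ)) ∞ (surfaceMeasure Ω) := by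
  have hc : ContinuousOn (fun x => (meanCurvature ρ x : ℂ)) (frontier Ω) := fun x hx =>
    (Complex.continuous_ofReal.continuousAt.comp
      (continuousAt_meanCurvature hρ.smooth (hρ.gradient_ne_zero x hx))).continuousWithinAt
  obtain ⟨C, hC⟩ := (isCompact_frontier hΩ).exists_bound_of_continuousOn hc
  exact memLp_top_of_bound (hc.aestronglyMeasurable isClosed_frontier.measurableSet) C
    ((ae_restrict_iff' isClosed_frontier.measurableSet).2 (Eventually.of_forall hC))

/-- Multiplication by the mean curvature, `L²(Γ) → L²(Γ)`. -/
def mulMeanCurvature {Ω : Set E3} (hΩ : IsLipschitzExteriorDomain Ω) {ρ : E3 → ℝ}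
    (hρ : IsSmoothDefiningFunction Ω ρ) : L2 Ω →L[ℂ] L2 Ω :=
  (ContinuousLinearMap.mul ℂ ℂ).holderL (surfaceMeasure Ω) ∞ 2 2
    (memLp_meanCurvature hΩ hρ).toLp

theorem mulMeanCurvature_ae {Ω : Set E3} (hΩ : IsLipschitzExteriorDomain Ω) {ρ : E3 → ℝ}
    (hρ : IsSmoothDefiningFunction Ω ρ) (v : L2 Ω) :
    mulMeanCurvature hΩ hρ v =ᵐ[surfaceMeasure Ω] fun x => (meanCurvature ρ x : ℂ) * v x := by
  have h1 := (ContinuousLinearMap.mul ℂ ℂ).coeFn_holder (r := 2) (memLp_meanCurvature hΩ hρ).toLp v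
  filter_upwards [h1, (memLp_meanCurvature hΩ hρ).coeFn_toLp] with x h1 h2
  rw [← h2]
  exact h1

/-- The operator `X → X'`, `ψ ↦ ℋ ψ`, for `X = H^{1/2}(Γ)`. -/
def curvatureIncl {Ω : Set E3} (hΩ : IsLipschitzExteriorDomain Ω) {ρ : E3 → ℝ}
    (hρ : IsSmoothDefiningFunction Ω ρ) (κ : ℝ) :
    HHalfWeighted Ω κ →L[ℂ] AntiDual (HHalfWeighted Ω κ) :=
  (antiPairing (HHalfWeighted.toL2 Ω κ)).comp
    ((mulMeanCurvature hΩ hρ).comp (HHalfWeighted.toL2 Ω κ))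

/-- The absorbing condition (B2): `∂ₙu = ε⁻¹ ∂ₜ^{1/2} u - ℋ u`. -/
def absorbing2 {Ω : Set E3} (hΩ : IsLipschitzExteriorDomain Ω) {ρ : E3 → ℝ}
    (hρ : IsSmoothDefiningFunction Ω ρ) (κ ε T : ℝ) (u : ℝ → HHalfWeighted Ω κ)
    (dnu : ℝ → AntiDual (HHalfWeighted Ω κ)) : Prop :=
  ∀ t ∈ Icc 0 T, dnu t =
    (ε⁻¹ : ℂ) • HHalfWeighted.incl Ω κ (halfDeriv u t) - curvatureIncl hΩ hρ κ (u t)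

/-- `F(s) = ε⁻¹ s^{-1/2} - ℋ s⁻¹`. -/
def absorbing2Transfer {Ω : Set E3} (hΩ : IsLipschitzExteriorDomain Ω) {ρ : E3 → ℝ}
    (hρ : IsSmoothDefiningFunction Ω ρ) (κ ε : ℝ) (s : ℂ) :
    HHalfWeighted Ω κ →L[ℂ] AntiDual (HHalfWeighted Ω κ) :=
  ((ε⁻¹ : ℂ) * s ^ (-(1 / 2) : ℂ)) • HHalfWeighted.incl Ω κ - s⁻¹ • curvatureIncl hΩ hρ κ

/-- The maximum of the mean curvature on `∂Ω`. -/
def maxMeanCurvature (Ω : Set E3) (ρ : E3 → ℝ) : ℝ := sSup (meanCurvature ρ '' frontier Ω)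

/-- The acoustic condition (C): there is a function `δ : [0, T] → X'` with
`m ∂ₜ²δ + α ∂ₜδ + k δ + ∂ₜu = 0`, `∂ₜδ = -∂ₙu` and `δ(0) = ∂ₜδ(0) = 0`. -/
def acoustic (Ω : Set E3) (m α k T : ℝ) (u : ℝ → HHalfWeighted Ω 0)
    (dnu : ℝ → AntiDual (HHalfWeighted Ω 0)) : Prop :=
  ∃ δ δ' δ'' : ℝ → AntiDual (HHalfWeighted Ω 0), δ 0 = 0 ∧ δ' 0 = 0 ∧ ∀ t ∈ Icc 0 T,
    HasDerivWithinAt δ (δ' t) (Icc 0 T) t ∧ HasDerivWithinAt δ' (δ'' t) (Icc 0 T) t ∧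
      (m : ℂ) • δ'' t + (α : ℂ) • δ' t + (k : ℂ) • δ t + HHalfWeighted.incl Ω 0 (deriv u t) = 0 ∧
      δ' t = -dnu t

/-- `F(s) = (m s + α + k s⁻¹)⁻¹`. -/
def acousticTransfer (Ω : Set E3) (m α k : ℝ) (s : ℂ) :
    HHalfWeighted Ω 0 →L[ℂ] AntiDual (HHalfWeighted Ω 0) :=
  (m * s + α + k * s⁻¹)⁻¹ • HHalfWeighted.incl Ω 0

end Gibc

end

open Gibc

/-! The proof combines frequency-domain estimates, an identification of convolutions, and function
space theory on Γ.

Frequency domain. Every transfer operator has the form φ(s)A − ψ(s)B with scalar holomorphic φ, ψ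
and fixed operators A, B, so analyticity and polynomial bounds are scalar questions
(`isTransferOperator_of_eq_smul_sub`). Positivity in (A) comes from Re s⁻¹ = Re s / |s|². In (B1),
s^(-1/2) stays in the sector |arg| < π/4, where the real part is comparable to the modulus. In (B2),
Re s⁻¹ ≤ σ^(-1/2) Re s^(-1/2), so the first term absorbs the curvature term as soon as ε⁻¹ > M
σ^(-1/2) with M = max(0, max ℋ); this is the abscissa. In (C) the seminorm is zero and Re F is
nonnegative.

Time domain. Fourier inversion turns s^(-a), a > 1, into t^(a-1)/Γ(a) (`invLaplace_cpow`), and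
integration by parts cancels the n derivatives of g = ∂ₜu against s^(-n)
(`causalConv_fracKernel_iteratedDeriv`). What remains is u, ∂ₜ²u or the half derivative. In (C) the
kernel is not computed: contour shifts give causality, division by s is integration
(`LaplaceDecay.invLaplace_div`), hence the convolution solves the oscillator equation
(`oscillator_causalConv`), and uniqueness for that equation gives the equivalence.

Spaces. The spaces are closed graphs, hence complete. The hard case is (A). A function with a
gradient in L² has a finite Sobolev-Slobodeckij seminorm (`slobodeckij_lt_top`): its differences in
a chart are O(|h|) in L², and |h|⁻³|h|² is integrable in the plane. The gradient is unique
(`eq_zero_of_isWeakTangentialGradient_zero`), so the embedding in H^{1/2} is injective. For density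
(`H1.denseRange_embed`), u in H^{1/2} is averaged over balls of radius about r. The averages are
restrictions to Γ of C¹ functions on space, and since the surface measure of a ball of small radius
r about a point of Γ is comparable to r², the squared H^{1/2} error is bounded by the part of the
double integral of u with |x − y| < 3r, which tends to zero. -/

/-! ### Inverse Laplace transforms of scalar functions -/

/-- The Laplace transform of `t ^ (a - 1)`. -/
theorem integral_rpow_mul_cexp {a : ℝ} (ha : 0 < a) {s : ℂ} (hs : 0 < s.re) :
    IntegrableOn (fun t : ℝ => ((t ^ (a - 1) : ℝ) : ℂ) * Complex.exp (-(s * t))) (Ioi 0) ∧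
    ∫ t : ℝ in Ioi 0, ((t ^ (a - 1) : ℝ) : ℂ) * Complex.exp (-(s * t)) =
      s ^ (-a : ℂ) * Complex.Gamma a := by
  set d : ℝ → ℝ≥0 := fun t => (t ^ (a - 1)).toNNReal with hd
  have hdm : Measurable d := by fun_prop
  -- The integral is the complex moment generating function of this measure at −z, which is
  -- holomorphic wherever −Re z is interior to the set of exponents of integrability.
  set ν : Measure ℝ := (volume.restrict (Ioi 0)).withDensity (fun t => (d t : ℝ≥0∞)) with hν
  have key : ∀ z : ℂ, (fun t : ℝ => d t • Complex.exp (z * t)) =ᵐ[volume.restrict (Ioi 0)]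
      fun t => ((t ^ (a - 1) : ℝ) : ℂ) * Complex.exp (z * t) := by
    intro z
    filter_upwards [ae_restrict_mem measurableSet_Ioi] with t ht
    rw [NNReal.smul_def, Real.coe_toNNReal _ (Real.rpow_nonneg (le_of_lt ht) _), Complex.real_smul]
  have hreal : ∀ r : ℝ, 0 < r → IntegrableOn (fun t : ℝ => t ^ (a - 1) * Real.exp (-(r * t))) (Ioi 0) := by
    intro r hr
    have := integrableOn_rpow_mul_exp_neg_mul_rpow (p := 1) (s := a - 1) (by linarith) one_pos hr
    simpa using this
  have hint : ∀ z : ℂ, 0 < z.re →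
      IntegrableOn (fun t : ℝ => ((t ^ (a - 1) : ℝ) : ℂ) * Complex.exp (-(z * t))) (Ioi 0) := by
    intro z hz
    refine (hreal z.re hz).mono' (by fun_prop) ?_
    filter_upwards [ae_restrict_mem measurableSet_Ioi] with t ht
    rw [norm_mul, Complex.norm_real, Complex.norm_exp, Real.norm_of_nonneg (Real.rpow_nonneg (le_of_lt ht) _)]
    simp
  have hmgf : ∀ z : ℂ, ProbabilityTheory.complexMGF (fun t : ℝ => t) ν z =
      ∫ t : ℝ in Ioi 0, ((t ^ (a - 1) : ℝ) : ℂ) * Complex.exp (z * t) := by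
    intro z
    rw [ProbabilityTheory.complexMGF, hν, integral_withDensity_eq_integral_smul hdm]
    exact integral_congr_ae (key z)
  have hset : Iio 0 ⊆ ProbabilityTheory.integrableExpSet (fun t : ℝ => t) ν := by
    intro r hr
    have hr : r < 0 := hr
    rw [ProbabilityTheory.integrableExpSet, Set.mem_ofPred_eq, hν,
      integrable_withDensity_iff_integrable_smul hdm]
    refine (hreal (-r) (by linarith)).congr ?_
    filter_upwards [ae_restrict_mem measurableSet_Ioi] with t ht
    rw [NNReal.smul_def, Real.coe_toNNReal _ (Real.rpow_nonneg (le_of_lt ht) _), smul_eq_mul]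
    simp
  have hset' : Iio 0 ⊆ interior (ProbabilityTheory.integrableExpSet (fun t : ℝ => t) ν) :=
    interior_maximal hset isOpen_Iio
  refine ⟨hint s hs, ?_⟩
  have hopen : IsOpen {z : ℂ | 0 < z.re} := isOpen_lt continuous_const Complex.continuous_re
  have hf : AnalyticOnNhd ℂ (fun z : ℂ => ProbabilityTheory.complexMGF (fun t : ℝ => t) ν (-z))
      {z | 0 < z.re} := by
    refine DifferentiableOn.analyticOnNhd (fun z hz => ?_) hopen
    have hz' : (-z).re ∈ interior (ProbabilityTheory.integrableExpSet (fun t : ℝ => t) ν) :=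
      hset' (by simpa using hz)
    exact ((ProbabilityTheory.hasDerivAt_complexMGF hz').comp z (hasDerivAt_neg z)).differentiableAt.differentiableWithinAt
  have hg : AnalyticOnNhd ℂ (fun z : ℂ => z ^ (-a : ℂ) * Complex.Gamma a) {z | 0 < z.re} := by
    refine DifferentiableOn.analyticOnNhd (fun z hz => ?_) hopen
    refine DifferentiableAt.differentiableWithinAt ?_
    refine DifferentiableAt.mul ?_ (differentiableAt_const _)
    exact DifferentiableAt.cpow (differentiableAt_id) (differentiableAt_const _) (Or.inl hz)
  have hfg : EqOn (fun z : ℂ => ProbabilityTheory.complexMGF (fun t : ℝ => t) ν (-z))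
      (fun z : ℂ => z ^ (-a : ℂ) * Complex.Gamma a) {z | 0 < z.re} := by
    -- Identity theorem: both sides are holomorphic on the half-plane and agree at positive reals,
    -- where the claim is the Gamma integral; these accumulate at 1.
    refine hf.eqOn_of_preconnected_of_frequently_eq hg (z₀ := 1)
      ((convex_halfSpace_re_gt 0).isPreconnected) (by simp) ?_
    have hr : ∀ r : ℝ, 0 < r → ProbabilityTheory.complexMGF (fun t : ℝ => t) ν (-(r : ℂ)) =
        (r : ℂ) ^ (-a : ℂ) * Complex.Gamma a := by
      intro r hr
      rw [hmgf]
      have h1 := Complex.integral_cpow_mul_exp_neg_mul_Ioi (a := a) (by simpa using ha) hr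
      rw [Complex.cpow_neg, ← Complex.inv_cpow _ _ (by
        rw [Complex.arg_ofReal_of_nonneg hr.le]; exact Real.pi_pos.ne), ← one_div, ← h1]
      refine setIntegral_congr_fun measurableSet_Ioi fun t ht => ?_
      have ht : 0 < t := ht
      simp only [neg_mul]
      rw [Complex.ofReal_cpow ht.le]
      push_cast
      rfl
    have ht : Tendsto (fun r : ℝ => (r : ℂ)) (𝓝[≠] 1) (𝓝[≠] 1) := by
      refine tendsto_nhdsWithin_iff.2 ⟨?_, ?_⟩
      · exact (Complex.continuous_ofReal.tendsto' 1 1 (by simp)).mono_left nhdsWithin_le_nhds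
      · filter_upwards [self_mem_nhdsWithin] with r hr
        simpa using hr
    refine ht.frequently (Eventually.frequently ?_)
    filter_upwards [mem_nhdsWithin_of_mem_nhds (lt_mem_nhds (zero_lt_one (α := ℝ)))] with r hr0
    exact hr r hr0
  have := hfg hs
  simp only [hmgf, neg_mul] at this
  exact this

/-- The inverse Laplace transform, as an integral along the line `Re s = σ`. -/
noncomputable def invLaplace (φ : ℂ → ℂ) (σ t : ℝ) : ℂ :=
  (2 * Real.pi : ℂ)⁻¹ * ∫ w : ℝ,
    Complex.exp ((σ + w * Complex.I) * t) * φ (σ + w * Complex.I)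

/-- Since σ² + w² ≥ min(1, σ²)(1 + w²), the integrand is dominated by a multiple of (1 + w²)^(-a/2).
-/
theorem integrable_norm_line {a σ : ℝ} (ha : 1 < a) (hσ : 0 < σ) :
    Integrable fun w : ℝ => ‖(σ + w * Complex.I : ℂ)‖ ^ (-a) := by
  have h1 := integrable_rpow_neg_one_add_norm_sq (E := ℝ) (r := a) (μ := volume) (by simpa using ha)
  set c : ℝ := min 1 (σ ^ 2) with hc
  have hc0 : 0 < c := lt_min one_pos (by positivity)
  refine (h1.const_mul (c ^ (-a / 2))).mono' ?_ (Eventually.of_forall fun w => ?_)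
  · refine Continuous.aestronglyMeasurable ?_
    refine Continuous.rpow_const (by fun_prop) fun w => Or.inl ?_
    rw [norm_ne_zero_iff]
    intro h
    have := congrArg Complex.re h
    simp at this
    exact hσ.ne' this
  · have h2 : ‖(σ + w * Complex.I : ℂ)‖ ^ 2 = σ ^ 2 + w ^ 2 := by
      rw [← Complex.normSq_eq_norm_sq, Complex.normSq_add_mul_I]
    rw [Real.norm_of_nonneg (by positivity), ← Real.mul_rpow hc0.le (by positivity)]
    have h3 : ‖(σ + w * Complex.I : ℂ)‖ ^ (-a) = (σ ^ 2 + w ^ 2) ^ (-a / 2) := by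
      rw [← h2, ← Real.rpow_natCast, ← Real.rpow_mul (norm_nonneg _)]
      congr 1
      push_cast
      ring
    rw [h3]
    refine Real.rpow_le_rpow_of_nonpos (by positivity) ?_ (by linarith)
    rw [Real.norm_eq_abs, sq_abs, mul_add, mul_one]
    refine add_le_add (min_le_right _ _) ?_
    exact (mul_le_mul_of_nonneg_right (min_le_left _ _) (sq_nonneg w)).trans (by simp)

theorem continuous_rpow_max_zero {b : ℝ} (hb : 0 < b) :
    Continuous fun t : ℝ => (max t 0) ^ b :=
  Continuous.rpow_const (by fun_prop) fun _ => Or.inr hb.le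

/-- The inverse Laplace transform of `s ^ (-a)`. -/
theorem invLaplace_cpow {a σ : ℝ} (ha : 1 < a) (hσ : 0 < σ) (t : ℝ) :
    invLaplace (fun s => s ^ (-a : ℂ)) σ t = (((max t 0) ^ (a - 1) / Real.Gamma a : ℝ) : ℂ) := by
  have ha0 : 0 < a := by linarith
  -- The damped power e^(-σt) t^(a-1)/Γ(a), extended by zero, has the Fourier transform (σ +
  -- 2πiw)^(-a). The condition a > 1 makes `h` continuous and its transform integrable, so Fourier
  -- inversion holds at every point.
  set h : ℝ → ℂ := fun t => (((max t 0) ^ (a - 1) * Real.exp (-(σ * t)) / Real.Gamma a : ℝ) : ℂ)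
    with hh
  have hcont : Continuous h := by
    have := continuous_rpow_max_zero (b := a - 1) (by linarith)
    simp only [hh]
    fun_prop
  have hzero : ∀ t ≤ 0, h t = 0 := by
    intro t ht
    simp [hh, max_eq_right ht, Real.zero_rpow (by linarith : a - 1 ≠ 0)]
  have hpos : ∀ (z : ℂ) (t : ℝ), 0 < t → Complex.exp (-(z * t)) * h t =
      (((t ^ (a - 1) : ℝ) : ℂ) * Complex.exp (-((σ + z) * t))) * (Complex.Gamma a)⁻¹ := by
    intro z t ht
    rw [hh, Complex.Gamma_ofReal]
    simp only [max_eq_left ht.le]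
    have : -((σ + z) * t) = -(z * t) + ((-(σ * t) : ℝ) : ℂ) := by push_cast; ring
    rw [this, Complex.exp_add]
    push_cast
    ring
  have hint : Integrable h := by
    have h1 : IntegrableOn h (Ioi 0) := by
      have := ((integral_rpow_mul_cexp ha0 (s := σ) (by simpa using hσ)).1).mul_const
        (Complex.Gamma a)⁻¹
      refine this.congr ?_
      filter_upwards [ae_restrict_mem measurableSet_Ioi] with t ht
      have := hpos 0 t ht
      simp only [zero_mul, neg_zero, Complex.exp_zero, one_mul, add_zero] at this
      exact this.symm
    refine (integrableOn_iff_integrable_of_support_subset ?_).1 h1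
    intro t ht
    by_contra hn
    exact ht (hzero t (not_lt.1 hn))
  have hF : ∀ w : ℝ, FourierTransform.fourier h w = (σ + (2 * Real.pi * w : ℝ) * Complex.I) ^ (-a : ℂ) := by
    intro w
    rw [Real.fourier_real_eq_integral_exp_smul]
    have h1 : ∀ v : ℝ, Complex.exp (↑(-2 * Real.pi * v * w) * Complex.I) • h v =
        Complex.exp (-(((2 * Real.pi * w : ℝ) * Complex.I) * v)) * h v := by
      intro v
      rw [smul_eq_mul]
      congr 2
      push_cast
      ring
    simp_rw [h1]
    rw [← integral_add_compl (s := Ioi (0:ℝ)) measurableSet_Ioi, setIntegral_eq_zero_of_forall_eq_zero (t := (Ioi (0:ℝ))ᶜ), add_zero]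
    · rw [setIntegral_congr_fun measurableSet_Ioi (fun t ht => hpos _ t ht), integral_mul_const,
        (integral_rpow_mul_cexp ha0 (by simpa using hσ)).2, mul_assoc, mul_inv_cancel₀, mul_one]
      exact Complex.Gamma_ne_zero_of_re_pos (by simpa using ha0)
    · intro t ht
      rw [hzero t (by simpa using ht), mul_zero]
    · refine hint.norm.mono' ?_ (Eventually.of_forall fun v => ?_)
      · exact (Continuous.mul (by fun_prop) hcont).aestronglyMeasurable
      · rw [norm_mul, Complex.norm_exp]
        simp
  have hcpow : ∀ w : ℝ, ‖(σ + w * Complex.I : ℂ) ^ (-a : ℂ)‖ = ‖(σ + w * Complex.I : ℂ)‖ ^ (-a) := by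
    intro w
    have := Complex.norm_cpow_real (σ + w * Complex.I) (-a)
    simpa using this
  have hcc : Continuous fun w : ℝ => (σ + w * Complex.I : ℂ) ^ (-a : ℂ) := by
    refine Continuous.cpow (by fun_prop) continuous_const fun w => Or.inl ?_
    simpa using hσ
  have hline : Integrable fun w : ℝ => (σ + w * Complex.I : ℂ) ^ (-a : ℂ) := by
    refine (integrable_norm_line ha hσ).mono' hcc.aestronglyMeasurable (Eventually.of_forall fun w => ?_)
    rw [hcpow]
  have hFint : Integrable (FourierTransform.fourier h) := by
    have := hline.comp_mul_left' (R := 2 * Real.pi) (by positivity)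
    refine this.congr (Eventually.of_forall fun w => ?_)
    simp only [hF]
  have hinv := congrFun (hcont.fourierInv_fourier_eq hint hFint) t
  rw [Real.fourierInv_eq'] at hinv
  simp only [hF] at hinv
  have h2 : ∀ w : ℝ, Complex.exp (↑(2 * Real.pi * inner ℝ w t) * Complex.I) •
      ((σ : ℂ) + (2 * Real.pi * w : ℝ) * Complex.I) ^ (-a : ℂ) =
      (fun w : ℝ => Complex.exp (w * Complex.I * t) * (σ + w * Complex.I) ^ (-a : ℂ)) (2 * Real.pi * w) := by
    intro w
    simp only [smul_eq_mul]
    congr 2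
    simp
    ring
  simp_rw [h2] at hinv
  rw [Measure.integral_comp_mul_left (fun w : ℝ => Complex.exp (w * Complex.I * t) *
    (σ + w * Complex.I) ^ (-a : ℂ)) (2 * Real.pi)] at hinv
  rw [invLaplace]
  have h3 : ∀ w : ℝ, Complex.exp ((σ + w * Complex.I) * t) * (σ + w * Complex.I : ℂ) ^ (-a : ℂ) =
      Complex.exp (σ * t) * (Complex.exp (w * Complex.I * t) * (σ + w * Complex.I) ^ (-a : ℂ)) := by
    intro w
    rw [add_mul, Complex.exp_add, mul_assoc]
  simp_rw [h3]
  rw [integral_const_mul]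
  have h4 : (2 * Real.pi : ℂ)⁻¹ * ∫ w : ℝ, Complex.exp (w * Complex.I * t) *
      (σ + w * Complex.I : ℂ) ^ (-a : ℂ) = h t := by
    rw [← hinv, abs_of_pos (by positivity), Complex.real_smul]
    push_cast
    rfl
  rw [mul_left_comm, h4, hh]
  simp only
  rw [← Complex.ofReal_mul, ← Complex.ofReal_exp, ← Complex.ofReal_mul]
  congr 1
  rw [Real.exp_neg]
  field_simp

/-! ### Contour shifts: causality of inverse transforms and division by s. -/

/-- `φ` is holomorphic on the right half-plane and `O(|s| ^ (-a))`, `a > 1`, for `Re s ≥ σ`. -/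
structure LaplaceDecay (φ : ℂ → ℂ) (σ : ℝ) : Prop where
  pos : 0 < σ
  diff : DifferentiableOn ℂ φ {s | 0 < s.re}
  bound : ∃ a M : ℝ, 1 < a ∧ ∀ s : ℂ, σ ≤ s.re → ‖φ s‖ ≤ M * ‖s‖ ^ (-a)

theorem LaplaceDecay.continuous_line {φ : ℂ → ℂ} {σ : ℝ} (h : LaplaceDecay φ σ) {R : ℝ}
    (hR : σ ≤ R) : Continuous fun w : ℝ => φ (R + w * Complex.I) := by
  refine h.diff.continuousOn.comp_continuous (by fun_prop) fun w => ?_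
  have := h.pos
  simp
  linarith

theorem LaplaceDecay.integrable_line {φ : ℂ → ℂ} {σ : ℝ} (h : LaplaceDecay φ σ) {R : ℝ}
    (hR : σ ≤ R) : Integrable fun w : ℝ => φ (R + w * Complex.I) := by
  obtain ⟨a, M, ha, hM⟩ := h.bound
  refine ((integrable_norm_line ha (h.pos.trans_le hR)).const_mul M).mono'
    (h.continuous_line hR).aestronglyMeasurable (Eventually.of_forall fun w => hM _ ?_)
  simpa using hR

/-- Cauchy's theorem on the rectangle [σ, R] × [−W, W] with W → ∞ makes the integral independent of
the abscissa, because the horizontal sides are O(W^(-a)). Letting R → ∞ then shows that its value is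
zero. -/
theorem LaplaceDecay.integral_line_eq_zero {φ : ℂ → ℂ} {σ : ℝ} (h : LaplaceDecay φ σ) :
    ∫ w : ℝ, φ (σ + w * Complex.I) = 0 := by
  obtain ⟨a, M, ha, hM⟩ := h.bound
  have hσ := h.pos
  have hM0 : 0 ≤ M := by
    have := (norm_nonneg _).trans (hM σ (by simp))
    have h2 : 0 < ‖(σ : ℂ)‖ ^ (-a) := Real.rpow_pos_of_pos (by simpa using hσ.ne') _
    exact nonneg_of_mul_nonneg_left this h2
  have hshift : ∀ R : ℝ, σ ≤ R →
      ∫ w : ℝ, φ (R + w * Complex.I) = ∫ w : ℝ, φ (σ + w * Complex.I) := by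
    intro R hR
    have hside : ∀ e : ℝ, |e| = 1 → Tendsto (fun W : ℝ => ∫ x : ℝ in σ..R,
        φ (x + ((e * W : ℝ) : ℂ) * Complex.I)) atTop (𝓝 0) := by
      intro e he
      have h0 : Tendsto (fun W : ℝ => M * W ^ (-a) * |R - σ|) atTop (𝓝 0) := by
        have := ((tendsto_rpow_neg_atTop (by linarith : 0 < a)).const_mul M).mul_const |R - σ|
        simpa using this
      refine squeeze_zero_norm' ?_ h0
      filter_upwards [eventually_gt_atTop 0] with W hW
      refine intervalIntegral.norm_integral_le_of_norm_le_const fun x hx => ?_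
      rw [uIoc_of_le hR] at hx
      refine (hM _ (by simpa using hx.1.le)).trans ?_
      refine mul_le_mul_of_nonneg_left ?_ hM0
      refine Real.rpow_le_rpow_of_nonpos hW ?_ (by linarith)
      have := Complex.abs_im_le_norm (x + ((e * W : ℝ) : ℂ) * Complex.I)
      simpa [abs_mul, he, abs_of_pos hW] using this
    have hline : ∀ Q : ℝ, σ ≤ Q → Tendsto (fun W : ℝ => ∫ y : ℝ in (-W)..W,
        φ (Q + y * Complex.I)) atTop (𝓝 (∫ w : ℝ, φ (Q + w * Complex.I))) := fun Q hQ =>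
      intervalIntegral_tendsto_integral (h.integrable_line hQ) tendsto_neg_atTop_atBot tendsto_id
    have hrect : ∀ W : ℝ, (∫ x : ℝ in σ..R, φ (x + ((-1 * W : ℝ) : ℂ) * Complex.I)) -
        (∫ x : ℝ in σ..R, φ (x + ((1 * W : ℝ) : ℂ) * Complex.I)) +
        Complex.I * (∫ y : ℝ in (-W)..W, φ (R + y * Complex.I)) -
        Complex.I * (∫ y : ℝ in (-W)..W, φ (σ + y * Complex.I)) = 0 := by
      intro W
      have := Complex.integral_boundary_rect_eq_zero_of_differentiableOn φ
        (σ + ((-W : ℝ) : ℂ) * Complex.I) (R + (W : ℂ) * Complex.I) (h.diff.mono ?_)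
      · simpa using this
      · intro z hz
        have hz := hz.1
        simp only [Complex.add_re, Complex.ofReal_re, Complex.mul_re, Complex.I_re, mul_zero,
          Complex.ofReal_im, Complex.I_im, mul_one, sub_zero, add_zero, mem_preimage,
          uIcc_of_le hR] at hz
        exact hσ.trans_le hz.1
    have hlim := (((hside (-1) (by simp)).sub (hside 1 (by simp))).add
      ((hline R hR).const_mul Complex.I)).sub ((hline σ le_rfl).const_mul Complex.I)
    have := tendsto_nhds_unique (hlim.congr hrect) tendsto_const_nhds
    rw [sub_zero, zero_add, ← mul_sub] at this
    have := (mul_eq_zero.1 this).resolve_left Complex.I_ne_zero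
    exact sub_eq_zero.1 this
  -- Pointwise the integrand is O(R^(-a)), and the bound on the line Re s = σ dominates it for all R
  -- ≥ σ.
  have hlim : Tendsto (fun R : ℝ => ∫ w : ℝ, φ (R + w * Complex.I)) atTop (𝓝 (∫ _ : ℝ, (0 : ℂ))) := by
    refine tendsto_integral_filter_of_dominated_convergence
      (fun w => M * ‖(σ + w * Complex.I : ℂ)‖ ^ (-a)) ?_ ?_
      ((integrable_norm_line ha hσ).const_mul M) ?_
    · filter_upwards [eventually_ge_atTop σ] with R hR
      exact (h.continuous_line hR).aestronglyMeasurable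
    · filter_upwards [eventually_ge_atTop σ] with R hR
      refine Eventually.of_forall fun w => (hM _ (by simpa using hR)).trans ?_
      refine mul_le_mul_of_nonneg_left ?_ hM0
      refine Real.rpow_le_rpow_of_nonpos ?_ ?_ (by linarith)
      · rw [norm_pos_iff]
        intro h0
        have := congrArg Complex.re h0
        simp at this
        exact hσ.ne' this
      · rw [← abs_of_nonneg (norm_nonneg (σ + w * Complex.I : ℂ)),
          ← abs_of_nonneg (norm_nonneg (R + w * Complex.I : ℂ)), ← sq_le_sq,
          ← Complex.normSq_eq_norm_sq, ← Complex.normSq_eq_norm_sq, Complex.normSq_add_mul_I,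
          Complex.normSq_add_mul_I]
        gcongr
    · refine Eventually.of_forall fun w => ?_
      have h0 : Tendsto (fun R : ℝ => M * R ^ (-a)) atTop (𝓝 0) := by
        simpa using (tendsto_rpow_neg_atTop (by linarith : 0 < a)).const_mul M
      refine squeeze_zero_norm' ?_ h0
      filter_upwards [eventually_ge_atTop σ] with R hR
      refine (hM _ (by simpa using hR)).trans ?_
      refine mul_le_mul_of_nonneg_left ?_ hM0
      refine Real.rpow_le_rpow_of_nonpos (hσ.trans_le hR) ?_ (by linarith)
      have := Complex.re_le_norm (R + w * Complex.I : ℂ)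
      simpa using this
  rw [integral_zero] at hlim
  have hconst : (fun _ : ℝ => ∫ w : ℝ, φ (σ + w * Complex.I)) =ᶠ[atTop]
      fun R : ℝ => ∫ w : ℝ, φ (R + w * Complex.I) := by
    filter_upwards [eventually_ge_atTop σ] with R hR
    exact (hshift R hR).symm
  exact tendsto_nhds_unique tendsto_const_nhds (hlim.congr' hconst.symm)

/-- For t ≤ 0 the factor e^(st) has modulus at most one on the right half-plane, so it does not
disturb the decay of φ. -/
theorem LaplaceDecay.invLaplace_eq_zero {φ : ℂ → ℂ} {σ : ℝ} (h : LaplaceDecay φ σ) {t : ℝ}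
    (ht : t ≤ 0) : invLaplace φ σ t = 0 := by
  have : LaplaceDecay (fun s => Complex.exp (s * t) * φ s) σ := by
    obtain ⟨a, M, ha, hM⟩ := h.bound
    refine ⟨h.pos, DifferentiableOn.mul (by fun_prop) h.diff, a, M, ha, fun s hs => ?_⟩
    refine le_trans ?_ (hM s hs)
    rw [norm_mul]
    refine mul_le_of_le_one_left (norm_nonneg _) ?_
    rw [Complex.norm_exp, Real.exp_le_one_iff]
    simp
    nlinarith [h.pos]
  rw [invLaplace, this.integral_line_eq_zero, mul_zero]

theorem LaplaceDecay.integrable_invLaplace {φ : ℂ → ℂ} {σ : ℝ} (h : LaplaceDecay φ σ) (t : ℝ) :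
    Integrable fun w : ℝ => Complex.exp ((σ + w * Complex.I) * t) * φ (σ + w * Complex.I) := by
  have := (h.integrable_line le_rfl).bdd_mul (c := Real.exp (σ * t))
    (f := fun w : ℝ => Complex.exp ((σ + w * Complex.I) * t))
    (Continuous.aestronglyMeasurable (by fun_prop)) (Eventually.of_forall fun w => ?_)
  · exact this
  · rw [Complex.norm_exp]
    simp

theorem LaplaceDecay.continuous_invLaplace {φ : ℂ → ℂ} {σ : ℝ} (h : LaplaceDecay φ σ) :
    Continuous (invLaplace φ σ) := by
  have h1 : ∀ t : ℝ, invLaplace φ σ t = (2 * Real.pi : ℂ)⁻¹ * (Complex.exp (σ * t) *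
      ∫ w : ℝ, Complex.exp (w * Complex.I * t) * φ (σ + w * Complex.I)) := by
    intro t
    rw [invLaplace, ← integral_const_mul (Complex.exp (σ * t))]
    simp_rw [add_mul, Complex.exp_add, mul_assoc]
  have h2 : Continuous fun t : ℝ =>
      ∫ w : ℝ, Complex.exp (w * Complex.I * t) * φ (σ + w * Complex.I) := by
    refine continuous_of_dominated (bound := fun w => ‖φ (σ + w * Complex.I)‖) ?_ ?_
      (h.integrable_line le_rfl).norm ?_
    · intro t
      exact (Continuous.mul (by fun_prop) (h.continuous_line le_rfl)).aestronglyMeasurable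
    · refine fun t => Eventually.of_forall fun w => ?_
      rw [norm_mul, Complex.norm_exp]
      simp
    · exact Eventually.of_forall fun w => by fun_prop
  rw [funext h1]
  fun_prop

theorem LaplaceDecay.div {φ : ℂ → ℂ} {σ : ℝ} (h : LaplaceDecay φ σ) :
    LaplaceDecay (fun s => φ s * s⁻¹) σ := by
  obtain ⟨a, M, ha, hM⟩ := h.bound
  refine ⟨h.pos, h.diff.mul ?_, a + 1, M, by linarith, fun s hs => ?_⟩
  · refine DifferentiableOn.inv differentiableOn_id fun s hs h0 => ?_
    have hs : 0 < s.re := hs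
    rw [show s = 0 from h0] at hs
    simp at hs
  · have hs0 : 0 < ‖s‖ := (h.pos.trans_le hs).trans_le (Complex.re_le_norm s)
    rw [norm_mul, norm_inv, neg_add, Real.rpow_add hs0, Real.rpow_neg_one, ← mul_assoc]
    gcongr
    exact hM s hs

/-- Division by `s` corresponds to integration from zero. -/
theorem LaplaceDecay.invLaplace_div {φ : ℂ → ℂ} {σ : ℝ} (h : LaplaceDecay φ σ) (t : ℝ) :
    invLaplace (fun s => φ s * s⁻¹) σ t = ∫ τ in (0 : ℝ)..t, invLaplace φ σ τ := by
  -- After Fubini, integrating e^(sτ) over [0, t] leaves (e^(st) − 1)/s. The term from τ = 0 is an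
  -- inverse transform at time zero, which vanishes by causality.
  have h0 := h.div.invLaplace_eq_zero (le_refl (0 : ℝ))
  have hne : ∀ w : ℝ, (σ + w * Complex.I : ℂ) ≠ 0 := by
    intro w hw
    have := congrArg Complex.re hw
    simp at this
    exact h.pos.ne' this
  simp only [invLaplace]
  rw [intervalIntegral.integral_const_mul, intervalIntegral_integral_swap]
  · have h1 : ∀ w : ℝ, ∫ τ in (0 : ℝ)..t, Complex.exp ((σ + w * Complex.I) * τ) *
        φ (σ + w * Complex.I) =
        Complex.exp ((σ + w * Complex.I) * t) * (φ (σ + w * Complex.I) * (σ + w * Complex.I)⁻¹) -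
        Complex.exp ((σ + w * Complex.I) * (0 : ℝ)) *
          (φ (σ + w * Complex.I) * (σ + w * Complex.I)⁻¹) := by
      intro w
      rw [intervalIntegral.integral_mul_const, integral_exp_mul_complex (hne w)]
      ring
    simp_rw [h1]
    rw [integral_sub (h.div.integrable_invLaplace t) (h.div.integrable_invLaplace 0), mul_sub]
    have h0' : (2 * Real.pi : ℂ)⁻¹ * ∫ w : ℝ, Complex.exp ((σ + w * Complex.I) * (0 : ℝ)) *
          (φ (σ + w * Complex.I) * (σ + w * Complex.I)⁻¹) = 0 := h0
    rw [h0', sub_zero]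
  · have hi : IntegrableOn (fun τ : ℝ => Real.exp (σ * τ)) (uIoc 0 t) :=
      (Continuous.integrableOn_Icc (by fun_prop)).mono_set uIoc_subset_uIcc
    refine (hi.mul_prod (h.integrable_line le_rfl).norm).mono' ?_ (Eventually.of_forall ?_)
    · refine Continuous.aestronglyMeasurable ?_
      have := h.continuous_line le_rfl
      exact Continuous.mul (by fun_prop) (this.comp continuous_snd)
    · rintro ⟨τ, w⟩
      simp [Complex.norm_exp]

/-! ### Causal convolutions -/

section Causal

variable {V : Type*} [NormedAddCommGroup V] [NormedSpace ℂ V]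

/-- The convolution on `[0, t]` of a scalar kernel with a vector-valued function. -/
noncomputable def causalConv (κ : ℝ → ℂ) (v : ℝ → V) (t : ℝ) : V :=
  ∫ τ in (0 : ℝ)..t, κ (t - τ) • v τ

theorem causalConv_of_nonpos {κ : ℝ → ℂ} {v : ℝ → V} (hv : ∀ t ≤ 0, v t = 0) {t : ℝ}
    (ht : t ≤ 0) : causalConv κ v t = 0 := by
  rw [causalConv]
  refine intervalIntegral.integral_zero_ae (Eventually.of_forall fun τ hτ => ?_)
  rw [uIoc_of_ge ht] at hτ
  rw [hv τ hτ.2, smul_zero]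

/-- The integrand vanishes for τ ≥ t, so the upper limit can be replaced by one that does not depend
on t. Continuity in t and Fubini then take place on fixed domains. -/
theorem causalConv_eq {κ : ℝ → ℂ} {v : ℝ → V} (hκ : Continuous κ) (hκ0 : ∀ t ≤ 0, κ t = 0)
    (hv : Continuous v) (hv0 : ∀ t ≤ 0, v t = 0) {t T : ℝ} (hT : t ≤ T) (hT0 : 0 ≤ T) :
    causalConv κ v t = ∫ τ in (0 : ℝ)..T, κ (t - τ) • v τ := by
  have hcont : Continuous fun τ => κ (t - τ) • v τ := by fun_prop
  rcases le_total t 0 with ht | ht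
  · rw [causalConv_of_nonpos hv0 ht, eq_comm]
    refine intervalIntegral.integral_zero_ae (Eventually.of_forall fun τ hτ => ?_)
    rw [uIoc_of_le hT0] at hτ
    rw [hκ0 _ (by linarith [hτ.1]), zero_smul]
  · rw [causalConv, ← intervalIntegral.integral_add_adjacent_intervals
      (hcont.intervalIntegrable 0 t) (hcont.intervalIntegrable t T), left_eq_add]
    refine intervalIntegral.integral_zero_ae (Eventually.of_forall fun τ hτ => ?_)
    rw [uIoc_of_le hT] at hτ
    rw [hκ0 _ (by linarith [hτ.1]), zero_smul]

theorem continuous_causalConv {κ : ℝ → ℂ} {v : ℝ → V} (hκ : Continuous κ)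
    (hκ0 : ∀ t ≤ 0, κ t = 0) (hv : Continuous v) (hv0 : ∀ t ≤ 0, v t = 0) :
    Continuous (causalConv κ v) := by
  refine continuous_iff_continuousAt.2 fun t₀ => ?_
  have h1 : Continuous fun t : ℝ => ∫ τ in (0 : ℝ)..(|t₀| + 1), κ (t - τ) • v τ :=
    intervalIntegral.continuous_parametric_intervalIntegral_of_continuous' (by fun_prop) _ _
  refine h1.continuousAt.congr ?_
  filter_upwards [Iio_mem_nhds (show t₀ < |t₀| + 1 by linarith [le_abs_self t₀])] with t ht
  exact (causalConv_eq hκ hκ0 hv hv0 (le_of_lt ht) (by positivity)).symm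

/-- Fubini on the square [0, t]²; the inner integral of κ(r − τ) over r starts effectively at r = τ
because κ is causal. -/
theorem causalConv_integral [CompleteSpace V] {κ : ℝ → ℂ} {v : ℝ → V} (hκ : Continuous κ)
    (hκ0 : ∀ t ≤ 0, κ t = 0) (hv : Continuous v) (hv0 : ∀ t ≤ 0, v t = 0) (t : ℝ) :
    causalConv (fun t => ∫ τ in (0 : ℝ)..t, κ τ) v t = ∫ r in (0 : ℝ)..t, causalConv κ v r := by
  rcases le_total t 0 with ht | ht
  · rw [causalConv_of_nonpos hv0 ht, eq_comm]
    refine intervalIntegral.integral_zero_ae (Eventually.of_forall fun τ hτ => ?_)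
    rw [uIoc_of_ge ht] at hτ
    exact causalConv_of_nonpos hv0 hτ.2
  · have h1 : ∫ r in (0 : ℝ)..t, causalConv κ v r =
        ∫ r in (0 : ℝ)..t, ∫ τ in (0 : ℝ)..t, κ (r - τ) • v τ := by
      refine intervalIntegral.integral_congr fun r hr => ?_
      rw [uIcc_of_le ht] at hr
      exact causalConv_eq hκ hκ0 hv hv0 hr.2 ht
    rw [h1, intervalIntegral_intervalIntegral_swap, causalConv]
    · refine intervalIntegral.integral_congr fun τ hτ => ?_
      rw [uIcc_of_le ht] at hτ
      rw [intervalIntegral.integral_smul_const, intervalIntegral.integral_comp_sub_right κ τ,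
        zero_sub, ← intervalIntegral.integral_add_adjacent_intervals
        (hκ.intervalIntegrable (-τ) 0) (hκ.intervalIntegrable 0 (t - τ))]
      have : ∫ x in (-τ)..0, κ x = 0 := by
        refine intervalIntegral.integral_zero_ae (Eventually.of_forall fun x hx => ?_)
        rw [uIoc_of_le (by linarith [hτ.1])] at hx
        exact hκ0 x hx.2
      rw [this, zero_add]
    · have : Continuous (Function.uncurry fun r τ => κ (r - τ) • v τ) := by fun_prop
      exact (this.continuousOn.integrableOn_compact (isCompact_uIcc.prod isCompact_uIcc)).mono_set
        (prod_mono uIoc_subset_uIcc uIoc_subset_uIcc)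

/-! ### Fractional integration kernels. -/

/-- The kernel `t ^ (a - 1) / Γ(a)` of the fractional integral of order `a`. -/
noncomputable def fracKernel (a t : ℝ) : ℂ := (((max t 0) ^ (a - 1) / Real.Gamma a : ℝ) : ℂ)

theorem continuous_fracKernel {a : ℝ} (ha : 1 < a) : Continuous (fracKernel a) := by
  have := continuous_rpow_max_zero (b := a - 1) (by linarith)
  unfold fracKernel
  fun_prop

theorem fracKernel_of_nonpos {a : ℝ} (ha : 1 < a) {t : ℝ} (ht : t ≤ 0) : fracKernel a t = 0 := by
  simp [fracKernel, max_eq_right ht, Real.zero_rpow (by linarith : a - 1 ≠ 0)]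

/-- True also for t ≤ 0, because 0 ^ 0 = 1. The order one is therefore not covered by
`fracKernel_of_nonpos`. -/
theorem fracKernel_one (t : ℝ) : fracKernel 1 t = 1 := by
  simp [fracKernel]

theorem hasDerivAt_zero_of_nonpos {v : ℝ → V} (hv : ContDiff ℝ 1 v) (hv0 : ∀ t ≤ 0, v t = 0) :
    ∀ t ≤ 0, deriv v t = 0 := by
  have hneg : ∀ t < 0, deriv v t = 0 := by
    intro t ht
    have : v =ᶠ[𝓝 t] fun _ => 0 := by
      filter_upwards [Iio_mem_nhds ht] with r hr
      exact hv0 r (le_of_lt hr)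
    rw [this.deriv_eq, deriv_const]
  intro t ht
  rcases ht.lt_or_eq with ht | rfl
  · exact hneg t ht
  -- At the origin the derivative is the limit of the vanishing derivatives from the left.
  · have hc : Continuous (deriv v) := hv.continuous_deriv le_rfl
    have h1 : Tendsto (deriv v) (𝓝[<] 0) (𝓝 (deriv v 0)) := (hc.tendsto 0).mono_left nhdsWithin_le_nhds
    refine tendsto_nhds_unique h1 (tendsto_const_nhds.congr' ?_)
    filter_upwards [self_mem_nhdsWithin] with r hr
    exact (hneg r hr).symm

theorem iteratedDeriv_of_nonpos {n : ℕ} {v : ℝ → V} (hv : ContDiff ℝ n v)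
    (hv0 : ∀ t ≤ 0, v t = 0) : ∀ t ≤ 0, iteratedDeriv n v t = 0 := by
  induction n generalizing v with
  | zero => simpa using hv0
  | succ n ih =>
    rw [iteratedDeriv_succ']
    have h1 : ContDiff ℝ 1 v := hv.of_le (by norm_cast; omega)
    have h2 : ContDiff ℝ (n + 1) v := by exact_mod_cast hv
    exact ih ((contDiff_succ_iff_deriv.1 h2).2.2) (hasDerivAt_zero_of_nonpos h1 hv0)

variable [CompleteSpace V]

/-- Integration by parts. The boundary terms vanish because v(0) = 0 and the kernel of order b + 1
is zero at 0. For b < 1 the kernel of order b is singular at τ = t, so it is only required to be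
integrable and to be the derivative on the open interval. -/
theorem causalConv_fracKernel_deriv {b : ℝ} (hb : 0 < b) {v : ℝ → V} (hv : ContDiff ℝ 1 v)
    (hv0 : ∀ t ≤ 0, v t = 0) (t : ℝ) :
    causalConv (fracKernel (b + 1)) (deriv v) t = causalConv (fracKernel b) v t := by
  rcases le_total t 0 with ht | ht
  · rw [causalConv_of_nonpos (hasDerivAt_zero_of_nonpos hv hv0) ht, causalConv_of_nonpos hv0 ht]
  have hdc : Continuous (deriv v) := hv.continuous_deriv le_rfl
  have hvc : Continuous v := hv.continuous
  have hG : Real.Gamma b ≠ 0 := (Real.Gamma_pos_of_pos hb).ne'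
  have h1 : IntervalIntegrable (fun τ => fracKernel b (t - τ) • v τ) volume 0 t := by
    have h : IntervalIntegrable (fun τ : ℝ => ((t - τ) ^ (b - 1) / Real.Gamma b)) volume 0 t := by
      have := (intervalIntegral.intervalIntegrable_rpow' (a := t) (b := 0) (r := b - 1)
        (by linarith)).comp_sub_left t
      simp only [sub_self, sub_zero] at this
      exact this.div_const _
    have h2 : IntervalIntegrable (fun τ : ℝ => (((t - τ) ^ (b - 1) / Real.Gamma b : ℝ) : ℂ) • v τ)
        volume 0 t := by
      have h3 : IntervalIntegrable (fun τ : ℝ => (((t - τ) ^ (b - 1) / Real.Gamma b : ℝ) : ℂ))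
        volume 0 t := ⟨h.1.ofReal, h.2.ofReal⟩
      exact h3.smul_continuousOn hvc.continuousOn
    refine h2.congr fun τ hτ => ?_
    rw [uIoc_of_le ht] at hτ
    simp only [fracKernel, max_eq_left (sub_nonneg.2 hτ.2)]
  have h2 : IntervalIntegrable (fun τ => fracKernel (b + 1) (t - τ) • deriv v τ) volume 0 t := by
    have := continuous_fracKernel (a := b + 1) (by linarith)
    exact Continuous.intervalIntegrable (by fun_prop) _ _
  rw [causalConv, causalConv, ← sub_eq_zero, ← intervalIntegral.integral_sub h2 h1]
  have hcont : Continuous fun τ => fracKernel (b + 1) (t - τ) • v τ := by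
    have := continuous_fracKernel (a := b + 1) (by linarith)
    fun_prop
  rw [intervalIntegral.integral_eq_sub_of_hasDerivAt_of_le ht hcont.continuousOn
    (f' := fun τ => fracKernel (b + 1) (t - τ) • deriv v τ - fracKernel b (t - τ) • v τ) ?_ (h2.sub h1)]
  · rw [hv0 0 le_rfl, sub_self, fracKernel_of_nonpos (by linarith) le_rfl]
    simp
  · intro τ hτ
    have hd : HasDerivAt v (deriv v τ) τ :=
      (hv.differentiable (by simp)).differentiableAt.hasDerivAt
    have hk : HasDerivAt (fun τ : ℝ => fracKernel (b + 1) (t - τ)) (-fracKernel b (t - τ)) τ := by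
      have h3 : HasDerivAt (fun τ : ℝ => (t - τ) ^ b / Real.Gamma (b + 1))
          (-((t - τ) ^ (b - 1) / Real.Gamma b)) τ := by
        have := (((hasDerivAt_id τ).const_sub t).rpow_const (p := b)
          (Or.inl (by simp; linarith [hτ.2]))).div_const (Real.Gamma (b + 1))
        convert! this using 1
        rw [Real.Gamma_add_one hb.ne']
        simp
        field_simp
      have h4 := h3.ofReal_comp
      have h5 : (fun τ : ℝ => fracKernel (b + 1) (t - τ)) =ᶠ[𝓝 τ]
          fun τ : ℝ => (((t - τ) ^ b / Real.Gamma (b + 1) : ℝ) : ℂ) := by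
        filter_upwards [Iio_mem_nhds hτ.2] with r hr
        have hr : r < t := hr
        simp only [fracKernel, max_eq_left (sub_nonneg.2 hr.le), add_sub_cancel_right]
      refine (h4.congr_of_eventuallyEq h5).congr_deriv ?_
      simp only [fracKernel, max_eq_left (sub_nonneg.2 hτ.2.le)]
      push_cast
      rfl
    have := hk.smul hd
    rw [neg_smul, ← sub_eq_add_neg] at this
    exact this

/-- The time-domain form of s^(-b-j) · s^j = s^(-b); this removes the regularization by s^(-n) in
the definition of the temporal convolution. -/
theorem causalConv_fracKernel_iteratedDeriv {b : ℝ} (hb : 0 < b) {j : ℕ} {v : ℝ → V}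
    (hv : ContDiff ℝ j v) (hv0 : ∀ t ≤ 0, v t = 0) (t : ℝ) :
    causalConv (fracKernel (b + j)) (iteratedDeriv j v) t = causalConv (fracKernel b) v t := by
  induction j generalizing v b with
  | zero => simp
  | succ j ih =>
    have h1 : ContDiff ℝ 1 v := hv.of_le (by norm_cast; omega)
    have h2 : ContDiff ℝ (j + 1) v := by exact_mod_cast hv
    rw [iteratedDeriv_succ', ← causalConv_fracKernel_deriv hb h1 hv0,
      ← ih (b := b + 1) (by linarith) ((contDiff_succ_iff_deriv.1 h2).2.2)
      (hasDerivAt_zero_of_nonpos h1 hv0)]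
    congr 2
    push_cast
    ring

theorem causalConv_fracKernel_one_deriv {v : ℝ → V} (hv : ContDiff ℝ 1 v)
    (hv0 : ∀ t ≤ 0, v t = 0) (t : ℝ) : causalConv (fracKernel 1) (deriv v) t = v t := by
  simp only [causalConv, fracKernel_one, one_smul]
  rw [intervalIntegral.integral_deriv_eq_sub
    (fun x _ => (hv.differentiable (by simp)).differentiableAt)
    ((hv.continuous_deriv le_rfl).intervalIntegrable _ _), hv0 0 le_rfl, sub_zero]

theorem integral_fracKernel {a : ℝ} (ha : 1 < a) (t : ℝ) :
    ∫ τ in (0 : ℝ)..t, fracKernel a τ = fracKernel (a + 1) t := by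
  rcases le_total t 0 with ht | ht
  · rw [fracKernel_of_nonpos (by linarith) ht]
    refine intervalIntegral.integral_zero_ae (Eventually.of_forall fun τ hτ => ?_)
    rw [uIoc_of_ge ht] at hτ
    exact fracKernel_of_nonpos ha hτ.2
  · have h1 : ∫ τ in (0 : ℝ)..t, fracKernel a τ =
        ∫ τ in (0 : ℝ)..t, ((τ ^ (a - 1) / Real.Gamma a : ℝ) : ℂ) := by
      refine intervalIntegral.integral_congr fun τ hτ => ?_
      rw [uIcc_of_le ht] at hτ
      simp only [fracKernel, max_eq_left hτ.1]
    rw [h1, intervalIntegral.integral_ofReal, intervalIntegral.integral_div,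
      integral_rpow (Or.inl (by linarith)), fracKernel, max_eq_left ht,
      Real.Gamma_add_one (by linarith), Real.zero_rpow (by linarith)]
    congr 1
    simp
    field_simp

end Causal

/-! ### Temporal convolutions with scalar families -/

theorem invLaplace_congr {φ ψ : ℂ → ℂ} {σ : ℝ} (hσ : 0 < σ) (h : ∀ s : ℂ, 0 < s.re → φ s = ψ s)
    (t : ℝ) : invLaplace φ σ t = invLaplace ψ σ t := by
  rw [invLaplace, invLaplace]
  congr 2
  ext w
  rw [h _ (by simpa using hσ)]

theorem laplaceDecay_cpow {a σ : ℝ} (ha : 1 < a) (hσ : 0 < σ) :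
    LaplaceDecay (fun s => s ^ (-a : ℂ)) σ := by
  refine ⟨hσ, fun s hs => ?_, a, 1, ha, fun s hs => ?_⟩
  · exact (DifferentiableAt.cpow differentiableAt_id (differentiableAt_const _)
      (Or.inl hs)).differentiableWithinAt
  · have := Complex.norm_cpow_real s (-a)
    rw [Complex.ofReal_neg] at this
    rw [this, one_mul]

theorem LaplaceDecay.congr {φ ψ : ℂ → ℂ} {σ : ℝ} (h : LaplaceDecay φ σ)
    (hs : ∀ s : ℂ, 0 < s.re → ψ s = φ s) : LaplaceDecay ψ σ := by
  obtain ⟨a, M, ha, hM⟩ := h.bound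
  exact ⟨h.pos, h.diff.congr hs, a, M, ha, fun s hσ => by
    rw [hs s (h.pos.trans_le hσ)]; exact hM s hσ⟩

theorem cpow_neg_mul_pow_inv {s : ℂ} (hs : 0 < s.re) (p : ℝ) (n : ℕ) :
    s ^ (-p : ℂ) * (s ^ n)⁻¹ = s ^ (-((n + p : ℝ) : ℂ)) := by
  have hs0 : s ≠ 0 := by
    rintro rfl
    simp at hs
  rw [← Complex.cpow_natCast, ← Complex.cpow_neg, ← Complex.cpow_add _ _ hs0]
  congr 1
  push_cast
  ring

/-- All transfer operators are combinations of two fixed operators with scalar coefficients, so the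
operator-valued kernel reduces to two scalar inverse transforms. The target is kept as an abstract
Banach space, which `laplaceKernel_sub` specializes to operators X → X'. -/
theorem integral_line_smul_sub {E : Type*} [NormedAddCommGroup E] [NormedSpace ℂ E]
    [CompleteSpace E] {φ ψ : ℂ → ℂ} {A B : E} {F : ℂ → E} {n : ℕ} {σ : ℝ}
    (hF : ∀ s : ℂ, 0 < s.re → F s = φ s • A - ψ s • B)
    (hφ : LaplaceDecay (fun s => φ s * (s ^ n)⁻¹) σ)
    (hψ : LaplaceDecay (fun s => ψ s * (s ^ n)⁻¹) σ) (t : ℝ) :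
    (2 * Real.pi : ℂ)⁻¹ • ∫ w : ℝ,
      (Complex.exp ((σ + w * Complex.I) * t) * ((σ + w * Complex.I) ^ n)⁻¹) •
        F (σ + w * Complex.I) = invLaplace (fun s => φ s * (s ^ n)⁻¹) σ t • A -
      invLaplace (fun s => ψ s * (s ^ n)⁻¹) σ t • B := by
  have h1 : ∀ w : ℝ, (Complex.exp ((σ + w * Complex.I) * t) * ((σ + w * Complex.I) ^ n)⁻¹) •
      F (σ + w * Complex.I) =
      (Complex.exp ((σ + w * Complex.I) * t) *
        (φ (σ + w * Complex.I) * ((σ + w * Complex.I) ^ n)⁻¹)) • A -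
      (Complex.exp ((σ + w * Complex.I) * t) *
        (ψ (σ + w * Complex.I) * ((σ + w * Complex.I) ^ n)⁻¹)) • B := by
    intro w
    rw [hF _ (by simpa using hφ.pos), smul_sub, smul_smul, smul_smul]
    congr 2 <;> ring
  simp_rw [h1, invLaplace]
  rw [integral_sub ((hφ.integrable_invLaplace t).smul_const A)
    ((hψ.integrable_invLaplace t).smul_const B), integral_smul_const, integral_smul_const, smul_sub,
    smul_smul, smul_smul]

section Temporal

variable {X : Type*} [NormedAddCommGroup X] [InnerProductSpace ℂ X]

theorem laplaceKernel_sub {φ ψ : ℂ → ℂ} {A B : X →L[ℂ] AntiDual X} {F : ℂ → X →L[ℂ] AntiDual X}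
    {n : ℕ} {σ : ℝ} (hF : ∀ s : ℂ, 0 < s.re → F s = φ s • A - ψ s • B)
    (hφ : LaplaceDecay (fun s => φ s * (s ^ n)⁻¹) σ)
    (hψ : LaplaceDecay (fun s => ψ s * (s ^ n)⁻¹) σ) (t : ℝ) :
    laplaceKernel F n σ t = invLaplace (fun s => φ s * (s ^ n)⁻¹) σ t • A -
      invLaplace (fun s => ψ s * (s ^ n)⁻¹) σ t • B :=
  integral_line_smul_sub (E := X →L[ℂ] AntiDual X) hF hφ hψ t

variable [CompleteSpace X]

theorem temporalConvolution_sub {φ ψ : ℂ → ℂ} {A B : X →L[ℂ] AntiDual X}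
    {F : ℂ → X →L[ℂ] AntiDual X} {n : ℕ} {σ : ℝ}
    (hF : ∀ s : ℂ, 0 < s.re → F s = φ s • A - ψ s • B)
    (hφ : LaplaceDecay (fun s => φ s * (s ^ n)⁻¹) σ)
    (hψ : LaplaceDecay (fun s => ψ s * (s ^ n)⁻¹) σ) {g : ℝ → X} (hg : ContDiff ℝ n g) (t : ℝ) :
    temporalConvolution F n σ g t =
      A (causalConv (invLaplace (fun s => φ s * (s ^ n)⁻¹) σ) (iteratedDeriv n g) t) -
      B (causalConv (invLaplace (fun s => ψ s * (s ^ n)⁻¹) σ) (iteratedDeriv n g) t) := by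
  have hgc : Continuous (iteratedDeriv n g) := hg.continuous_iteratedDeriv n le_rfl
  have h1 := hφ.continuous_invLaplace
  have h2 := hψ.continuous_invLaplace
  have i1 : IntervalIntegrable (fun τ => invLaplace (fun s => φ s * (s ^ n)⁻¹) σ (t - τ) •
      iteratedDeriv n g τ) volume 0 t := Continuous.intervalIntegrable (by fun_prop) _ _
  have i2 : IntervalIntegrable (fun τ => invLaplace (fun s => ψ s * (s ^ n)⁻¹) σ (t - τ) •
      iteratedDeriv n g τ) volume 0 t := Continuous.intervalIntegrable (by fun_prop) _ _
  rw [temporalConvolution, causalConv, causalConv, ← A.intervalIntegral_comp_comm i1,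
    ← B.intervalIntegral_comp_comm i2, ← intervalIntegral.integral_sub]
  · refine intervalIntegral.integral_congr fun τ _ => ?_
    simp only [laplaceKernel_sub hF hφ hψ, map_smul]
    rfl
  · exact Continuous.intervalIntegrable (by fun_prop) _ _
  · exact Continuous.intervalIntegrable (by fun_prop) _ _

/-- The temporal convolution with `s ^ (-p) A - s ^ (-q) B`. -/
theorem temporalConvolution_cpow {p q : ℝ} {A B : X →L[ℂ] AntiDual X}
    {F : ℂ → X →L[ℂ] AntiDual X} {n : ℕ} {σ : ℝ} (hσ : 0 < σ) (hp : 1 < n + p) (hq : 1 < n + q)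
    (hF : ∀ s : ℂ, 0 < s.re → F s = s ^ (-p : ℂ) • A - s ^ (-q : ℂ) • B)
    {g : ℝ → X} (hg : ContDiff ℝ n g) (t : ℝ) :
    temporalConvolution F n σ g t = A (causalConv (fracKernel (n + p)) (iteratedDeriv n g) t) -
      B (causalConv (fracKernel (n + q)) (iteratedDeriv n g) t) := by
  -- The extra factor s^(-n) shifts the order from r to n + r, and n + r > 1 is what
  -- `invLaplace_cpow` needs. The exponent r may be negative, as it is for the factor s in condition
  -- (A).
  have hk : ∀ r : ℝ, 1 < n + r →
      invLaplace (fun s => s ^ (-r : ℂ) * (s ^ n)⁻¹) σ = fracKernel (n + r) := by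
    intro r hr
    ext t
    rw [invLaplace_congr hσ (fun s hs => cpow_neg_mul_pow_inv hs r n), invLaplace_cpow hr hσ,
      fracKernel]
  have hd : ∀ r : ℝ, 1 < n + r → LaplaceDecay (fun s => s ^ (-r : ℂ) * (s ^ n)⁻¹) σ :=
    fun r hr => (laplaceDecay_cpow hr hσ).congr fun s hs => cpow_neg_mul_pow_inv hs r n
  rw [temporalConvolution_sub hF (hd p hp) (hd q hq) hg, hk p hp, hk q hq]

end Temporal

/-! ### The half derivative -/

section HalfDeriv

variable {V : Type*} [NormedAddCommGroup V] [NormedSpace ℂ V] [CompleteSpace V]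

/-- The kernel of order a + 1 is the primitive of the kernel of order a, so by `causalConv_integral`
the convolution on the left is the primitive of a continuous function. -/
theorem hasDerivAt_causalConv_fracKernel {a : ℝ} (ha : 1 < a) {v : ℝ → V} (hv : Continuous v)
    (hv0 : ∀ t ≤ 0, v t = 0) (t : ℝ) :
    HasDerivAt (causalConv (fracKernel (a + 1)) v) (causalConv (fracKernel a) v t) t := by
  have hk := continuous_fracKernel ha
  have hk0 : ∀ t ≤ 0, fracKernel a t = 0 := fun t ht => fracKernel_of_nonpos ha ht
  have h1 : causalConv (fracKernel (a + 1)) v = fun t => ∫ r in (0 : ℝ)..t, causalConv (fracKernel a) v r := by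
    ext t
    rw [← causalConv_integral hk hk0 hv hv0, funext (integral_fracKernel ha)]
  rw [h1]
  have hc := continuous_causalConv hk hk0 hv hv0
  exact intervalIntegral.integral_hasDerivAt_right (hc.intervalIntegrable _ _)
    (hc.stronglyMeasurableAtFilter _ _) hc.continuousAt

/-- The Riemann–Liouville kernel has order 1/2 and is singular. Two integrations by parts raise the
order to 5/2, and the outer derivative lowers it to 3/2, where the kernel is still continuous; a
single integration by parts would end at the singular order 1/2. -/
theorem halfDeriv_eq {u : ℝ → V} (hu : ContDiff ℝ 2 u) (hu0 : ∀ t ≤ 0, u t = 0) (t : ℝ) :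
    halfDeriv u t = causalConv (fracKernel (3 / 2)) (iteratedDeriv 2 u) t := by
  have h1 : (fun r : ℝ => ∫ τ in (0 : ℝ)..r, (√(Real.pi * (r - τ)))⁻¹ • u τ) =
      causalConv (fracKernel (3 / 2 + 1)) (iteratedDeriv 2 u) := by
    ext r
    have h2 := causalConv_fracKernel_iteratedDeriv (b := 1 / 2) (by norm_num) (j := 2) hu hu0 r
    have h3 : (1 / 2 : ℝ) + (2 : ℕ) = 3 / 2 + 1 := by norm_num
    rw [← h3, h2]
    rcases le_total r 0 with hr | hr
    · rw [causalConv_of_nonpos hu0 hr]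
      refine intervalIntegral.integral_zero_ae (Eventually.of_forall fun τ hτ => ?_)
      rw [uIoc_of_ge hr] at hτ
      rw [hu0 τ hτ.2, smul_zero]
    · refine intervalIntegral.integral_congr fun τ hτ => ?_
      rw [uIcc_of_le hr] at hτ
      have h4 : 0 ≤ r - τ := sub_nonneg.2 hτ.2
      simp only [fracKernel, max_eq_left h4, Complex.coe_smul]
      congr 1
      rw [Real.Gamma_one_half_eq, Real.sqrt_mul Real.pi_pos.le, mul_inv, Real.sqrt_eq_rpow (r - τ),
        ← Real.rpow_neg h4, mul_comm, div_eq_mul_inv]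
      congr 2
      norm_num
  rw [halfDeriv, h1]
  exact (hasDerivAt_causalConv_fracKernel (by norm_num) (hu.continuous_iteratedDeriv 2 le_rfl)
    (iteratedDeriv_of_nonpos hu hu0) t).deriv

end HalfDeriv

/-! ### The damped oscillator -/

theorem le_re_oscillator {m α k : ℝ} (hα : 0 ≤ α) (hk : 0 < k) {s : ℂ} (hs : 0 < s.re) :
    m * s.re ≤ (m * s + α + k * s⁻¹).re := by
  simp only [Complex.add_re, Complex.re_ofReal_mul, Complex.ofReal_re, Complex.inv_re]
  have : 0 ≤ k * (s.re / Complex.normSq s) :=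
    mul_nonneg hk.le (div_nonneg hs.le (Complex.normSq_nonneg _))
  linarith

theorem oscillator_ne_zero {m α k : ℝ} (hm : 0 < m) (hα : 0 ≤ α) (hk : 0 < k) {s : ℂ}
    (hs : 0 < s.re) : (m * s + α + k * s⁻¹ : ℂ) ≠ 0 := by
  intro h
  have := le_re_oscillator (m := m) hα hk hs
  rw [h, Complex.zero_re] at this
  exact absurd this (not_le.2 (mul_pos hm hs))

/-- With D = ms + α + k/s one has m|s| ≤ |D| + (α + k/σ). The constant α + k/σ is absorbed in |D| by
means of |D| ≥ mσ, which explains the factor 1 + (α + k/σ)/(mσ). -/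
theorem norm_inv_oscillator_le {m α k : ℝ} (hm : 0 < m) (hα : 0 ≤ α) (hk : 0 < k) {σ : ℝ}
    (hσ : 0 < σ) {s : ℂ} (hs : σ ≤ s.re) :
    ‖(m * s + α + k * s⁻¹)⁻¹‖ ≤ (1 + (α + k / σ) / (m * σ)) / m * ‖s‖ ^ (-1 : ℝ) := by
  have hσs : σ ≤ ‖s‖ := hs.trans (Complex.re_le_norm s)
  have hs0 : 0 < ‖s‖ := hσ.trans_le hσs
  set D : ℂ := m * s + α + k * s⁻¹ with hD
  have h1 : m * σ ≤ ‖D‖ :=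
    ((mul_le_mul_of_nonneg_left hs hm.le).trans (le_re_oscillator hα hk (hσ.trans_le hs))).trans
      (Complex.re_le_norm D)
  have h2 : m * ‖s‖ ≤ ‖D‖ + (α + k / σ) := by
    have e : (m * s : ℂ) = D - (α + k * s⁻¹) := by rw [hD]; ring
    have e1 : ‖(m * s : ℂ)‖ = m * ‖s‖ := by simp [abs_of_pos hm]
    rw [← e1, e]
    refine (norm_sub_le _ _).trans (add_le_add_right ((norm_add_le _ _).trans ?_) _)
    refine add_le_add (by simp [abs_of_nonneg hα]) ?_
    rw [norm_mul, norm_inv, Complex.norm_real, Real.norm_of_nonneg hk.le, ← div_eq_mul_inv]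
    gcongr
  have hD0 : 0 < ‖D‖ := (mul_pos hm hσ).trans_le h1
  rw [norm_inv, Real.rpow_neg_one, ← div_eq_mul_inv, div_div, le_div_iff₀ (by positivity),
    inv_mul_le_iff₀ hD0]
  have h3 : α + k / σ ≤ ‖D‖ * ((α + k / σ) / (m * σ)) := by
    rw [mul_div_assoc', le_div_iff₀ (by positivity), mul_comm]
    gcongr
  linarith

theorem laplaceDecay_oscillator {m α k : ℝ} (hm : 0 < m) (hα : 0 ≤ α) (hk : 0 < k) {σ : ℝ}
    (hσ : 0 < σ) {n : ℕ} (hn : 0 < n) :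
    LaplaceDecay (fun s => (m * s + α + k * s⁻¹)⁻¹ * (s ^ n)⁻¹) σ := by
  have hne : ∀ s : ℂ, 0 < s.re → s ≠ 0 := by
    rintro s hs rfl
    simp at hs
  refine ⟨hσ, fun s hs => DifferentiableAt.differentiableWithinAt ?_, n + 1,
    (1 + (α + k / σ) / (m * σ)) / m, by simpa using hn, fun s hs => ?_⟩
  · have h1 : (m * s + α + k * s⁻¹ : ℂ) ≠ 0 := oscillator_ne_zero hm hα hk hs
    have h2 : DifferentiableAt ℂ (fun s : ℂ => s⁻¹) s := differentiableAt_inv (hne s hs)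
    have h3 : DifferentiableAt ℂ (fun s : ℂ => (m * s + α + k * s⁻¹ : ℂ)) s := by fun_prop
    have h4 : DifferentiableAt ℂ (fun s : ℂ => s ^ n) s := by fun_prop
    exact (h3.fun_inv h1).fun_mul (h4.fun_inv (pow_ne_zero n (hne s hs)))
  · have hs0 : 0 < ‖s‖ := norm_pos_iff.2 (hne s (hσ.trans_le hs))
    have h1 : ‖s‖ ^ (-(n + 1 : ℝ)) = ‖s‖ ^ (-1 : ℝ) * ‖(s ^ n)⁻¹‖ := by
      rw [norm_inv, norm_pow, ← Real.rpow_natCast, ← Real.rpow_neg hs0.le, ← Real.rpow_add hs0]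
      congr 1
      ring
    rw [norm_mul, h1, ← mul_assoc]
    exact mul_le_mul_of_nonneg_right (norm_inv_oscillator_le hm hα hk hσ hs) (norm_nonneg _)

section Oscillator

variable {V : Type*} [NormedAddCommGroup V] [NormedSpace ℂ V]

/-- The velocity of a damped oscillator, as a convolution. -/
theorem oscillator_causalConv [CompleteSpace V] {m α k : ℝ} (hm : 0 < m) (hα : 0 ≤ α) (hk : 0 < k)
    {σ : ℝ} (hσ : 0 < σ) {n : ℕ} (hn : 0 < n) {u : ℝ → V} (hu : ContDiff ℝ (n + 1 : ℕ) u)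
    (hu0 : ∀ t ≤ 0, u t = 0) {W : ℝ → V}
    (hW : W = causalConv (invLaplace (fun s => (m * s + α + k * s⁻¹)⁻¹ * (s ^ n)⁻¹) σ)
      (iteratedDeriv n (deriv u))) :
    W 0 = 0 ∧ ∀ t, ∃ W' : V, HasDerivAt W W' t ∧
      (m : ℂ) • W' + (α : ℂ) • W t + (k : ℂ) • (∫ τ in (0 : ℝ)..t, W τ) = deriv u t ∧
      HasDerivAt (fun t => ∫ τ in (0 : ℝ)..t, W τ) (W t) t := by
  set φ : ℂ → ℂ := fun s => (m * s + α + k * s⁻¹)⁻¹ * (s ^ n)⁻¹ with hφ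
  have h0 : LaplaceDecay φ σ := laplaceDecay_oscillator hm hα hk hσ hn
  set v := iteratedDeriv n (deriv u) with hv
  have hu1 : ContDiff ℝ 1 u := hu.of_le (by norm_cast; omega)
  have hu' : ContDiff ℝ n (deriv u) := by
    have h2 : ContDiff ℝ (n + 1) u := by exact_mod_cast hu
    exact (contDiff_succ_iff_deriv.1 h2).2.2
  have hud0 := hasDerivAt_zero_of_nonpos hu1 hu0
  have hvc : Continuous v := hu'.continuous_iteratedDeriv n le_rfl
  have hv0 : ∀ t ≤ 0, v t = 0 := iteratedDeriv_of_nonpos hu' hud0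
  set κ₀ := invLaplace φ σ with hκ₀
  set κ₁ := invLaplace (fun s => φ s * s⁻¹) σ with hκ₁
  set κ₂ := invLaplace (fun s => φ s * s⁻¹ * s⁻¹) σ with hκ₂
  have c0 : Continuous κ₀ := h0.continuous_invLaplace
  have c1 : Continuous κ₁ := h0.div.continuous_invLaplace
  have c2 : Continuous κ₂ := h0.div.div.continuous_invLaplace
  have z0 : ∀ t ≤ 0, κ₀ t = 0 := fun t ht => h0.invLaplace_eq_zero ht
  have z1 : ∀ t ≤ 0, κ₁ t = 0 := fun t ht => h0.div.invLaplace_eq_zero ht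
  have hW1 : ∀ t, causalConv κ₁ v t = ∫ r in (0 : ℝ)..t, W r := by
    intro t
    rw [hW, ← causalConv_integral c0 z0 hvc hv0, hκ₁, funext h0.invLaplace_div]
  have hW2 : ∀ t, causalConv κ₂ v t = ∫ r in (0 : ℝ)..t, causalConv κ₁ v r := by
    intro t
    rw [← causalConv_integral c1 z1 hvc hv0, hκ₂, funext h0.div.invLaplace_div]
  -- In the frequency domain m + α/s + k/s² is the oscillator symbol divided by s. Multiplied by φ
  -- it leaves s^(-n-1), whose inverse transform is known explicitly.
  have hkernel : ∀ t, (m : ℂ) * κ₀ t + α * κ₁ t + k * κ₂ t = fracKernel (1 + n) t := by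
    intro t
    have e1 : fracKernel (1 + n) t = invLaplace (fun s => m * φ s + α * (φ s * s⁻¹) +
        k * (φ s * s⁻¹ * s⁻¹)) σ t := by
      rw [fracKernel, ← invLaplace_cpow (by simpa using hn) hσ]
      refine invLaplace_congr hσ (fun s hs => ?_) t
      have hs0 : s ≠ 0 := by
        rintro rfl
        simp at hs
      have hD : (m * s + α + k * s⁻¹ : ℂ) ≠ 0 := oscillator_ne_zero hm hα hk hs
      have e2 : m * φ s + α * (φ s * s⁻¹) + k * (φ s * s⁻¹ * s⁻¹) =
          (m * s + α + k * s⁻¹) * φ s * s⁻¹ := by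
        field_simp
      rw [e2, hφ]
      simp only
      rw [← mul_assoc, mul_inv_cancel₀ hD, one_mul, ← mul_inv, ← pow_succ, ← Complex.cpow_natCast,
        ← Complex.cpow_neg]
      congr 1
      push_cast
      ring
    have i0 := (h0.integrable_invLaplace t).const_mul (m : ℂ)
    have i1 := (h0.div.integrable_invLaplace t).const_mul (α : ℂ)
    have i2 := (h0.div.div.integrable_invLaplace t).const_mul (k : ℂ)
    rw [e1, hκ₀, hκ₁, hκ₂]
    simp only [invLaplace]
    rw [mul_left_comm (m : ℂ), mul_left_comm (α : ℂ), mul_left_comm (k : ℂ), ← mul_add, ← mul_add,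
      ← integral_const_mul (m : ℂ), ← integral_const_mul (α : ℂ), ← integral_const_mul (k : ℂ),
      ← integral_add i0 i1, ← integral_add (i0.fun_add i1) i2]
    congr 2
    ext w
    ring
  -- Convolving the kernel identity with the n-th derivative of ∂ₜu gives the once integrated
  -- oscillator equation mW + α∫W + k∫∫W = u.
  have hsum : ∀ t, (m : ℂ) • W t + (α : ℂ) • causalConv κ₁ v t + (k : ℂ) • causalConv κ₂ v t =
      u t := by
    intro t
    have e1 := causalConv_fracKernel_iteratedDeriv (b := 1) one_pos hu' hud0 t
    rw [causalConv_fracKernel_one_deriv hu1 hu0] at e1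
    have i : ∀ κ : ℝ → ℂ, Continuous κ → IntervalIntegrable (fun τ => κ (t - τ) • v τ) volume 0 t :=
      fun κ hκ => Continuous.intervalIntegrable (by fun_prop) _ _
    have i' : ∀ (c : ℂ) (κ : ℝ → ℂ), Continuous κ →
        IntervalIntegrable (fun τ => c • κ (t - τ) • v τ) volume 0 t :=
      fun c κ hκ => Continuous.intervalIntegrable (by fun_prop) _ _
    rw [← e1, hW]
    simp only [causalConv]
    rw [← intervalIntegral.integral_smul, ← intervalIntegral.integral_smul,
      ← intervalIntegral.integral_smul, ← intervalIntegral.integral_add (i' _ _ c0) (i' _ _ c1),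
      ← intervalIntegral.integral_add ((i' _ _ c0).add (i' _ _ c1)) (i' _ _ c2)]
    refine intervalIntegral.integral_congr fun τ _ => ?_
    simp only [smul_smul, ← add_smul, hkernel]
    rfl
  have hWc : Continuous W := hW ▸ continuous_causalConv c0 z0 hvc hv0
  have hW1c : Continuous (causalConv κ₁ v) := continuous_causalConv c1 z1 hvc hv0
  have hd1 : ∀ t, HasDerivAt (fun t => ∫ τ in (0 : ℝ)..t, W τ) (W t) t := fun t =>
    intervalIntegral.integral_hasDerivAt_right (hWc.intervalIntegrable _ _)
      (hWc.stronglyMeasurableAtFilter _ _) hWc.continuousAt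
  have hd2 : ∀ t, HasDerivAt (causalConv κ₂ v) (causalConv κ₁ v t) t := by
    intro t
    rw [funext hW2]
    exact intervalIntegral.integral_hasDerivAt_right (hW1c.intervalIntegrable _ _)
      (hW1c.stronglyMeasurableAtFilter _ _) hW1c.continuousAt
  have hm0 : (m : ℂ) ≠ 0 := by exact_mod_cast hm.ne'
  refine ⟨by rw [hW, causalConv_of_nonpos hv0 le_rfl], fun t =>
    ⟨(m : ℂ)⁻¹ • (deriv u t - (α : ℂ) • W t - (k : ℂ) • causalConv κ₁ v t), ?_, ?_, hd1 t⟩⟩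
  -- The kernel of W is only known to be continuous. Differentiability of W is obtained by solving
  -- the integrated equation for W, since all other terms are differentiable.
  · have e : W = fun t => (m : ℂ)⁻¹ • (u t - (α : ℂ) • (∫ r in (0 : ℝ)..t, W r) -
        (k : ℂ) • causalConv κ₂ v t) := by
      ext t
      rw [← hsum t, hW1, eq_inv_smul_iff₀ hm0]
      abel
    have hud : HasDerivAt u (deriv u t) t :=
      (hu1.differentiable (by simp)).differentiableAt.hasDerivAt
    have := ((hud.sub ((hd1 t).const_smul (α : ℂ))).sub ((hd2 t).const_smul (k : ℂ))).const_smul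
      (m : ℂ)⁻¹
    exact this.congr_of_eventuallyEq (Eventually.of_forall fun t => congrFun e t)
  · rw [smul_inv_smul₀ hm0, hW1]
    abel

/-- Uniqueness for the damped oscillator. -/
theorem oscillator_unique {m α k : ℂ} (hm : m ≠ 0) {T : ℝ} {y y' y'' z z' z'' : ℝ → V} {f : ℝ → V}
    (h0 : y 0 = z 0) (h0' : y' 0 = z' 0)
    (hy : ∀ t ∈ Icc 0 T, HasDerivWithinAt y (y' t) (Icc 0 T) t ∧
      HasDerivWithinAt y' (y'' t) (Icc 0 T) t ∧ m • y'' t + α • y' t + k • y t + f t = 0)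
    (hz : ∀ t ∈ Icc 0 T, HasDerivWithinAt z (z' t) (Icc 0 T) t ∧
      HasDerivWithinAt z' (z'' t) (Icc 0 T) t ∧ m • z'' t + α • z' t + k • z t + f t = 0) :
    ∀ t ∈ Icc 0 T, y' t = z' t := by
  -- The equation as a first-order system for (y, y'). The forcing enters as a translation, so the
  -- Lipschitz constant is ‖L‖ and f needs no regularity.
  let L : V × V →L[ℂ] V × V := (ContinuousLinearMap.snd ℂ V V).prod
    (-(m⁻¹ • (α • ContinuousLinearMap.snd ℂ V V + k • ContinuousLinearMap.fst ℂ V V)))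
  let v : ℝ → V × V → V × V := fun t x => L x - (0, m⁻¹ • f t)
  have hv : ∀ t ∈ Ico 0 T, LipschitzOnWith ‖L‖₊ (v t) univ := by
    intro t _
    refine (LipschitzWith.of_dist_le_mul fun x x' => ?_).lipschitzOnWith
    have := L.lipschitz.dist_le_mul x x'
    simpa [v] using this
  have key : ∀ y y' y'' : ℝ → V, (∀ t ∈ Icc 0 T, HasDerivWithinAt y (y' t) (Icc 0 T) t ∧
      HasDerivWithinAt y' (y'' t) (Icc 0 T) t ∧ m • y'' t + α • y' t + k • y t + f t = 0) →
      ContinuousOn (fun t => (y t, y' t)) (Icc 0 T) ∧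
      ∀ t ∈ Ico 0 T, HasDerivWithinAt (fun t => (y t, y' t)) (v t (y t, y' t)) (Ici t) t := by
    intro y y' y'' h
    refine ⟨fun t ht => (h t ht).1.continuousWithinAt.prodMk (h t ht).2.1.continuousWithinAt,
      fun t ht => ?_⟩
    obtain ⟨h1, h2, h3⟩ := h t ⟨ht.1, ht.2.le⟩
    have h4 : HasDerivWithinAt (fun t => (y t, y' t)) (y' t, y'' t) (Icc 0 T) t := h1.prodMk h2
    have h5 : v t (y t, y' t) = (y' t, y'' t) := by
      have : y'' t = -(m⁻¹ • (α • y' t + k • y t + f t)) := by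
        rw [← smul_neg, eq_inv_smul_iff₀ hm, eq_neg_iff_add_eq_zero, ← h3]
        abel
      rw [this]
      refine Prod.ext ?_ ?_
      · simp [v, L]
      · simp only [v, L, Prod.snd_sub, ContinuousLinearMap.prod_apply, neg_apply, smul_apply,
          add_apply, ContinuousLinearMap.coe_snd', ContinuousLinearMap.coe_fst', smul_add]
        abel
    rw [h5]
    refine h4.mono_of_mem_nhdsWithin ?_
    exact mem_of_superset (Icc_mem_nhdsGE ht.2) (Icc_subset_Icc_left ht.1)
  obtain ⟨cy, dy⟩ := key y y' y'' hy
  obtain ⟨cz, dz⟩ := key z z' z'' hz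
  have := ODE_solution_unique_of_mem_Icc_right hv cy dy (fun _ _ => mem_univ _) cz dz
    (fun _ _ => mem_univ _) (by rw [h0, h0'])
  intro t ht
  exact congrArg Prod.snd (this ht)

end Oscillator

/-! ### Completeness of `H^{1/2}(Γ)` -/

theorem exists_subseq_ae_tendsto {α E : Type*} [MeasurableSpace α] {μ : Measure α}
    [NormedAddCommGroup E] {f : ℕ → Lp E 2 μ} {g : Lp E 2 μ} (h : Tendsto f atTop (𝓝 g)) :
    ∃ ns : ℕ → ℕ, StrictMono ns ∧ ∀ᵐ x ∂μ, Tendsto (fun i => f (ns i) x) atTop (𝓝 (g x)) :=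
  (tendstoInMeasure_of_tendsto_Lp h).exists_seq_tendsto_ae

/-- Along a subsequence the functions converge almost everywhere, and along a further one so do the
difference quotients; the pointwise relation between them passes to the limit. -/
theorem isClosed_halfSubmodule (Ω : Set E3) :
    IsClosed (halfSubmodule Ω : Set (WithLp 2 (L2 Ω ×
      Lp ℂ 2 ((surfaceMeasure Ω).prod (surfaceMeasure Ω))))) := by
  refine IsSeqClosed.isClosed fun p q hp hpq => ?_
  have h1 : Tendsto (fun n => (p n).fst) atTop (𝓝 q.fst) :=
    ((WithLp.fstL 2 ℂ (L2 Ω) _).continuous.tendsto q).comp hpq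
  have h2 : Tendsto (fun n => (p n).snd) atTop (𝓝 q.snd) :=
    ((WithLp.sndL 2 ℂ (L2 Ω) _).continuous.tendsto q).comp hpq
  obtain ⟨ns, hns, hae⟩ := exists_subseq_ae_tendsto h1
  obtain ⟨ms, hms, hae'⟩ := exists_subseq_ae_tendsto (h2.comp hns.tendsto_atTop)
  have e1 := Measure.quasiMeasurePreserving_fst (μ := surfaceMeasure Ω) (ν := surfaceMeasure Ω)
    |>.ae hae
  have e2 := Measure.quasiMeasurePreserving_snd (μ := surfaceMeasure Ω) (ν := surfaceMeasure Ω)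
    |>.ae hae
  have e3 : ∀ᵐ z ∂((surfaceMeasure Ω).prod (surfaceMeasure Ω)), ∀ n,
      (p n).snd z = ((‖z.1 - z.2‖ ^ (-(3 / 2) : ℝ) : ℝ) : ℂ) * ((p n).fst z.1 - (p n).fst z.2) :=
    ae_all_iff.2 fun n => hp n
  change ∀ᵐ z ∂((surfaceMeasure Ω).prod (surfaceMeasure Ω)),
    q.snd z = ((‖z.1 - z.2‖ ^ (-(3 / 2) : ℝ) : ℝ) : ℂ) * (q.fst z.1 - q.fst z.2)
  filter_upwards [e1, e2, e3, hae'] with z h1 h2 h3 h4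
  refine tendsto_nhds_unique h4 ?_
  simp only [Function.comp_def, h3]
  exact ((h1.comp hms.tendsto_atTop).sub (h2.comp hms.tendsto_atTop)).const_mul _

instance (Ω : Set E3) : CompleteSpace (HHalf Ω) :=
  haveI := (isClosed_halfSubmodule Ω).isComplete.completeSpace_coe
  inferInstanceAs (CompleteSpace (halfSubmodule Ω))

/-! ### The weighted space -/

theorem isClosed_halfWeightedSubmodule (Ω : Set E3) (κ : ℝ) :
    IsClosed (halfWeightedSubmodule Ω κ : Set (WithLp 2 (HHalf Ω × L2 Ω))) := by
  have : (halfWeightedSubmodule Ω κ : Set (WithLp 2 (HHalf Ω × L2 Ω))) =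
      {p | WithLp.sndL 2 ℂ (HHalf Ω) (L2 Ω) p =
        (κ : ℂ) • HHalf.toL2 Ω (WithLp.fstL 2 ℂ (HHalf Ω) (L2 Ω) p)} := rfl
  rw [this]
  exact isClosed_eq (by fun_prop) (by fun_prop)

instance (Ω : Set E3) (κ : ℝ) : CompleteSpace (HHalfWeighted Ω κ) :=
  haveI := (isClosed_halfWeightedSubmodule Ω κ).isComplete.completeSpace_coe
  inferInstanceAs (CompleteSpace (halfWeightedSubmodule Ω κ))

theorem HHalfWeighted.seminorm_apply {Ω : Set E3} {κ : ℝ} (hκ : 0 ≤ κ) (ψ : HHalfWeighted Ω κ) :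
    HHalfWeighted.seminorm Ω κ ψ = κ * ‖HHalfWeighted.toL2 Ω κ ψ‖ := by
  rw [HHalfWeighted.seminorm, smul_apply, NNReal.smul_def, Real.coe_toNNReal _ hκ]
  rfl

theorem HHalfWeighted.surjective_embed (Ω : Set E3) (κ : ℝ) :
    Function.Surjective (HHalfWeighted.embed Ω κ) := fun h =>
  ⟨(⟨WithLp.toLp 2 (h, (κ : ℂ) • HHalf.toL2 Ω h), rfl⟩ : halfWeightedSubmodule Ω κ), rfl⟩

theorem HHalfWeighted.isAdmissibleSpace (Ω : Set E3) {κ : ℝ} (hκ : 0 ≤ κ) :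
    IsAdmissibleSpace (HHalfWeighted.embed Ω κ) (HHalfWeighted.seminorm Ω κ) where
  complete := inferInstance
  injective := by
    rintro ⟨p, hp⟩ ⟨q, hq⟩ h
    have h : p.fst = q.fst := h
    have hp : p.snd = (κ : ℂ) • HHalf.toL2 Ω p.fst := hp
    have hq : q.snd = (κ : ℂ) • HHalf.toL2 Ω q.fst := hq
    refine Subtype.ext ?_
    rw [WithLp.ext_iff]
    exact Prod.ext h (by change p.snd = q.snd; rw [hp, hq, h])
  dense := (HHalfWeighted.surjective_embed Ω κ).denseRange
  norm_sq := by
    intro ψ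
    rw [HHalfWeighted.seminorm_apply hκ]
    obtain ⟨p, hp⟩ := ψ
    have hp' : p.snd = (κ : ℂ) • HHalf.toL2 Ω p.fst := hp
    change ‖p‖ ^ 2 = ‖p.fst‖ ^ 2 + (κ * ‖HHalf.toL2 Ω p.fst‖) ^ 2
    rw [WithLp.prod_norm_sq_eq_of_L2, hp', norm_smul, Complex.norm_real, Real.norm_of_nonneg hκ]

/-! ### Transfer operators -/

theorem analyticOnNhd_smul_sub {E : Type*} [NormedAddCommGroup E] [NormedSpace ℂ E]
    [CompleteSpace E] {φ ψ : ℂ → ℂ} {A B : E} {F : ℂ → E}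
    (hF : ∀ s : ℂ, 0 < s.re → F s = φ s • A - ψ s • B)
    (hφ : DifferentiableOn ℂ φ {s | 0 < s.re}) (hψ : DifferentiableOn ℂ ψ {s | 0 < s.re}) :
    AnalyticOnNhd ℂ F {s | 0 < s.re} :=
  DifferentiableOn.analyticOnNhd
    (((hφ.smul_const A).sub (hψ.smul_const B)).congr fun s hs => hF s hs)
    (isOpen_lt continuous_const Complex.continuous_re)

theorem exists_norm_smul_sub_le {E : Type*} [NormedAddCommGroup E] [NormedSpace ℂ E]
    {φ ψ : ℂ → ℂ} {A B : E} {F : ℂ → E} {μ σ : ℝ}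
    (hF : ∀ s : ℂ, σ ≤ s.re → F s = φ s • A - ψ s • B)
    (hφ : ∃ M : ℝ, ∀ s : ℂ, σ ≤ s.re → ‖φ s‖ ≤ M * ‖s‖ ^ μ)
    (hψ : ∃ M : ℝ, ∀ s : ℂ, σ ≤ s.re → ‖ψ s‖ ≤ M * ‖s‖ ^ μ) :
    ∃ M : ℝ, ∀ s : ℂ, σ ≤ s.re → ‖F s‖ ≤ M * ‖s‖ ^ μ := by
  obtain ⟨M, hM⟩ := hφ
  obtain ⟨N, hN⟩ := hψ
  refine ⟨M * ‖A‖ + N * ‖B‖, fun s hs => ?_⟩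
  rw [hF s hs]
  refine (norm_sub_le _ _).trans ?_
  rw [norm_smul, norm_smul, add_mul, mul_right_comm M, mul_right_comm N]
  gcongr
  · exact hM s hs
  · exact hN s hs

/-- Leaves only scalar conditions on φ and ψ, together with a lower bound for the quadratic form in
which s and ψ are already separated. -/
theorem isTransferOperator_of_eq_smul_sub {X : Type*} [NormedAddCommGroup X]
    [InnerProductSpace ℂ X] {p : Seminorm ℂ X} {φ ψ : ℂ → ℂ} {A B : X →L[ℂ] AntiDual X}
    {F : ℂ → X →L[ℂ] AntiDual X} {μ σ₀ : ℝ}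
    (hF : ∀ s : ℂ, 0 < s.re → F s = φ s • A - ψ s • B)
    (hφ : DifferentiableOn ℂ φ {s | 0 < s.re}) (hψ : DifferentiableOn ℂ ψ {s | 0 < s.re})
    (bφ : ∀ σ > 0, ∃ M : ℝ, ∀ s : ℂ, σ ≤ s.re → ‖φ s‖ ≤ M * ‖s‖ ^ μ)
    (bψ : ∀ σ > 0, ∃ M : ℝ, ∀ s : ℂ, σ ≤ s.re → ‖ψ s‖ ≤ M * ‖s‖ ^ μ) (h0 : 0 ≤ σ₀)
    (hpos : ∀ σ > σ₀, ∃ c > 0, ∀ (v : X) (s : ℂ), σ ≤ s.re →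
      c * (‖s⁻¹‖ * p v) ^ 2 ≤ (φ s * A v v - ψ s * B v v).re) :
    IsTransferOperator p F μ σ₀ where
  analytic := analyticOnNhd_smul_sub (E := X →L[ℂ] AntiDual X) hF hφ hψ
  bound σ hσ := exists_norm_smul_sub_le (E := X →L[ℂ] AntiDual X) (fun s hs => hF s (hσ.trans_le hs)) (bφ σ hσ) (bψ σ hσ)
  nonneg := h0
  pos σ hσ := by
    obtain ⟨c, hc, h⟩ := hpos σ hσ
    refine ⟨c, hc, fun v s hs => ?_⟩
    rw [map_smul_eq_mul, hF s ((h0.trans_lt hσ).trans_le hs)]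
    exact h v s hs

theorem differentiableOn_cpow_halfPlane (p : ℝ) :
    DifferentiableOn ℂ (fun s : ℂ => s ^ (-p : ℂ)) {s | 0 < s.re} := fun _ hs =>
  (DifferentiableAt.cpow differentiableAt_id (differentiableAt_const _)
    (Or.inl hs)).differentiableWithinAt

theorem exists_norm_cpow_le {p μ : ℝ} (h : -p ≤ μ) :
    ∀ σ > 0, ∃ M : ℝ, ∀ s : ℂ, σ ≤ s.re → ‖s ^ (-p : ℂ)‖ ≤ M * ‖s‖ ^ μ := by
  intro σ hσ
  -- Split |s|^(-p) as |s|^(-p-μ) |s|^μ; the first exponent is nonpositive and |s| ≥ σ.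
  refine ⟨σ ^ (-p - μ), fun s hs => ?_⟩
  have hσs : σ ≤ ‖s‖ := hs.trans (Complex.re_le_norm s)
  have h1 := Complex.norm_cpow_real s (-p)
  rw [Complex.ofReal_neg] at h1
  have h2 : ‖s‖ ^ (-p) = ‖s‖ ^ (-p - μ) * ‖s‖ ^ μ := by
    rw [← Real.rpow_add (hσ.trans_le hσs), sub_add_cancel]
  rw [h1, h2]
  exact mul_le_mul_of_nonneg_right (Real.rpow_le_rpow_of_nonpos hσ hσs (by linarith))
    (Real.rpow_nonneg (norm_nonneg _) _)

theorem cpow_neg_half_re_pos {s : ℂ} (hs : 0 < s.re) : 0 < (s ^ (-(1 / 2 : ℝ) : ℂ)).re := by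
  have hs0 : s ≠ 0 := by
    rintro rfl
    simp at hs
  rw [Complex.cpow_def_of_ne_zero hs0, Complex.exp_re]
  refine mul_pos (Real.exp_pos _) (Real.cos_pos_of_mem_Ioo ?_)
  have h1 : (Complex.log s * (-(1 / 2 : ℝ) : ℂ)).im = -(s.arg / 2) := by
    rw [← Complex.ofReal_neg, Complex.im_mul_ofReal, Complex.log_im]
    ring
  rw [h1]
  have h2 := abs_le.1 (Complex.abs_arg_le_pi_div_two_iff.2 hs.le)
  have h3 := Real.pi_pos
  constructor <;> linarith [h2.1, h2.2]

theorem cpow_neg_half_sq {s : ℂ} (hs : 0 < s.re) : (s ^ (-(1 / 2 : ℝ) : ℂ)) ^ 2 = s⁻¹ := by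
  have hs0 : s ≠ 0 := by
    rintro rfl
    simp at hs
  rw [← Complex.cpow_nat_mul, ← Complex.cpow_neg_one]
  congr 1
  push_cast
  ring

theorem inv_re_pos {s : ℂ} (hs : 0 < s.re) : 0 < s⁻¹.re := by
  rw [Complex.inv_re]
  refine div_pos hs (Complex.normSq_pos.2 ?_)
  rintro rfl
  simp at hs

/-- The real part of `s ^ (-1/2)` dominates that of `s⁻¹`, and `|s|⁻²`. -/
theorem cpow_neg_half_bounds {σ : ℝ} (hσ : 0 < σ) {s : ℂ} (hs : σ ≤ s.re) :
    s⁻¹.re ≤ (s ^ (-(1 / 2 : ℝ) : ℂ)).re * (√σ)⁻¹ ∧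
    (√σ) ^ 3 / 2 * ‖s⁻¹‖ ^ 2 ≤ (s ^ (-(1 / 2 : ℝ) : ℂ)).re := by
  have hs0 : 0 < s.re := hσ.trans_le hs
  -- With z² = s⁻¹ and |z| ≤ σ^(-1/2): Re s⁻¹ = (Re z)² − (Im z)² ≤ Re z · |z| gives the first
  -- bound. Its positivity gives |Im z| < Re z, hence |z|/2 ≤ Re z, and |s⁻¹|² = |z|⁴ ≤ σ^(-3/2) |z|
  -- gives the second.
  set z : ℂ := s ^ (-(1 / 2 : ℝ) : ℂ) with hz
  have h1 : 0 < z.re := cpow_neg_half_re_pos hs0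
  have h2 : z ^ 2 = s⁻¹ := cpow_neg_half_sq hs0
  have h3 : s⁻¹.re = z.re ^ 2 - z.im ^ 2 := by
    rw [← h2, sq, Complex.mul_re]
    ring
  have h4 : ‖s⁻¹‖ = ‖z‖ ^ 2 := by rw [← h2, norm_pow]
  have h5 : 0 < √σ := Real.sqrt_pos.2 hσ
  have h6 : ‖z‖ ≤ (√σ)⁻¹ := by
    refine abs_le_of_sq_le_sq' ?_ (by positivity) |>.2
    rw [← h4, norm_inv, inv_pow, Real.sq_sqrt hσ.le]
    exact inv_anti₀ hσ (hs.trans (Complex.re_le_norm s))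
  have h7 := inv_re_pos hs0
  have h8 : z.re ≤ ‖z‖ := Complex.re_le_norm z
  have h9 : ‖z‖ ^ 2 = z.re ^ 2 + z.im ^ 2 := by
    rw [← Complex.normSq_eq_norm_sq, Complex.normSq_apply]
    ring
  constructor
  · rw [h3]
    nlinarith [sq_nonneg z.im]
  · rw [h4]
    have h10 : √σ * ‖z‖ ≤ 1 := by
      rw [← inv_inv (√σ), inv_mul_le_iff₀ (by positivity), mul_one]
      exact h6
    have h11 : ‖z‖ / 2 ≤ z.re := by
      have : (‖z‖ / 2) ^ 2 ≤ z.re ^ 2 := by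
        rw [h3] at h7
        nlinarith [sq_nonneg z.re]
      exact (abs_le_of_sq_le_sq' this h1.le).2
    have h12 : (√σ * ‖z‖) ^ 3 ≤ 1 := pow_le_one₀ (by positivity) h10
    calc √σ ^ 3 / 2 * (‖z‖ ^ 2) ^ 2 = (√σ * ‖z‖) ^ 3 * (‖z‖ / 2) := by ring
      _ ≤ 1 * (‖z‖ / 2) := by gcongr
      _ ≤ z.re := by linarith

theorem HHalfWeighted.incl_apply_self {Ω : Set E3} {κ : ℝ} (ψ : HHalfWeighted Ω κ) :
    HHalfWeighted.incl Ω κ ψ ψ = ((‖HHalfWeighted.toL2 Ω κ ψ‖ ^ 2 : ℝ) : ℂ) := by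
  have : HHalfWeighted.incl Ω κ ψ ψ =
    inner ℂ (HHalfWeighted.toL2 Ω κ ψ) (HHalfWeighted.toL2 Ω κ ψ) := rfl
  rw [this, inner_self_eq_norm_sq_to_K]
  norm_cast

theorem mul_smul_eq_sub_smul_zero {E : Type*} [AddCommGroup E] [Module ℂ E] (a b : ℂ) (A : E) :
    (a * b) • A = b • a • A - b • (0 : E) := by
  rw [smul_zero, sub_zero, smul_smul, mul_comm]

theorem absorbing1Transfer_eq (Ω : Set E3) (κ ε : ℝ) (s : ℂ) : absorbing1Transfer Ω κ ε s =
    s ^ (-(1 / 2 : ℝ) : ℂ) • ((ε⁻¹ : ℂ) • HHalfWeighted.incl Ω κ) -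
      s ^ (-(1 / 2 : ℝ) : ℂ) • (0 : HHalfWeighted Ω κ →L[ℂ] AntiDual (HHalfWeighted Ω κ)) := by
  rw [absorbing1Transfer, show (-(1 / 2) : ℂ) = (-(1 / 2 : ℝ) : ℂ) by push_cast; rfl]
  exact mul_smul_eq_sub_smul_zero (E := HHalfWeighted Ω κ →L[ℂ] AntiDual (HHalfWeighted Ω κ)) _ _ _

theorem isTransferOperator_absorbing1 (Ω : Set E3) {ε κ : ℝ} (hε : 0 < ε) (hκ : 0 ≤ κ) :
    IsTransferOperator (HHalfWeighted.seminorm Ω κ) (absorbing1Transfer Ω κ ε) 0 0 := by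
  refine isTransferOperator_of_eq_smul_sub (φ := fun s => s ^ (-(1 / 2 : ℝ) : ℂ))
    (ψ := fun s => s ^ (-(1 / 2 : ℝ) : ℂ)) (A := (ε⁻¹ : ℂ) • HHalfWeighted.incl Ω κ) (B := 0)
    (fun s _ => ?_) (differentiableOn_cpow_halfPlane _) (differentiableOn_cpow_halfPlane _)
    (exists_norm_cpow_le (by norm_num)) (exists_norm_cpow_le (by norm_num)) le_rfl
    -- The division is by κ² + 1 and not by κ², so that κ = 0 is included.
    (fun σ hσ => ⟨√σ ^ 3 / 2 * ε⁻¹ / (κ ^ 2 + 1), ?_, fun ψ s hs => ?_⟩)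
  · exact absorbing1Transfer_eq Ω κ ε s
  · have := Real.sqrt_pos.2 hσ
    positivity
  · have h1 := (cpow_neg_half_bounds hσ hs).2
    set z : ℂ := s ^ (-(1 / 2 : ℝ) : ℂ)
    have e1 : ((ε⁻¹ : ℂ) • HHalfWeighted.incl Ω κ) ψ ψ = (ε⁻¹ : ℂ) * HHalfWeighted.incl Ω κ ψ ψ :=
      rfl
    rw [HHalfWeighted.seminorm_apply hκ, e1, HHalfWeighted.incl_apply_self]
    set N := ‖HHalfWeighted.toL2 Ω κ ψ‖
    have e2 : (z * ((ε⁻¹ : ℂ) * ((N ^ 2 : ℝ) : ℂ)) - z * (0 : HHalfWeighted Ω κ →L[ℂ] AntiDual _) ψ ψ).re =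
        z.re * ε⁻¹ * N ^ 2 := by
      have : (0 : HHalfWeighted Ω κ →L[ℂ] AntiDual (HHalfWeighted Ω κ)) ψ ψ = 0 := rfl
      rw [this, mul_zero, sub_zero, ← Complex.ofReal_inv, ← Complex.ofReal_mul,
        Complex.re_mul_ofReal]
      ring
    rw [e2]
    have hk : κ ^ 2 / (κ ^ 2 + 1) ≤ 1 := by
      rw [div_le_one (by positivity)]
      linarith
    calc √σ ^ 3 / 2 * ε⁻¹ / (κ ^ 2 + 1) * (‖s⁻¹‖ * (κ * N)) ^ 2
        = (√σ ^ 3 / 2 * ‖s⁻¹‖ ^ 2) * (ε⁻¹ * N ^ 2) * (κ ^ 2 / (κ ^ 2 + 1)) := by ring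
      _ ≤ z.re * (ε⁻¹ * N ^ 2) * 1 := by
        have : 0 ≤ z.re := le_trans (by positivity) h1
        gcongr
      _ = _ := by ring

theorem inner_self_eq_ofReal_norm_sq {E : Type*} [NormedAddCommGroup E] [InnerProductSpace ℂ E]
    (v : E) : inner ℂ v v = ((‖v‖ ^ 2 : ℝ) : ℂ) := by
  rw [inner_self_eq_norm_sq_to_K]
  norm_cast

theorem add_smul_mul_comm_sub {E : Type*} [AddCommGroup E] [Module ℂ E] (a b c : ℂ) (A B : E) :
    (a * b) • A - c • B = b • a • A - c • B := by
  rw [smul_smul, mul_comm]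

theorem absorbing2Transfer_eq {Ω : Set E3} (hΩ : IsLipschitzExteriorDomain Ω) {ρ : E3 → ℝ}
    (hρ : IsSmoothDefiningFunction Ω ρ) (κ ε : ℝ) (s : ℂ) : absorbing2Transfer hΩ hρ κ ε s =
    s ^ (-(1 / 2 : ℝ) : ℂ) • ((ε⁻¹ : ℂ) • HHalfWeighted.incl Ω κ) -
      s ^ (-(1 : ℝ) : ℂ) • curvatureIncl hΩ hρ κ := by
  rw [absorbing2Transfer, show (-(1 / 2) : ℂ) = (-(1 / 2 : ℝ) : ℂ) by push_cast; rfl,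
    Complex.ofReal_one, Complex.cpow_neg_one]
  exact add_smul_mul_comm_sub (E := HHalfWeighted Ω κ →L[ℂ] AntiDual (HHalfWeighted Ω κ)) _ _ _ _ _

theorem meanCurvature_le_max {Ω : Set E3} (hΩ : IsLipschitzExteriorDomain Ω) {ρ : E3 → ℝ}
    (hρ : IsSmoothDefiningFunction Ω ρ) {x : E3} (hx : x ∈ frontier Ω) :
    meanCurvature ρ x ≤ max 0 (maxMeanCurvature Ω ρ) := by
  have hc : ContinuousOn (meanCurvature ρ) (frontier Ω) := fun x hx =>
    (continuousAt_meanCurvature hρ.smooth (hρ.gradient_ne_zero x hx)).continuousWithinAt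
  exact (le_csSup ((isCompact_frontier hΩ).image_of_continuousOn hc).bddAbove
    (mem_image_of_mem _ hx)).trans (le_max_right _ _)

/-- The form is the integral of ℋ|ψ|², which is real, so that only Re s⁻¹ enters the positivity
estimate for (B2). Only an upper bound is needed, because the term is subtracted. -/
theorem curvatureIncl_apply_self {Ω : Set E3} (hΩ : IsLipschitzExteriorDomain Ω) {ρ : E3 → ℝ}
    (hρ : IsSmoothDefiningFunction Ω ρ) {κ : ℝ} (ψ : HHalfWeighted Ω κ) :
    ∃ r : ℝ, curvatureIncl hΩ hρ κ ψ ψ = r ∧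
      r ≤ max 0 (maxMeanCurvature Ω ρ) * ‖HHalfWeighted.toL2 Ω κ ψ‖ ^ 2 := by
  set v : L2 Ω := HHalfWeighted.toL2 Ω κ ψ with hv
  have h0 : curvatureIncl hΩ hρ κ ψ ψ = inner ℂ v (mulMeanCurvature hΩ hρ v) := rfl
  have h1 : inner ℂ v (mulMeanCurvature hΩ hρ v) =
      ∫ x, ((meanCurvature ρ x * ‖v x‖ ^ 2 : ℝ) : ℂ) ∂(surfaceMeasure Ω) := by
    rw [L2.inner_def]
    refine integral_congr_ae ?_
    filter_upwards [mulMeanCurvature_ae hΩ hρ v] with x hx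
    rw [hx, RCLike.inner_apply, mul_assoc, Complex.mul_conj, Complex.normSq_eq_norm_sq]
    push_cast
    rfl
  have h2 : Integrable (fun x => ‖v x‖ ^ 2) (surfaceMeasure Ω) :=
    (memLp_two_iff_integrable_sq_norm (Lp.aestronglyMeasurable v)).1 (Lp.memLp v)
  have h3 : ‖v‖ ^ 2 = ∫ x, ‖v x‖ ^ 2 ∂(surfaceMeasure Ω) := by
    have h4 : inner ℂ v v = ∫ x, ((‖v x‖ ^ 2 : ℝ) : ℂ) ∂(surfaceMeasure Ω) := by
      rw [L2.inner_def]
      refine integral_congr_ae (Eventually.of_forall fun x => ?_)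
      exact inner_self_eq_ofReal_norm_sq _
    rw [integral_complex_ofReal, inner_self_eq_ofReal_norm_sq] at h4
    exact Complex.ofReal_injective h4
  have h5 : Integrable (fun x => meanCurvature ρ x * ‖v x‖ ^ 2) (surfaceMeasure Ω) := by
    have h6 : Integrable (fun x => inner ℂ (v x) (mulMeanCurvature hΩ hρ v x)) (surfaceMeasure Ω) :=
      L2.integrable_inner v (mulMeanCurvature hΩ hρ v)
    refine h6.re.congr ?_
    filter_upwards [mulMeanCurvature_ae hΩ hρ v] with x hx
    rw [hx, RCLike.inner_apply, mul_assoc, Complex.mul_conj, Complex.normSq_eq_norm_sq,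
      ← Complex.ofReal_mul]
    exact Complex.ofReal_re _
  refine ⟨∫ x, meanCurvature ρ x * ‖v x‖ ^ 2 ∂(surfaceMeasure Ω), ?_, ?_⟩
  · rw [h0, h1, integral_complex_ofReal]
  · rw [h3, ← integral_const_mul]
    refine integral_mono_ae h5 (h2.const_mul _) ?_
    have : ∀ᵐ x ∂(surfaceMeasure Ω), x ∈ frontier Ω :=
      ae_restrict_mem isClosed_frontier.measurableSet
    filter_upwards [this] with x hx
    exact mul_le_mul_of_nonneg_right (meanCurvature_le_max hΩ hρ hx) (sq_nonneg _)

theorem isTransferOperator_absorbing2 {Ω : Set E3} (hΩ : IsLipschitzExteriorDomain Ω) {ρ : E3 → ℝ}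
    (hρ : IsSmoothDefiningFunction Ω ρ) {ε κ : ℝ} (hε : 0 < ε) (hκ : 0 ≤ κ) :
    IsTransferOperator (HHalfWeighted.seminorm Ω κ) (absorbing2Transfer hΩ hρ κ ε) 0
      ((ε * max 0 (maxMeanCurvature Ω ρ)) ^ 2) := by
  set M := max 0 (maxMeanCurvature Ω ρ) with hM
  have hM0 : 0 ≤ M := le_max_left _ _
  -- The abscissa is exactly the threshold ε⁻¹ > M σ^(-1/2). The difference is the share of Re
  -- s^(-1/2) that is left after the curvature term has been absorbed.
  have hlt : ∀ σ > (ε * M) ^ 2, 0 < σ ∧ 0 < ε⁻¹ - M * (√σ)⁻¹ := by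
    intro σ hσ
    have hσ0 : 0 < σ := (sq_nonneg _).trans_lt hσ
    have h1 : ε * M < √σ := Real.lt_sqrt_of_sq_lt hσ
    have h2 := Real.sqrt_pos.2 hσ0
    refine ⟨hσ0, ?_⟩
    rw [sub_pos, ← div_eq_mul_inv, div_lt_iff₀ h2, inv_mul_eq_div, lt_div_iff₀ hε, mul_comm]
    exact h1
  refine isTransferOperator_of_eq_smul_sub (φ := fun s => s ^ (-(1 / 2 : ℝ) : ℂ))
    (ψ := fun s => s ^ (-(1 : ℝ) : ℂ)) (A := (ε⁻¹ : ℂ) • HHalfWeighted.incl Ω κ)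
    (B := curvatureIncl hΩ hρ κ)
    (fun s _ => absorbing2Transfer_eq hΩ hρ κ ε s) (differentiableOn_cpow_halfPlane _)
    (differentiableOn_cpow_halfPlane _)
    (exists_norm_cpow_le (by norm_num)) (exists_norm_cpow_le (by norm_num)) (sq_nonneg _)
    (fun σ hσ => ⟨√σ ^ 3 / 2 * (ε⁻¹ - M * (√σ)⁻¹) / (κ ^ 2 + 1), ?_, fun ψ s hs => ?_⟩)
  · have h1 := (hlt σ hσ).2
    have := Real.sqrt_pos.2 (hlt σ hσ).1
    positivity
  · obtain ⟨hσ0, hσ1⟩ := hlt σ hσ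
    obtain ⟨h2, h1⟩ := cpow_neg_half_bounds hσ0 hs
    have h3 := inv_re_pos (hσ0.trans_le hs)
    rw [Complex.ofReal_one, Complex.cpow_neg_one]
    set z : ℂ := s ^ (-(1 / 2 : ℝ) : ℂ)
    obtain ⟨r, hr, hrM⟩ := curvatureIncl_apply_self hΩ hρ ψ
    have e1 : ((ε⁻¹ : ℂ) • HHalfWeighted.incl Ω κ) ψ ψ = (ε⁻¹ : ℂ) * HHalfWeighted.incl Ω κ ψ ψ :=
      rfl
    rw [HHalfWeighted.seminorm_apply hκ, e1, HHalfWeighted.incl_apply_self, hr]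
    set N := ‖HHalfWeighted.toL2 Ω κ ψ‖
    have e2 : (z * ((ε⁻¹ : ℂ) * ((N ^ 2 : ℝ) : ℂ)) - s⁻¹ * r).re =
        z.re * ε⁻¹ * N ^ 2 - s⁻¹.re * r := by
      rw [Complex.sub_re, ← Complex.ofReal_inv, ← Complex.ofReal_mul, Complex.re_mul_ofReal,
        Complex.re_mul_ofReal]
      ring
    rw [e2]
    have hk : κ ^ 2 / (κ ^ 2 + 1) ≤ 1 := by
      rw [div_le_one (by positivity)]
      linarith
    have h4 : s⁻¹.re * r ≤ z.re * (√σ)⁻¹ * (M * N ^ 2) :=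
      (mul_le_mul_of_nonneg_left hrM h3.le).trans
        (mul_le_mul_of_nonneg_right h2 (by positivity))
    calc √σ ^ 3 / 2 * (ε⁻¹ - M * (√σ)⁻¹) / (κ ^ 2 + 1) * (‖s⁻¹‖ * (κ * N)) ^ 2
        = (√σ ^ 3 / 2 * ‖s⁻¹‖ ^ 2) * ((ε⁻¹ - M * (√σ)⁻¹) * N ^ 2) * (κ ^ 2 / (κ ^ 2 + 1)) := by ring
      _ ≤ z.re * ((ε⁻¹ - M * (√σ)⁻¹) * N ^ 2) * 1 := by
        have : 0 ≤ z.re := le_trans (by positivity) h1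
        gcongr
      _ ≤ _ := by linarith

theorem smul_eq_smul_sub_smul_zero {E : Type*} [AddCommGroup E] [Module ℂ E] (a : ℂ) (A : E) :
    a • A = a • A - a • (0 : E) := by
  rw [smul_zero, sub_zero]

theorem acousticTransfer_eq (Ω : Set E3) (m α k : ℝ) (s : ℂ) : acousticTransfer Ω m α k s =
    (m * s + α + k * s⁻¹)⁻¹ • HHalfWeighted.incl Ω 0 -
      (m * s + α + k * s⁻¹)⁻¹ • (0 : HHalfWeighted Ω 0 →L[ℂ] AntiDual (HHalfWeighted Ω 0)) :=
  smul_eq_smul_sub_smul_zero (E := HHalfWeighted Ω 0 →L[ℂ] AntiDual (HHalfWeighted Ω 0)) _ _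

theorem isTransferOperator_acoustic (Ω : Set E3) {m α k : ℝ} (hm : 0 < m) (hα : 0 ≤ α)
    (hk : 0 < k) :
    IsTransferOperator (HHalfWeighted.seminorm Ω 0) (acousticTransfer Ω m α k) (-1) 0 := by
  have hd : DifferentiableOn ℂ (fun s : ℂ => (m * s + α + k * s⁻¹)⁻¹) {s | 0 < s.re} := by
    intro s hs
    have hs0 : s ≠ 0 := by
      rintro rfl
      simp at hs
    have h2 : DifferentiableAt ℂ (fun s : ℂ => s⁻¹) s := differentiableAt_inv hs0
    have h3 : DifferentiableAt ℂ (fun s : ℂ => (m * s + α + k * s⁻¹ : ℂ)) s := by fun_prop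
    exact (h3.fun_inv (oscillator_ne_zero hm hα hk hs)).differentiableWithinAt
  have hb : ∀ σ > 0, ∃ M : ℝ, ∀ s : ℂ, σ ≤ s.re →
      ‖(m * s + α + k * s⁻¹)⁻¹‖ ≤ M * ‖s‖ ^ (-1 : ℝ) := fun σ hσ =>
    ⟨_, fun s hs => norm_inv_oscillator_le hm hα hk hσ hs⟩
  -- The seminorm is zero for κ = 0, so any constant serves; what has to be shown is that the real
  -- part is nonnegative.
  refine isTransferOperator_of_eq_smul_sub (fun s _ => acousticTransfer_eq Ω m α k s) hd hd hb hb
    le_rfl (fun σ hσ => ⟨1, one_pos, fun ψ s hs => ?_⟩)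
  have e0 : (0 : HHalfWeighted Ω 0 →L[ℂ] AntiDual (HHalfWeighted Ω 0)) ψ ψ = 0 := rfl
  rw [HHalfWeighted.seminorm_apply le_rfl, HHalfWeighted.incl_apply_self, e0, mul_zero, sub_zero,
    Complex.re_mul_ofReal, zero_mul, mul_zero]
  have h1 := le_re_oscillator (m := m) hα hk (hσ.trans_le hs)
  have h2 := mul_pos hm (hσ.trans_le hs)
  have h3 := inv_re_pos (h2.trans_le h1)
  simp only [ne_eq, OfNat.ofNat_ne_zero, not_false_eq_true, zero_pow, mul_zero]
  positivity

/-- The factor s is written as s^(-p) with p = −1, so that the power-law lemmas apply to both terms.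
-/
theorem thinCoating_smul_eq {E : Type*} [AddCommGroup E] [Module ℂ E] (a s : ℂ) (A B : E) :
    a • (s • A - s⁻¹ • B) = s ^ (-(-1 : ℝ) : ℂ) • a • A - s ^ (-(1 : ℝ) : ℂ) • a • B := by
  have : (-(-1 : ℝ) : ℂ) = 1 := by simp
  rw [this, Complex.cpow_one, Complex.ofReal_one, Complex.cpow_neg_one, smul_sub, smul_comm a s,
    smul_comm a s⁻¹]

theorem thinCoatingTransfer_eq (Ω : Set E3) (ε : ℝ) (s : ℂ) : thinCoatingTransfer Ω ε s =
    s ^ (-(-1 : ℝ) : ℂ) • ((ε : ℂ) • H1.incl Ω ε) -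
      s ^ (-(1 : ℝ) : ℂ) • ((ε : ℂ) • laplaceBeltrami Ω ε) := by
  have := thinCoating_smul_eq (E := H1 Ω ε →L[ℂ] AntiDual (H1 Ω ε)) ε s (H1.incl Ω ε)
    (laplaceBeltrami Ω ε)
  exact this

theorem H1.seminorm_apply {Ω : Set E3} {ε : ℝ} (ψ : H1 Ω ε) :
    H1.seminorm Ω ε ψ = √ε * ‖H1.grad Ω ε ψ‖ := by
  rw [H1.seminorm, smul_apply, NNReal.smul_def, Real.coe_toNNReal _ (Real.sqrt_nonneg _)]
  rfl

/-- Since Re s⁻¹ = Re s/|s|², the gradient part of the form equals Re s times the squared seminorm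
of s⁻¹ψ, so c = σ works. The L² part is nonnegative and is dropped. -/
theorem isTransferOperator_thinCoating (Ω : Set E3) {ε : ℝ} (hε : 0 < ε) :
    IsTransferOperator (H1.seminorm Ω ε) (thinCoatingTransfer Ω ε) 1 0 := by
  refine isTransferOperator_of_eq_smul_sub (fun s _ => thinCoatingTransfer_eq Ω ε s)
    (differentiableOn_cpow_halfPlane _) (differentiableOn_cpow_halfPlane _)
    (exists_norm_cpow_le (by norm_num)) (exists_norm_cpow_le (by norm_num)) le_rfl
    (fun σ hσ => ⟨σ, hσ, fun ψ s hs => ?_⟩)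
  have hs0 : 0 < s.re := lt_of_lt_of_le hσ hs
  have e0 : (-(-1 : ℝ) : ℂ) = 1 := by simp
  have e1 : ((ε : ℂ) • H1.incl Ω ε) ψ ψ = ((ε * ‖H1.toL2 Ω ε ψ‖ ^ 2 : ℝ) : ℂ) := by
    have : ((ε : ℂ) • H1.incl Ω ε) ψ ψ = (ε : ℂ) * inner ℂ (H1.toL2 Ω ε ψ) (H1.toL2 Ω ε ψ) := rfl
    rw [this, inner_self_eq_ofReal_norm_sq, ← Complex.ofReal_mul]
  have e2 : ((ε : ℂ) • laplaceBeltrami Ω ε) ψ ψ = ((-(ε * ‖H1.grad Ω ε ψ‖ ^ 2) : ℝ) : ℂ) := by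
    have : ((ε : ℂ) • laplaceBeltrami Ω ε) ψ ψ =
      (ε : ℂ) * -inner ℂ (H1.grad Ω ε ψ) (H1.grad Ω ε ψ) := rfl
    rw [this, inner_self_eq_ofReal_norm_sq, mul_neg, ← Complex.ofReal_mul, Complex.ofReal_neg]
  rw [e0, Complex.cpow_one, Complex.ofReal_one, Complex.cpow_neg_one, e1, e2, H1.seminorm_apply,
    Complex.sub_re, Complex.re_mul_ofReal, Complex.re_mul_ofReal, Complex.inv_re,
    Complex.normSq_eq_norm_sq]
  set N := ‖H1.toL2 Ω ε ψ‖
  set G := ‖H1.grad Ω ε ψ‖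
  have h1 : 0 < ‖s‖ := hs0.trans_le (Complex.re_le_norm s)
  have h2 : (‖s⁻¹‖ * (√ε * G)) ^ 2 = ε * G ^ 2 / ‖s‖ ^ 2 := by
    rw [mul_pow, mul_pow, Real.sq_sqrt hε.le, norm_inv, inv_pow]
    ring
  rw [h2]
  have h3 : 0 ≤ s.re * (ε * N ^ 2) := by positivity
  have h4 : σ * (ε * G ^ 2 / ‖s‖ ^ 2) ≤ s.re * (ε * G ^ 2 / ‖s‖ ^ 2) := by gcongr
  have h5 : s.re / ‖s‖ ^ 2 * -(ε * G ^ 2) = -(s.re * (ε * G ^ 2 / ‖s‖ ^ 2)) := by ring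
  rw [h5]
  linarith

/-! ### The boundary conditions as temporal convolutions -/

theorem contDiff_deriv_of_succ {V : Type*} [NormedAddCommGroup V] [NormedSpace ℝ V] {n : ℕ}
    {u : ℝ → V} (hu : ContDiff ℝ (n + 1 : ℕ) u) : ContDiff ℝ n (deriv u) := by
  have h2 : ContDiff ℝ (n + 1) u := by exact_mod_cast hu
  exact (contDiff_succ_iff_deriv.1 h2).2.2

section Convolutions

variable {V : Type*} [NormedAddCommGroup V] [NormedSpace ℂ V] [CompleteSpace V]

/-- For n = j + 1 the left side has the order j + 3/2 and j + 2 derivatives of u. Cancelling j of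
them leaves the expression in `halfDeriv_eq`. -/
theorem causalConv_fracKernel_half {n : ℕ} (hn : 1 ≤ n) {u : ℝ → V}
    (hu : ContDiff ℝ (n + 1 : ℕ) u) (hu0 : ∀ t ≤ 0, u t = 0) (t : ℝ) :
    causalConv (fracKernel (n + (1 / 2 : ℝ))) (iteratedDeriv n (deriv u)) t = halfDeriv u t := by
  obtain ⟨j, rfl⟩ : ∃ j, n = j + 1 := ⟨n - 1, by omega⟩
  have h2 : ContDiff ℝ 2 u := hu.of_le (by norm_cast; omega)
  have h1 : ContDiff ℝ 1 u := h2.of_le one_le_two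
  have hd : ContDiff ℝ (j + 1 : ℕ) (deriv u) := contDiff_deriv_of_succ hu
  have hdd : ContDiff ℝ j (deriv (deriv u)) := contDiff_deriv_of_succ hd
  have hd1 : ContDiff ℝ 1 (deriv u) := contDiff_deriv_of_succ h2
  have hu0' := hasDerivAt_zero_of_nonpos h1 hu0
  rw [halfDeriv_eq h2 hu0, iteratedDeriv_succ', iteratedDeriv_succ', iteratedDeriv_one,
    ← causalConv_fracKernel_iteratedDeriv (b := 3 / 2) (by norm_num) hdd
      (hasDerivAt_zero_of_nonpos hd1 hu0')]
  congr 2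
  push_cast
  ring

theorem causalConv_fracKernel_add_one {n : ℕ} {u : ℝ → V} (hu : ContDiff ℝ (n + 1 : ℕ) u)
    (hu0 : ∀ t ≤ 0, u t = 0) (t : ℝ) :
    causalConv (fracKernel (n + 1)) (iteratedDeriv n (deriv u)) t = u t := by
  have h1 : ContDiff ℝ 1 u := hu.of_le (by norm_cast; omega)
  rw [add_comm, causalConv_fracKernel_iteratedDeriv one_pos (contDiff_deriv_of_succ hu)
    (hasDerivAt_zero_of_nonpos h1 hu0), causalConv_fracKernel_one_deriv h1 hu0]

/-- For n = j + 2 the order is j + 1, so this is the previous identity applied to ∂ₜ²u with j in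
place of n. -/
theorem causalConv_fracKernel_sub_one {n : ℕ} (hn : 2 ≤ n) {u : ℝ → V}
    (hu : ContDiff ℝ (n + 1 : ℕ) u) (hu0 : ∀ t ≤ 0, u t = 0) (t : ℝ) :
    causalConv (fracKernel (n + (-1 : ℝ))) (iteratedDeriv n (deriv u)) t = iteratedDeriv 2 u t := by
  obtain ⟨j, rfl⟩ : ∃ j, n = j + 2 := ⟨n - 2, by omega⟩
  have h2 : ContDiff ℝ 2 u := hu.of_le (by norm_cast; omega)
  have h1 : ContDiff ℝ 1 u := hu.of_le (by norm_cast; omega)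
  have hd : ContDiff ℝ (j + 2 : ℕ) (deriv u) := contDiff_deriv_of_succ hu
  have hdd : ContDiff ℝ (j + 1 : ℕ) (deriv (deriv u)) := contDiff_deriv_of_succ hd
  have hd1 : ContDiff ℝ 1 (deriv u) := hd.of_le (by norm_cast; omega)
  have hu0' := hasDerivAt_zero_of_nonpos h1 hu0
  have h3 : ((j + 2 : ℕ) : ℝ) + (-1) = j + 1 := by push_cast; ring
  rw [h3, iteratedDeriv_succ', iteratedDeriv_succ', iteratedDeriv_succ',
    iteratedDeriv_one]
  exact causalConv_fracKernel_add_one hdd (hasDerivAt_zero_of_nonpos hd1 hu0') t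

end Convolutions

theorem absorbing1_iff (Ω : Set E3) (κ ε : ℝ) {n : ℕ} {σ T : ℝ} (hn : 1 ≤ n) (hσ : 0 < σ)
    {u : ℝ → HHalfWeighted Ω κ} {dnu : ℝ → AntiDual (HHalfWeighted Ω κ)}
    (hu : ContDiff ℝ (n + 1 : ℕ) u) (hu0 : ∀ t ≤ 0, u t = 0) :
    absorbing1 Ω κ ε T u dnu ↔ ∀ t ∈ Icc 0 T,
      dnu t = temporalConvolution (absorbing1Transfer Ω κ ε) n σ (deriv u) t := by
  refine forall₂_congr fun t _ => ?_
  have hn1 : (1 : ℝ) ≤ n := by exact_mod_cast hn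
  rw [temporalConvolution_cpow hσ (by linarith) (by linarith)
    (fun s _ => absorbing1Transfer_eq Ω κ ε s) (contDiff_deriv_of_succ hu),
    causalConv_fracKernel_half hn hu hu0]
  have : ∀ v, ((0 : HHalfWeighted Ω κ →L[ℂ] AntiDual (HHalfWeighted Ω κ)) v) = 0 := fun _ => rfl
  rw [this, sub_zero]
  rfl

theorem absorbing2_iff {Ω : Set E3} (hΩ : IsLipschitzExteriorDomain Ω) {ρ : E3 → ℝ}
    (hρ : IsSmoothDefiningFunction Ω ρ) (κ ε : ℝ) {n : ℕ} {σ T : ℝ} (hn : 1 ≤ n) (hσ : 0 < σ)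
    {u : ℝ → HHalfWeighted Ω κ} {dnu : ℝ → AntiDual (HHalfWeighted Ω κ)}
    (hu : ContDiff ℝ (n + 1 : ℕ) u) (hu0 : ∀ t ≤ 0, u t = 0) :
    absorbing2 hΩ hρ κ ε T u dnu ↔ ∀ t ∈ Icc 0 T,
      dnu t = temporalConvolution (absorbing2Transfer hΩ hρ κ ε) n σ (deriv u) t := by
  refine forall₂_congr fun t _ => ?_
  have hn1 : (1 : ℝ) ≤ n := by exact_mod_cast hn
  rw [temporalConvolution_cpow hσ (by linarith) (by linarith)
    (fun s _ => absorbing2Transfer_eq hΩ hρ κ ε s) (contDiff_deriv_of_succ hu),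
    causalConv_fracKernel_half hn hu hu0, causalConv_fracKernel_add_one hu hu0]
  rfl

theorem thinCoating_iff (Ω : Set E3) (ε : ℝ) [CompleteSpace (H1 Ω ε)] {n : ℕ} {σ T : ℝ}
    (hn : 3 ≤ n) (hσ : 0 < σ) {u : ℝ → H1 Ω ε} {dnu : ℝ → AntiDual (H1 Ω ε)}
    (hu : ContDiff ℝ (n + 1 : ℕ) u) (hu0 : ∀ t ≤ 0, u t = 0) :
    thinCoating Ω ε T u dnu ↔ ∀ t ∈ Icc 0 T,
      dnu t = temporalConvolution (thinCoatingTransfer Ω ε) n σ (deriv u) t := by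
  refine forall₂_congr fun t _ => ?_
  have hn1 : (3 : ℝ) ≤ n := by exact_mod_cast hn
  rw [temporalConvolution_cpow hσ (by linarith) (by linarith)
    (fun s _ => thinCoatingTransfer_eq Ω ε s) (contDiff_deriv_of_succ hu),
    causalConv_fracKernel_sub_one (by omega) hu hu0, causalConv_fracKernel_add_one hu hu0,
    smul_sub]
  rfl

/-- Let W be the X-valued oscillator velocity driven by ∂ₜu. Since the inclusion of X in X' is
linear and continuous, minus the image of ∫W is an admissible displacement with velocity minus the
image of W. Uniqueness in X' forces every admissible δ to have this velocity on [0, T], and ∂ₜδ =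
−∂ₙu identifies ∂ₙu. -/
theorem acoustic_iff (Ω : Set E3) {m α k : ℝ} (hm : 0 < m) (hα : 0 ≤ α) (hk : 0 < k) {n : ℕ}
    {σ T : ℝ} (hn : 0 < n) (hσ : 0 < σ) {u : ℝ → HHalfWeighted Ω 0}
    {dnu : ℝ → AntiDual (HHalfWeighted Ω 0)}
    (hu : ContDiff ℝ (n + 1 : ℕ) u) (hu0 : ∀ t ≤ 0, u t = 0) :
    acoustic Ω m α k T u dnu ↔ ∀ t ∈ Icc 0 T,
      dnu t = temporalConvolution (acousticTransfer Ω m α k) n σ (deriv u) t := by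
  have hdec := laplaceDecay_oscillator hm hα hk hσ hn
  set W : ℝ → HHalfWeighted Ω 0 :=
    causalConv (invLaplace (fun s => (m * s + α + k * s⁻¹)⁻¹ * (s ^ n)⁻¹) σ)
      (iteratedDeriv n (deriv u)) with hW
  set A := HHalfWeighted.incl Ω 0 with hA
  have hconv : ∀ t, temporalConvolution (acousticTransfer Ω m α k) n σ (deriv u) t = A (W t) := by
    intro t
    rw [temporalConvolution_sub (fun s _ => acousticTransfer_eq Ω m α k s) hdec hdec
      (contDiff_deriv_of_succ hu)]
    exact sub_zero _
  simp_rw [hconv]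
  obtain ⟨hW0, hW'⟩ := oscillator_causalConv hm hα hk hσ hn hu hu0 hW
  choose W' h1 h2 h3 using hW'
  set J : ℝ → HHalfWeighted Ω 0 := fun t => ∫ τ in (0 : ℝ)..t, W τ with hJ
  have hAd : ∀ {f : ℝ → HHalfWeighted Ω 0} {f' t}, HasDerivAt f f' t →
      HasDerivWithinAt (fun t => -A (f t)) (-A f') (Icc 0 T) t := by
    intro f f' t h
    have := ((A.restrictScalars ℝ).hasFDerivAt.comp_hasDerivAt t h).neg
    exact this.hasDerivWithinAt
  have hode : ∀ t, (m : ℂ) • -A (W' t) + (α : ℂ) • -A (W t) + (k : ℂ) • -A (J t) +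
      A (deriv u t) = 0 := by
    intro t
    rw [← h2 t, map_add, map_add, map_smul, map_smul, map_smul]
    simp only [smul_neg]
    abel
  have hstd : ∀ t ∈ Icc 0 T, HasDerivWithinAt (fun t => -A (J t)) (-A (W t)) (Icc 0 T) t ∧
      HasDerivWithinAt (fun t => -A (W t)) (-A (W' t)) (Icc 0 T) t ∧
      (m : ℂ) • -A (W' t) + (α : ℂ) • -A (W t) + (k : ℂ) • -A (J t) + A (deriv u t) = 0 :=
    fun t _ => ⟨hAd (h3 t), hAd (h1 t), hode t⟩
  have hJ0 : J 0 = 0 := by simp [hJ]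
  constructor
  · rintro ⟨δ, δ', δ'', hδ0, hδ0', h⟩ t ht
    have huniq := oscillator_unique (m := (m : ℂ)) (by exact_mod_cast hm.ne')
      (z := fun t => -A (J t)) (z' := fun t => -A (W t)) (z'' := fun t => -A (W' t))
      (f := fun t => A (deriv u t))
      (by rw [hδ0, hJ0, map_zero, neg_zero]) (by rw [hδ0', hW0, map_zero, neg_zero])
      (fun t ht => ⟨(h t ht).1, (h t ht).2.1, (h t ht).2.2.1⟩) hstd t ht
    have := (h t ht).2.2.2
    rw [huniq] at this
    exact (neg_injective this).symm
  · intro h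
    refine ⟨fun t => -A (J t), fun t => -A (W t), fun t => -A (W' t), ?_, ?_, fun t ht => ?_⟩
    · simp only [hJ0, map_zero, neg_zero]
    · simp only [hW0, map_zero, neg_zero]
    · refine ⟨(hstd t ht).1, (hstd t ht).2.1, (hstd t ht).2.2, ?_⟩
      rw [h t ht]

/-! ### The surface measure in graph charts -/

theorem fst_graphMap (e : E3 ≃ₗᵢ[ℝ] WithLp 2 (E2 × ℝ)) (g : E2 → ℝ) (y : E2) :
    (e (graphMap e g y)).fst = y := by
  simp [graphMap]

theorem dist_fst_le (e : E3 ≃ₗᵢ[ℝ] WithLp 2 (E2 × ℝ)) (x y : E3) :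
    dist (e x).fst (e y).fst ≤ dist x y := by
  rw [← e.dist_map x y, dist_eq_norm, dist_eq_norm]
  exact WithLp.norm_fst_le _ (e x - e y)

theorem dist_le_dist_graphMap (e : E3 ≃ₗᵢ[ℝ] WithLp 2 (E2 × ℝ)) (g : E2 → ℝ) (y z : E2) :
    dist y z ≤ dist (graphMap e g y) (graphMap e g z) := by
  have := dist_fst_le e (graphMap e g y) (graphMap e g z)
  rwa [fst_graphMap, fst_graphMap] at this

theorem continuous_fst_apply (e : E3 ≃ₗᵢ[ℝ] WithLp 2 (E2 × ℝ)) :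
    Continuous fun x => (e x).fst := by
  fun_prop

section Chart

variable {Ω : Set E3} {e : E3 ≃ₗᵢ[ℝ] WithLp 2 (E2 × ℝ)} {g : E2 → ℝ} {U : Set E3}

/-- A boundary point is not strictly above the graph because Ω is open, and not strictly below it
because it is a limit of points of Ω ∩ U, which lie above. This is the converse of
`graphMap_mem_frontier`. -/
theorem graphMap_fst_of_mem_frontier (hΩ : IsOpen Ω) (h : IsGraphChart Ω e g U) {x : E3}
    (hx : x ∈ frontier Ω) (hU : x ∈ U) : graphMap e g (e x).fst = x := by
  obtain ⟨K, hK⟩ := h.lipschitz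
  have hgc : Continuous fun x => g (e x).fst := hK.continuous.comp (continuous_fst_apply e)
  have hsc : Continuous fun x => (e x).snd := by fun_prop
  have h1 : (e x).snd ≤ g (e x).fst := by
    by_contra hn
    have h2 : x ∈ Ω := (h.above x hU).2 (not_le.1 hn)
    rw [hΩ.frontier_eq] at hx
    exact hx.2 h2
  have h2 : g (e x).fst ≤ (e x).snd := by
    have h3 : x ∈ closure (Ω ∩ U) := by
      rw [inter_comm]
      exact h.isOpen.inter_closure ⟨hU, frontier_subset_closure hx⟩
    refine closure_minimal (s := Ω ∩ U) (t := {x | g (e x).fst ≤ (e x).snd}) ?_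
      (isClosed_le hgc hsc) h3
    rintro z ⟨hz, hzU⟩
    exact ((h.above z hzU).1 hz).le
  have h4 : e x = WithLp.toLp 2 ((e x).fst, g (e x).fst) := by
    rw [WithLp.ext_iff]
    exact Prod.ext rfl (le_antisymm h1 h2)
  rw [graphMap, ← h4, e.symm_apply_apply]

/-- A Lipschitz map of constant C enlarges two-dimensional Hausdorff measure by at most C². The
opposite bound `map_graphMap_le` uses that the projection to the parameter plane has Lipschitz
constant one. -/
theorem exists_restrict_le_map (hΩ : IsOpen Ω) (h : IsGraphChart Ω e g U) :
    ∃ C : ℝ≥0, (surfaceMeasure Ω).restrict U ≤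
      (C : ℝ≥0∞) • (volume.restrict (graphMap e g ⁻¹' U)).map (graphMap e g) := by
  obtain ⟨C, hC⟩ := exists_lipschitz_graphMap h
  have hG := continuous_graphMap h
  refine ⟨C ^ 2, Measure.le_iff.2 fun A hA => ?_⟩
  rw [Measure.restrict_apply hA, Measure.smul_apply, Measure.map_apply hG.measurable hA,
    Measure.restrict_apply (hG.measurable hA), surfaceMeasure,
    Measure.restrict_apply (hA.inter h.isOpen.measurableSet)]
  set B := graphMap e g ⁻¹' A ∩ graphMap e g ⁻¹' U
  have hsub : A ∩ U ∩ frontier Ω ⊆ graphMap e g '' B := by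
    rintro x ⟨⟨hA, hU⟩, hx⟩
    have := graphMap_fst_of_mem_frontier hΩ h hx hU
    exact ⟨(e x).fst, by simp only [B, mem_inter_iff, mem_preimage, this]; exact ⟨hA, hU⟩, this⟩
  refine (measure_mono hsub).trans ?_
  have hμ := hC.hausdorffMeasure_image_le (d := 2) (by norm_num) B
  rw [← EuclideanSpace.euclideanHausdorffMeasure_eq_volume]
  simp only [Measure.euclideanHausdorffMeasure_def, Measure.smul_apply]
  rw [smul_comm]
  gcongr
  simpa using hμ

/-- The exceptional set in Γ ∩ U is contained in the Lipschitz image of a null set of the plane. -/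
theorem ae_of_ae_graphMap (hΩ : IsOpen Ω) (h : IsGraphChart Ω e g U) {P : E3 → Prop}
    (hP : ∀ᵐ y : E2, graphMap e g y ∈ U → P (graphMap e g y)) :
    ∀ᵐ x ∂surfaceMeasure Ω, x ∈ U → P x := by
  obtain ⟨C, hC⟩ := exists_restrict_le_map hΩ h
  obtain ⟨L, hL⟩ := exists_lipschitz_graphMap h
  have hG := continuous_graphMap h
  rw [ae_iff]
  have hP' : volume {y : E2 | ¬ (graphMap e g y ∈ U → P (graphMap e g y))} = 0 := ae_iff.1 hP
  have hsub : {x | ¬ (x ∈ U → P x)} ∩ frontier Ω ⊆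
      graphMap e g '' {y : E2 | ¬ (graphMap e g y ∈ U → P (graphMap e g y))} := by
    rintro x ⟨hx, hf⟩
    have hx' : ¬ (x ∈ U → P x) := hx
    have hU : x ∈ U := by
      by_contra hn
      exact hx' fun h => absurd h hn
    have := graphMap_fst_of_mem_frontier hΩ h hf hU
    refine ⟨(e x).fst, ?_, this⟩
    change ¬ (graphMap e g (e x).fst ∈ U → P (graphMap e g (e x).fst))
    rwa [this]
  have hzero : (Measure.euclideanHausdorffMeasure 2 : Measure E3)
      ({x | ¬ (x ∈ U → P x)} ∩ frontier Ω) = 0 := by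
    refine measure_mono_null hsub ?_
    have hμ := hL.hausdorffMeasure_image_le (d := 2) (by norm_num)
      {y : E2 | ¬ (graphMap e g y ∈ U → P (graphMap e g y))}
    rw [← EuclideanSpace.euclideanHausdorffMeasure_eq_volume] at hP'
    simp only [Measure.euclideanHausdorffMeasure_def, Measure.smul_apply] at hP' ⊢
    simp only [Nat.cast_ofNat] at hP' ⊢
    rcases smul_eq_zero.1 hP' with h0 | h0
    · rw [h0, zero_smul]
    · rw [h0, mul_zero] at hμ
      rw [le_antisymm hμ bot_le, smul_zero]
  rw [surfaceMeasure, Measure.restrict_apply' isClosed_frontier.measurableSet]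
  exact hzero

end Chart

/-! ### Finite atlases -/

/-- A graph chart together with a disc in its parameter domain. -/
structure ChartDisc (Ω : Set E3) where
  e : E3 ≃ₗᵢ[ℝ] WithLp 2 (E2 × ℝ)
  g : E2 → ℝ
  U : Set E3
  c : E2
  R : ℝ
  chart : IsGraphChart Ω e g U
  R_pos : 0 < R
  -- The factor 3 leaves room for translations by |h| < 2R, the differences of points of the disc of
  -- radius R.
  ball_subset : Metric.ball c (3 * R) ⊆ graphMap e g ⁻¹' U

namespace ChartDisc

variable {Ω : Set E3} (d : ChartDisc Ω)

/-- The part of the chart domain above the disc. -/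
def dom : Set E3 := d.U ∩ {x | (d.e x).fst ∈ Metric.ball d.c d.R}

theorem isOpen_dom : IsOpen d.dom :=
  d.chart.isOpen.inter (Metric.isOpen_ball.preimage (continuous_fst_apply d.e))

end ChartDisc

theorem exists_chartDisc {Ω : Set E3} (hΩ : IsLipschitzExteriorDomain Ω) {x : E3}
    (hx : x ∈ frontier Ω) : ∃ d : ChartDisc Ω, x ∈ d.dom := by
  obtain ⟨e, g, U, hU, h⟩ := hΩ.lipschitz x hx
  have h1 : (e x).fst ∈ graphMap e g ⁻¹' U := by
    rw [mem_preimage, graphMap_fst_of_mem_frontier hΩ.isOpen h hx hU]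
    exact hU
  obtain ⟨r, hr, hball⟩ := Metric.isOpen_iff.1 (h.isOpen.preimage (continuous_graphMap h)) _ h1
  refine ⟨⟨e, g, U, (e x).fst, r / 3, h, by linarith, ?_⟩, hU, ?_⟩
  · rwa [mul_div_cancel₀ _ (by norm_num : (3 : ℝ) ≠ 0)]
  · simp only [mem_ofPred_eq]
    exact Metric.mem_ball_self (by linarith)

theorem exists_finite_atlas {Ω : Set E3} (hΩ : IsLipschitzExteriorDomain Ω) :
    ∃ t : Finset (ChartDisc Ω), frontier Ω ⊆ ⋃ d ∈ t, d.dom :=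
  (isCompact_frontier hΩ).elim_finite_subcover (fun d : ChartDisc Ω => d.dom)
    (fun d => d.isOpen_dom) fun _ hx => mem_iUnion.2 (exists_chartDisc hΩ hx)

theorem exists_lebesgue_number {Ω : Set E3} (hΩ : IsLipschitzExteriorDomain Ω)
    {t : Finset (ChartDisc Ω)} (ht : frontier Ω ⊆ ⋃ d ∈ t, d.dom) :
    ∃ δ > 0, ∀ x ∈ frontier Ω, ∃ d ∈ t, Metric.ball x δ ⊆ d.dom := by
  obtain ⟨δ, hδ, h⟩ := lebesgue_number_lemma_of_metric (isCompact_frontier hΩ)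
    (c := fun d : t => d.1.dom) (fun d => d.1.isOpen_dom) (by
      refine ht.trans fun x hx => ?_
      simp only [mem_iUnion] at hx ⊢
      obtain ⟨d, hd, hx⟩ := hx
      exact ⟨⟨d, hd⟩, hx⟩)
  refine ⟨δ, hδ, fun x hx => ?_⟩
  obtain ⟨d, hd⟩ := h x hx
  exact ⟨d.1, d.2, hd⟩

theorem volume_ball_plane (y : E2) (r : ℝ) :
    volume (Metric.ball y r) = NNReal.pi * ENNReal.ofReal r ^ 2 := by
  rw [EuclideanSpace.volume_ball_fin_two, mul_comm, ← NNReal.coe_real_pi, ENNReal.ofReal_coe_nnreal]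

theorem ae_mem_frontier (Ω : Set E3) : ∀ᵐ x ∂surfaceMeasure Ω, x ∈ frontier Ω :=
  ae_restrict_mem isClosed_frontier.measurableSet

/-- The surface measure is upper two-regular. -/
theorem exists_measure_ball_le {Ω : Set E3} (hΩ : IsLipschitzExteriorDomain Ω) :
    ∃ A : ℝ≥0, ∀ (x : E3) (r : ℝ), surfaceMeasure Ω (Metric.ball x r) ≤ A * ENNReal.ofReal r ^ 2 := by
  obtain ⟨t, ht⟩ := exists_finite_atlas hΩ
  choose C hC using fun d : ChartDisc Ω => exists_restrict_le_map hΩ.isOpen d.chart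
  refine ⟨∑ d ∈ t, C d * NNReal.pi, fun x r => ?_⟩
  -- The projection of a ball of radius r to the parameter plane lies in a disc of radius r, which
  -- has the area πr².
  have h1 : ∀ d : ChartDisc Ω, surfaceMeasure Ω (Metric.ball x r ∩ d.U) ≤
      (C d * NNReal.pi : ℝ≥0) * ENNReal.ofReal r ^ 2 := by
    intro d
    have hG := continuous_graphMap d.chart
    have h2 := hC d (Metric.ball x r)
    rw [Measure.restrict_apply Metric.isOpen_ball.measurableSet, Measure.smul_apply,
      Measure.map_apply hG.measurable Metric.isOpen_ball.measurableSet] at h2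
    refine h2.trans ?_
    rw [ENNReal.coe_mul, mul_assoc, smul_eq_mul]
    gcongr
    refine (Measure.restrict_apply_le _ _).trans ?_
    rw [← volume_ball_plane (d.e x).fst r]
    refine measure_mono fun y hy => ?_
    rw [Metric.mem_ball]
    refine lt_of_le_of_lt ?_ (Metric.mem_ball.1 (mem_preimage.1 hy))
    have := dist_fst_le d.e (graphMap d.e d.g y) x
    rwa [fst_graphMap] at this
  calc surfaceMeasure Ω (Metric.ball x r)
      = surfaceMeasure Ω (Metric.ball x r ∩ frontier Ω) := by
        refine (measure_inter_conull' ?_).symm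
        exact measure_mono_null (fun y hy => hy.2) (ae_iff.1 (ae_mem_frontier Ω))
    _ ≤ surfaceMeasure Ω (⋃ d ∈ t, Metric.ball x r ∩ d.U) := by
        refine measure_mono fun y hy => ?_
        have := ht hy.2
        simp only [mem_iUnion] at this ⊢
        obtain ⟨d, hd, h⟩ := this
        exact ⟨d, hd, hy.1, h.1⟩
    _ ≤ ∑ d ∈ t, surfaceMeasure Ω (Metric.ball x r ∩ d.U) := measure_biUnion_finset_le _ _
    _ ≤ ∑ d ∈ t, (C d * NNReal.pi : ℝ≥0) * ENNReal.ofReal r ^ 2 := Finset.sum_le_sum fun d _ => h1 d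
    _ = _ := by rw [← Finset.sum_mul, ENNReal.ofNNReal_finsetSum]

theorem isFiniteMeasure_surfaceMeasure {Ω : Set E3} (hΩ : IsLipschitzExteriorDomain Ω) :
    IsFiniteMeasure (surfaceMeasure Ω) := by
  obtain ⟨A, hA⟩ := exists_measure_ball_le hΩ
  obtain ⟨r, hr⟩ := (isCompact_frontier hΩ).isBounded.subset_ball 0
  refine ⟨?_⟩
  have : surfaceMeasure Ω univ ≤ surfaceMeasure Ω (Metric.ball 0 r) := by
    refine measure_mono_ae ?_
    filter_upwards [ae_mem_frontier Ω] with x hx _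
    exact hr hx
  exact (this.trans (hA 0 r)).trans_lt (by finiteness)

/-- The surface measure is lower two-regular at small scales. -/
theorem exists_le_measure_ball {Ω : Set E3} (hΩ : IsLipschitzExteriorDomain Ω) :
    ∃ a : ℝ≥0, 0 < a ∧ ∃ r₀ > 0, ∀ x ∈ frontier Ω, ∀ r ∈ Ioc 0 r₀,
      a * ENNReal.ofReal r ^ 2 ≤ surfaceMeasure Ω (Metric.ball x r) := by
  obtain ⟨t, ht⟩ := exists_finite_atlas hΩ
  choose L hL using fun d : ChartDisc Ω => exists_lipschitz_graphMap d.chart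
  have key : ∀ d : ChartDisc Ω, ∃ a : ℝ≥0, 0 < a ∧ ∃ r₀ > 0, ∀ x ∈ frontier Ω, x ∈ d.dom →
      ∀ r ∈ Ioc 0 r₀, a * ENNReal.ofReal r ^ 2 ≤ surfaceMeasure Ω (Metric.ball x r) := by
    intro d
    have hG := continuous_graphMap d.chart
    -- The disc of radius qr is mapped into the ball of radius r. The added 1 ensures q ≤ 1 and
    -- strict inequality; for r ≤ R the disc stays within distance 2R of the centre, hence in the
    -- chart.
    set q : ℝ := ((L d : ℝ) + 1)⁻¹ with hq
    have hq0 : 0 < q := by positivity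
    refine ⟨NNReal.pi * q.toNNReal ^ 2, by
      have := Real.toNNReal_pos.2 hq0
      have := NNReal.pi_pos
      positivity, d.R, d.R_pos, fun x hx hd r hr => ?_⟩
    have hxe := graphMap_fst_of_mem_frontier hΩ.isOpen d.chart hx hd.1
    set y := (d.e x).fst with hy
    have hyR : dist y d.c < d.R := Metric.mem_ball.1 hd.2
    have hq1 : q ≤ 1 := inv_le_one_of_one_le₀ (by linarith [(L d).2])
    have h1 := Measure.le_iff.1 (map_graphMap_le d.chart) (Metric.ball x r)
      Metric.isOpen_ball.measurableSet
    refine le_trans ?_ h1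
    rw [Measure.map_apply hG.measurable Metric.isOpen_ball.measurableSet,
      Measure.restrict_apply (hG.measurable Metric.isOpen_ball.measurableSet)]
    have h2 : Metric.ball y (q * r) ⊆
        graphMap d.e d.g ⁻¹' Metric.ball x r ∩ graphMap d.e d.g ⁻¹' d.U := by
      intro z hz
      have hz : dist z y < q * r := Metric.mem_ball.1 hz
      constructor
      · rw [mem_preimage, Metric.mem_ball]
        have h0 := (hL d).dist_le_mul z y
        rw [hxe] at h0
        refine h0.trans_lt ?_
        have h3 : (L d : ℝ) * dist z y ≤ ((L d : ℝ) + 1) * dist z y := by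
          have := dist_nonneg (x := z) (y := y)
          linarith
        refine h3.trans_lt ?_
        rw [hq, inv_mul_eq_div, lt_div_iff₀ (by positivity), mul_comm] at hz
        exact hz
      · refine d.ball_subset ?_
        rw [Metric.mem_ball]
        have h3 : q * r ≤ 1 * r := mul_le_mul_of_nonneg_right hq1 hr.1.le
        have h4 := dist_triangle z y d.c
        linarith [hr.2, d.R_pos]
    refine le_trans (le_of_eq ?_) (measure_mono h2)
    rw [volume_ball_plane, ENNReal.ofReal_mul hq0.le, mul_pow, ENNReal.coe_mul,
      ENNReal.coe_pow, mul_assoc]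
    rfl
  choose a ha r₀ hr₀ h using key
  rcases t.eq_empty_or_nonempty with rfl | hne
  · refine ⟨1, one_pos, 1, one_pos, fun x hx => ?_⟩
    have := ht hx
    simp at this
  obtain ⟨d₁, -, h₁⟩ := Finset.exists_min_image t a hne
  obtain ⟨d₂, -, h₂⟩ := Finset.exists_min_image t r₀ hne
  refine ⟨a d₁, ha d₁, r₀ d₂, hr₀ d₂, fun x hx r hr => ?_⟩
  have := ht hx
  simp only [mem_iUnion] at this
  obtain ⟨d, hd, hxd⟩ := this
  refine le_trans ?_ (h d x hx hxd r ⟨hr.1, hr.2.trans (h₂ d hd)⟩)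
  gcongr
  exact h₁ d hd

/-! ### Singular integrals over two-regular measures -/

section Regular

variable {α : Type*} [PseudoMetricSpace α] [MeasurableSpace α] [OpensMeasurableSpace α]
  {μ : Measure α} {A : ℝ≥0}

theorem tsum_ofReal_geometric {c : ℝ} (hc : 0 ≤ c) (A : ℝ≥0∞) :
    ∑' k : ℕ, A * ENNReal.ofReal (c * (1 / 2) ^ k) = A * ENNReal.ofReal (c * 2) := by
  rw [ENNReal.tsum_mul_left, ← ENNReal.ofReal_tsum_of_nonneg (fun k => by positivity)
    (summable_geometric_two.mul_left c), tsum_mul_left, tsum_geometric_two]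

/-- Dyadic decomposition: f is dominated by the sum of the constants w k on the balls of radius ρ k,
and each summand contributes at most A · w k · (ρ k)², a geometric sequence. Balls replace annuli
since only an upper bound is wanted. -/
theorem lintegral_le_of_forall_exists_ball {x : α} {s : Set α} (hs : MeasurableSet s)
    {f : α → ℝ≥0∞} {w ρ : ℕ → ℝ} {c : ℝ} (hc : 0 ≤ c) (hw : ∀ k, 0 ≤ w k) (hρ : ∀ k, 0 ≤ ρ k)
    (hμ : ∀ x r, μ (Metric.ball x r) ≤ A * ENNReal.ofReal r ^ 2)
    (hf : ∀ y ∈ s, f y = 0 ∨ ∃ k, f y ≤ ENNReal.ofReal (w k) ∧ dist y x < ρ k)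
    (hwρ : ∀ k, w k * ρ k ^ 2 = c * (1 / 2) ^ k) :
    ∫⁻ y in s, f y ∂μ ≤ A * ENNReal.ofReal (c * 2) := by
  calc ∫⁻ y in s, f y ∂μ
      ≤ ∫⁻ y in s, ∑' k, (Metric.ball x (ρ k)).indicator (fun _ => ENNReal.ofReal (w k)) y ∂μ := by
        refine setLIntegral_mono' hs fun y hy => ?_
        rcases hf y hy with h | ⟨k, hk, hd⟩
        · rw [h]
          exact bot_le
        · refine le_trans ?_ (ENNReal.le_tsum k)
          rw [indicator_of_mem (Metric.mem_ball.2 hd)]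
          exact hk
    _ ≤ ∫⁻ y, ∑' k, (Metric.ball x (ρ k)).indicator (fun _ => ENNReal.ofReal (w k)) y ∂μ :=
        setLIntegral_le_lintegral _ _
    _ = ∑' k, ENNReal.ofReal (w k) * μ (Metric.ball x (ρ k)) := by
        rw [lintegral_tsum fun k =>
          (measurable_const.indicator Metric.isOpen_ball.measurableSet).aemeasurable]
        exact tsum_congr fun k => lintegral_indicator_const Metric.isOpen_ball.measurableSet _
    _ ≤ ∑' k, A * ENNReal.ofReal (c * (1 / 2) ^ k) := by
        refine ENNReal.tsum_le_tsum fun k => ?_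
        rw [← hwρ k, ENNReal.ofReal_mul (hw k), ENNReal.ofReal_pow (hρ k), mul_left_comm]
        gcongr
        exact hμ _ _
    _ = _ := tsum_ofReal_geometric hc A

/-- At distances between r/2^(k+1) and r/2^k the integrand is at most 2^(k+1)/r. The radius of the
k-th ball is doubled so that the strict inequality holds. -/
theorem setLIntegral_ball_inv_dist_le (hμ : ∀ x r, μ (Metric.ball x r) ≤ A * ENNReal.ofReal r ^ 2)
    (x : α) {r : ℝ} (hr : 0 < r) :
    ∫⁻ y in Metric.ball x r, ENNReal.ofReal (dist y x)⁻¹ ∂μ ≤ A * ENNReal.ofReal (16 * r) := by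
  have := lintegral_le_of_forall_exists_ball (x := x) (μ := μ) (s := Metric.ball x r)
    (f := fun y => ENNReal.ofReal (dist y x)⁻¹) (w := fun k => 2 * 2 ^ k / r)
    (ρ := fun k => 2 * r / 2 ^ k) (c := 8 * r) Metric.isOpen_ball.measurableSet (by positivity)
    (fun k => by positivity) (fun k => by positivity) hμ ?_ ?_
  · convert this using 3
    ring
  · intro y hy
    have hd : dist y x < r := hy
    -- On the diagonal the integrand is zero, because the inverse of zero is zero.
    rcases (dist_nonneg (x := y) (y := x)).eq_or_lt with h0 | h0
    · left
      simp [← h0]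
    · right
      obtain ⟨k, hk1, hk2⟩ := exists_nat_pow_near (x := r / dist y x) (y := 2)
        (by rw [le_div_iff₀ h0]; linarith) one_lt_two
      refine ⟨k, ENNReal.ofReal_le_ofReal ?_, ?_⟩
      · rw [div_lt_iff₀ h0, pow_succ] at hk2
        rw [inv_le_comm₀ h0 (by positivity), inv_div, div_le_iff₀ (by positivity)]
        linarith
      · rw [le_div_iff₀ h0] at hk1
        rw [lt_div_iff₀ (by positivity)]
        linarith
  · intro k
    have : (2 : ℝ) ^ k ≠ 0 := by positivity
    rw [one_div, inv_pow]
    field_simp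
    ring

/-- The same decomposition outwards: at distances between 2^k r and 2^(k+1) r the integrand is at
most (2^k r)^(-3), which beats the measure of order (2^k r)² by a factor 2^(-k). -/
theorem setLIntegral_compl_ball_inv_dist_le
    (hμ : ∀ x r, μ (Metric.ball x r) ≤ A * ENNReal.ofReal r ^ 2)
    (x : α) {r : ℝ} (hr : 0 < r) :
    ∫⁻ y in (Metric.ball x r)ᶜ, ENNReal.ofReal (dist y x ^ 3)⁻¹ ∂μ ≤ A * ENNReal.ofReal (8 / r) := by
  have := lintegral_le_of_forall_exists_ball (x := x) (μ := μ) (s := (Metric.ball x r)ᶜ)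
    (f := fun y => ENNReal.ofReal (dist y x ^ 3)⁻¹) (w := fun k => ((2 ^ k * r) ^ 3)⁻¹)
    (ρ := fun k => 2 * 2 ^ k * r) (c := 4 / r) Metric.isOpen_ball.measurableSet.compl (by positivity)
    (fun k => by positivity) (fun k => by positivity) hμ ?_ ?_
  · convert this using 3
    ring
  · intro y hy
    have hd : r ≤ dist y x := by simpa using hy
    right
    obtain ⟨k, hk1, hk2⟩ := exists_nat_pow_near (x := dist y x / r) (y := 2)
      (by rw [le_div_iff₀ hr]; linarith) one_lt_two
    rw [le_div_iff₀ hr] at hk1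
    rw [div_lt_iff₀ hr, pow_succ, mul_comm (2 ^ k)] at hk2
    exact ⟨k, ENNReal.ofReal_le_ofReal (by gcongr), hk2⟩
  · intro k
    have : (2 : ℝ) ^ k ≠ 0 := by positivity
    rw [one_div, inv_pow]
    field_simp
    ring

end Regular

/-! ### Difference quotients of functions with weak gradients -/

theorem sq_lintegral_le {α : Type*} [MeasurableSpace α] (μ : Measure α) {f : α → ℝ≥0∞}
    (hf : AEMeasurable f μ) : (∫⁻ x, f x ∂μ) ^ 2 ≤ μ univ * ∫⁻ x, f x ^ 2 ∂μ := by
  have h := ENNReal.lintegral_mul_le_Lp_mul_Lq μ (Real.HolderConjugate.two_two) hf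
    (aemeasurable_const (b := (1 : ℝ≥0∞)))
  simp only [Pi.mul_apply, mul_one, lintegral_const, one_mul,
    ENNReal.rpow_two, one_pow] at h
  calc (∫⁻ x, f x ∂μ) ^ 2
      ≤ ((∫⁻ x, f x ^ 2 ∂μ) ^ (1 / 2 : ℝ) * μ univ ^ (1 / 2 : ℝ)) ^ 2 := by gcongr
    _ = _ := by
      rw [mul_pow, ← ENNReal.rpow_natCast, ← ENNReal.rpow_natCast, ← ENNReal.rpow_mul,
        ← ENNReal.rpow_mul]
      norm_num
      exact mul_comm _ _

theorem sub_eq_integral_fderiv_segment {η : E2 → ℝ} (hη : ContDiff ℝ ∞ η) (y h : E2) :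
    ∫ t in (0 : ℝ)..1, (fderiv ℝ η (y - t • h) h : ℂ) = (η y - η (y - h) : ℂ) := by
  have h1 : ∀ t : ℝ, HasDerivAt (fun t : ℝ => -(η (y - t • h) : ℂ)) (fderiv ℝ η (y - t • h) h : ℂ) t := by
    intro t
    have h2 : HasDerivAt (fun t : ℝ => y - t • h) (-h) t := by
      simpa using ((hasDerivAt_id t).smul_const h).const_sub y
    have h3 : HasFDerivAt η (fderiv ℝ η (y - t • h)) (y - t • h) :=
      (hη.differentiable (by simp)).differentiableAt.hasFDerivAt
    have h4 := ((h3.comp_hasDerivAt t h2).ofReal_comp).neg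
    rw [map_neg, Complex.ofReal_neg, neg_neg] at h4
    exact h4
  rw [intervalIntegral.integral_eq_sub_of_hasDerivAt (fun t _ => h1 t)]
  · simp
    ring
  · refine Continuous.intervalIntegrable ?_ _ _
    have : Continuous (fderiv ℝ η) := hη.continuous_fderiv (by simp)
    fun_prop

/-- A function with a weak derivative in the direction `h` satisfies the fundamental theorem of
calculus on almost every segment parallel to `h`. -/
theorem ae_sub_eq_integral_segment {F P : E2 → ℂ} (hF : Integrable F) (hP : Integrable P)
    (hPm : StronglyMeasurable P) {c h : E2} {R : ℝ} (hh : ‖h‖ < 2 * R)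
    (hweak : ∀ η : E2 → ℝ, ContDiff ℝ ∞ η → HasCompactSupport η →
      tsupport η ⊆ Metric.ball c (3 * R) →
      ∫ y, F y * (fderiv ℝ η y h : ℂ) = -∫ y, P y * (η y : ℂ)) :
    ∀ᵐ y : E2, y ∈ Metric.ball c R →
      F (y + h) - F y = ∫ t in (0 : ℝ)..1, P (y + t • h) := by
  have : IsFiniteMeasure ((volume : Measure ℝ).restrict (uIoc 0 1)) := by
    rw [uIoc_of_le zero_le_one]
    infer_instance
  set Q : E2 → ℂ := fun y => ∫ t in (0 : ℝ)..1, P (y + t • h) with hQ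
  have hPprod : Integrable (fun z : ℝ × E2 => P (z.2 + z.1 • h))
      ((volume.restrict (uIoc 0 1)).prod volume) := by
    have hm : StronglyMeasurable fun z : ℝ × E2 => P (z.2 + z.1 • h) :=
      hPm.comp_measurable (by fun_prop)
    rw [integrable_prod_iff hm.aestronglyMeasurable]
    refine ⟨Eventually.of_forall fun t => hP.comp_add_right (t • h), ?_⟩
    have : ∀ t : ℝ, ∫ y : E2, ‖P (y + t • h)‖ = ∫ y, ‖P y‖ := fun t =>
      integral_add_right_eq_self (fun y => ‖P y‖) (t • h)
    simp_rw [this]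
    exact integrable_const _
  have hQint : Integrable Q := by
    have := hPprod.integral_prod_right
    refine this.congr (Eventually.of_forall fun y => ?_)
    simp only [hQ, intervalIntegral.integral_of_le zero_le_one, uIoc_of_le zero_le_one]
  have hFh : Integrable fun y => F (y + h) := hF.comp_add_right h
  have hD : Integrable fun y => F (y + h) - F y - Q y := (hFh.sub hF).sub hQint
  -- The identity is tested with η supported in the small disc. The weak derivative tested with η(·
  -- − th) is averaged over t in [0, 1]: on one side the fundamental theorem for η gives η − η(· −
  -- h), on the other a translation moves the shift from η to P.
  have := Metric.isOpen_ball.ae_eq_zero_of_integral_contDiff_smul_eq_zero (U := Metric.ball c R)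
    (μ := volume) (hD.locallyIntegrable.locallyIntegrableOn _) ?_
  · filter_upwards [this] with y hy hyR
    exact sub_eq_zero.1 (hy hyR)
  intro η hη hηc hηs
  have hηb : ∃ B, ∀ y, ‖(η y : ℂ)‖ ≤ B := by
    obtain ⟨B, hB⟩ := hη.continuous.bounded_above_of_compact_support hηc
    exact ⟨B, fun y => by simpa using hB y⟩
  obtain ⟨B, hB⟩ := hηb
  have hcd : Continuous fun y => fderiv ℝ η y h :=
    (hη.continuous_fderiv (by simp)).clm_apply continuous_const
  have hdb : ∃ B', ∀ y, ‖(fderiv ℝ η y h : ℂ)‖ ≤ B' := by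
    obtain ⟨B', hB'⟩ := hcd.bounded_above_of_compact_support (hηc.fderiv_apply ℝ h)
    exact ⟨B', fun y => by simpa using hB' y⟩
  obtain ⟨B', hB'⟩ := hdb
  have hηcont := hη.continuous
  have bdd : ∀ {H : E2 → ℂ} {w : E2 → ℝ} {C : ℝ}, Integrable H → Continuous w →
      (∀ y, ‖(w y : ℂ)‖ ≤ C) → Integrable fun y => H y * (w y : ℂ) := by
    intro H w C hH hw hC
    exact hH.mul_bdd (c := C) (Complex.continuous_ofReal.comp hw).aestronglyMeasurable
      (Eventually.of_forall hC)
  -- the weak derivative tested with translates of `η`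
  have hshift : ∀ t ∈ Icc (0 : ℝ) 1, ∫ y, F y * (fderiv ℝ η (y - t • h) h : ℂ) =
      -∫ y, P y * (η (y - t • h) : ℂ) := by
    intro t ht
    have h1 := hweak (fun y => η (y - t • h)) (hη.comp (contDiff_id.sub contDiff_const)) ?_ ?_
    · have h2 : ∀ y, fderiv ℝ (fun y => η (y - t • h)) y = fderiv ℝ η (y - t • h) := fun y =>
        fderiv_comp_sub (f := η) (x := y) (t • h)
      simp_rw [h2] at h1
      exact h1
    · exact hηc.comp_homeomorph (Homeomorph.subRight (t • h))
    · have h3 : tsupport (fun y => η (y - t • h)) ⊆ (fun y => y - t • h) ⁻¹' tsupport η :=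
        tsupport_comp_subset_preimage η (by fun_prop)
      refine h3.trans fun y hy => ?_
      have hy := Metric.mem_ball.1 (hηs hy)
      rw [Metric.mem_ball]
      have h4 : dist y (y - t • h) ≤ ‖h‖ := by
        rw [dist_eq_norm, sub_sub_cancel, norm_smul, Real.norm_of_nonneg ht.1]
        exact mul_le_of_le_one_left (norm_nonneg _) ht.2
      linarith [dist_triangle y (y - t • h) c]
  have hint : ∫ t in (0 : ℝ)..1, ∫ y, F y * (fderiv ℝ η (y - t • h) h : ℂ) =
      -∫ t in (0 : ℝ)..1, ∫ y, P y * (η (y - t • h) : ℂ) := by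
    rw [← intervalIntegral.integral_neg]
    refine intervalIntegral.integral_congr fun t ht => ?_
    rw [uIcc_of_le zero_le_one] at ht
    exact hshift t ht
  have hone : Integrable (fun _ : ℝ => (1 : ℝ)) (volume.restrict (uIoc 0 1)) := integrable_const _
  have hL : ∫ t in (0 : ℝ)..1, ∫ y, F y * (fderiv ℝ η (y - t • h) h : ℂ) =
      ∫ y, F y * (η y - η (y - h) : ℂ) := by
    rw [intervalIntegral_integral_swap]
    · refine integral_congr_ae (Eventually.of_forall fun y => ?_)
      simp only
      rw [intervalIntegral.integral_const_mul, sub_eq_integral_fderiv_segment hη]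
    · refine (hone.mul_prod (hF.norm.mul_const B')).mono' ?_ (Eventually.of_forall ?_)
      · refine AEStronglyMeasurable.mul hF.aestronglyMeasurable.comp_snd ?_
        exact Continuous.aestronglyMeasurable (by fun_prop)
      · rintro ⟨t, y⟩
        simp only [Function.uncurry_apply_pair, norm_mul, one_mul]
        gcongr
        exact hB' _
  have hRr : ∫ t in (0 : ℝ)..1, ∫ y, P y * (η (y - t • h) : ℂ) = ∫ y, Q y * (η y : ℂ) := by
    have h1 : ∀ t : ℝ, ∫ y, P y * (η (y - t • h) : ℂ) = ∫ y, P (y + t • h) * (η y : ℂ) := by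
      intro t
      rw [← integral_add_right_eq_self (fun y => P y * (η (y - t • h) : ℂ)) (t • h)]
      simp
    simp_rw [h1]
    rw [intervalIntegral_integral_swap]
    · refine integral_congr_ae (Eventually.of_forall fun y => ?_)
      simp only [hQ]
      rw [intervalIntegral.integral_mul_const]
    · refine hPprod.mul_bdd (c := B) ?_ (Eventually.of_forall fun z => hB z.2)
      exact Continuous.aestronglyMeasurable (by fun_prop)
  have hFη : ∫ y, F y * (η y - η (y - h) : ℂ) = ∫ y, (F y - F (y + h)) * (η y : ℂ) := by
    have i1 := bdd hF hηcont hB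
    have i2 : Integrable fun y => F y * (η (y - h) : ℂ) :=
      bdd hF (by fun_prop : Continuous fun y => η (y - h)) (fun y => hB _)
    have i3 := bdd hFh hηcont hB
    simp_rw [mul_sub, sub_mul]
    rw [integral_sub i1 i2, integral_sub i1 i3]
    congr 1
    rw [← integral_add_right_eq_self (fun y => F y * (η (y - h) : ℂ)) h]
    simp
  rw [hL, hRr, hFη] at hint
  have i4 := bdd hQint hηcont hB
  have i5 : Integrable fun y => -((F y - F (y + h)) * (η y : ℂ)) :=
    (bdd (hF.sub hFh) hηcont hB).neg
  have h6 : ∀ y, η y • (F (y + h) - F y - Q y) =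
      -((F y - F (y + h)) * (η y : ℂ)) - Q y * (η y : ℂ) := by
    intro y
    rw [Complex.real_smul]
    ring
  simp_rw [h6]
  rw [integral_sub i5 i4, integral_neg, hint]
  ring

/-- Cauchy–Schwarz along the segment, then Tonelli and translation invariance of the area. -/
theorem lintegral_sq_sub_le_of_segment {F P : E2 → ℂ} (hP : Measurable P) {s : Set E2}
    (hs : MeasurableSet s) {h : E2}
    (hseg : ∀ᵐ y : E2, y ∈ s → F (y + h) - F y = ∫ t in (0 : ℝ)..1, P (y + t • h)) :
    ∫⁻ y in s, ‖F (y + h) - F y‖ₑ ^ 2 ≤ ∫⁻ y, ‖P y‖ₑ ^ 2 := by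
  have hm : Measurable fun z : E2 × ℝ => ‖P (z.1 + z.2 • h)‖ₑ ^ 2 :=
    (hP.comp (by fun_prop)).enorm.pow_const 2
  calc ∫⁻ y in s, ‖F (y + h) - F y‖ₑ ^ 2
      ≤ ∫⁻ y in s, ∫⁻ t in Ioc (0 : ℝ) 1, ‖P (y + t • h)‖ₑ ^ 2 := by
        refine lintegral_mono_ae ?_
        filter_upwards [(ae_restrict_iff' hs).2 hseg] with y hy
        rw [hy, intervalIntegral.integral_of_le zero_le_one]
        have h1 := sq_lintegral_le (volume.restrict (Ioc (0 : ℝ) 1))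
          (f := fun t => ‖P (y + t • h)‖ₑ) (hP.comp (by fun_prop)).enorm.aemeasurable
        simp only [MeasurableSet.univ, Measure.restrict_apply, univ_inter, Real.volume_Ioc, sub_zero,
          ENNReal.ofReal_one, one_mul] at h1
        exact le_trans (by gcongr; exact enorm_integral_le_lintegral_enorm _) h1
    _ ≤ ∫⁻ y, ∫⁻ t in Ioc (0 : ℝ) 1, ‖P (y + t • h)‖ₑ ^ 2 := setLIntegral_le_lintegral _ _
    _ = ∫⁻ t in Ioc (0 : ℝ) 1, ∫⁻ y, ‖P (y + t • h)‖ₑ ^ 2 :=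
        lintegral_lintegral_swap hm.aemeasurable
    _ = ∫⁻ t in Ioc (0 : ℝ) 1, ∫⁻ y, ‖P y‖ₑ ^ 2 := by
        refine lintegral_congr fun t => ?_
        exact lintegral_add_right_eq_self (fun y => ‖P y‖ₑ ^ 2) (t • h)
    _ = _ := by simp

/-- A function whose differences satisfy `‖F(· + h) - F‖_{L²} ≤ C |h|` on a disc has a finite
Sobolev-Slobodeckij seminorm of order `1/2` on the disc. -/
theorem lintegral_slobodeckij_ball_lt_top {F : E2 → ℂ} (hF : Measurable F) {c : E2} {R : ℝ}
    (hR : 0 < R) {K : ℝ≥0∞} (hK : K ≠ ⊤)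
    (hdiff : ∀ h : E2, ‖h‖ < 2 * R → ∫⁻ y in Metric.ball c R, ‖F (y + h) - F y‖ₑ ^ 2 ≤
      ENNReal.ofReal ‖h‖ ^ 2 * K) :
    ∫⁻ y in Metric.ball c R, ∫⁻ z in Metric.ball c R,
      ENNReal.ofReal (dist y z ^ 3)⁻¹ * ‖F y - F z‖ₑ ^ 2 < ⊤ := by
  set B := Metric.ball c R
  have hm : Measurable fun z : E2 × E2 =>
      ENNReal.ofReal (‖z.2‖ ^ 3)⁻¹ * ‖F (z.1 + z.2) - F z.1‖ₑ ^ 2 := by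
    refine Measurable.mul (by fun_prop) (Measurable.pow_const (Measurable.enorm ?_) 2)
    exact (hF.comp (by fun_prop)).sub (hF.comp measurable_fst)
  have h1 : ∀ y ∈ B, ∫⁻ z in B, ENNReal.ofReal (dist y z ^ 3)⁻¹ * ‖F y - F z‖ₑ ^ 2 ≤
      ∫⁻ h in Metric.ball 0 (2 * R), ENNReal.ofReal (‖h‖ ^ 3)⁻¹ * ‖F (y + h) - F y‖ₑ ^ 2 := by
    intro y hy
    rw [← lintegral_indicator Metric.isOpen_ball.measurableSet,
      ← lintegral_indicator Metric.isOpen_ball.measurableSet,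
      ← lintegral_add_left_eq_self _ y]
    refine lintegral_mono fun h => ?_
    by_cases hh : y + h ∈ B
    · have : h ∈ Metric.ball (0 : E2) (2 * R) := by
        rw [mem_ball_zero_iff]
        have h2 := dist_triangle_right (y + h) y c
        rw [dist_eq_norm, add_sub_cancel_left] at h2
        linarith [Metric.mem_ball.1 hh, Metric.mem_ball.1 hy]
      rw [indicator_of_mem hh, indicator_of_mem this, dist_self_add_right, ← enorm_neg, neg_sub]
    · rw [indicator_of_notMem hh]
      exact bot_le
  calc _ ≤ ∫⁻ y in B, ∫⁻ h in Metric.ball 0 (2 * R),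
        ENNReal.ofReal (‖h‖ ^ 3)⁻¹ * ‖F (y + h) - F y‖ₑ ^ 2 :=
        setLIntegral_mono' Metric.isOpen_ball.measurableSet h1
    _ = ∫⁻ h in Metric.ball 0 (2 * R), ∫⁻ y in B,
        ENNReal.ofReal (‖h‖ ^ 3)⁻¹ * ‖F (y + h) - F y‖ₑ ^ 2 :=
        lintegral_lintegral_swap hm.aemeasurable
    -- With z = y + h and the order of integration exchanged, the factor |h|² from the hypothesis
    -- reduces |h|⁻³ to |h|⁻¹, which is integrable near the origin of the plane.
    _ ≤ ∫⁻ h in Metric.ball (0 : E2) (2 * R), ENNReal.ofReal (dist h 0)⁻¹ * K := by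
        refine setLIntegral_mono' Metric.isOpen_ball.measurableSet fun h hh => ?_
        rw [lintegral_const_mul' _ _ ENNReal.ofReal_ne_top, dist_zero_right]
        refine (mul_le_mul_right (hdiff h (mem_ball_zero_iff.1 hh)) _).trans ?_
        rw [← mul_assoc, ← ENNReal.ofReal_pow (norm_nonneg _), ← ENNReal.ofReal_mul (by positivity)]
        gcongr
        rcases eq_or_ne ‖h‖ 0 with h0 | h0
        · simp [h0]
        · apply le_of_eq
          field_simp
    _ = (∫⁻ h in Metric.ball (0 : E2) (2 * R), ENNReal.ofReal (dist h 0)⁻¹) * K :=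
        lintegral_mul_const' _ _ hK
    _ ≤ NNReal.pi * ENNReal.ofReal (16 * (2 * R)) * K := by
        gcongr
        exact setLIntegral_ball_inv_dist_le (fun x r => (volume_ball_plane x r).le) 0 (by positivity)
    _ < ⊤ := by
        refine ENNReal.mul_lt_top (ENNReal.mul_lt_top ENNReal.coe_lt_top ENNReal.ofReal_lt_top) hK.lt_top

/-! ### The Sobolev-Slobodeckij seminorm -/

/-- The square of the Sobolev-Slobodeckij seminorm. -/
noncomputable def slobodeckij (Ω : Set E3) (f : E3 → ℂ) : ℝ≥0∞ :=
  ∫⁻ z, ENNReal.ofReal (dist z.1 z.2 ^ 3)⁻¹ * ‖f z.1 - f z.2‖ₑ ^ 2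
    ∂(surfaceMeasure Ω).prod (surfaceMeasure Ω)

theorem enorm_sq_differenceQuotient (f : E3 → ℂ) (z : E3 × E3) :
    ‖((‖z.1 - z.2‖ ^ (-(3 / 2) : ℝ) : ℝ) : ℂ) * (f z.1 - f z.2)‖ₑ ^ 2 =
      ENNReal.ofReal (dist z.1 z.2 ^ 3)⁻¹ * ‖f z.1 - f z.2‖ₑ ^ 2 := by
  rw [enorm_mul, mul_pow, dist_eq_norm]
  congr 1
  rw [← ofReal_norm, Complex.norm_real, Real.norm_of_nonneg (by positivity),
    ← ENNReal.ofReal_pow (by positivity), ← Real.rpow_natCast, ← Real.rpow_mul (norm_nonneg _)]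
  congr 1
  rw [← Real.rpow_natCast ‖z.1 - z.2‖ 3, ← Real.rpow_neg (norm_nonneg _)]
  norm_num

theorem enorm_sq_Lp_two {α E : Type*} [MeasurableSpace α] {μ : Measure α} [NormedAddCommGroup E]
    (f : Lp E 2 μ) : ‖f‖ₑ ^ 2 = ∫⁻ x, ‖f x‖ₑ ^ 2 ∂μ := by
  rw [Lp.enorm_def, eLpNorm_eq_lintegral_rpow_enorm_toReal (by simp) (by simp),
    ← ENNReal.rpow_natCast, ← ENNReal.rpow_mul]
  simp

theorem lintegral_enorm_sq_lt_top {α E : Type*} [MeasurableSpace α] {μ : Measure α}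
    [NormedAddCommGroup E] {f : α → E} (hf : MemLp f 2 μ) : ∫⁻ x, ‖f x‖ₑ ^ 2 ∂μ < ⊤ := by
  simpa using (eLpNorm_lt_top_iff_lintegral_rpow_enorm_lt_top (by simp) (by simp)).1 hf.2

theorem memLp_two_of_lintegral {α E : Type*} [MeasurableSpace α] {μ : Measure α}
    [NormedAddCommGroup E] {f : α → E} (hf : AEStronglyMeasurable f μ)
    (h : ∫⁻ x, ‖f x‖ₑ ^ 2 ∂μ < ⊤) : MemLp f 2 μ :=
  ⟨hf, (eLpNorm_lt_top_iff_lintegral_rpow_enorm_lt_top (by simp) (by simp)).2 (by simpa using h)⟩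

theorem HHalf.exists_toL2_eq {Ω : Set E3} {f : L2 Ω} (hf : slobodeckij Ω f < ⊤) :
    ∃ p : HHalf Ω, HHalf.toL2 Ω p = f := by
  have hm : AEStronglyMeasurable (fun z : E3 × E3 =>
      ((‖z.1 - z.2‖ ^ (-(3 / 2) : ℝ) : ℝ) : ℂ) * (f z.1 - f z.2))
      ((surfaceMeasure Ω).prod (surfaceMeasure Ω)) := by
    refine (Measurable.aestronglyMeasurable (by fun_prop)).mul ?_
    exact ((Lp.stronglyMeasurable f).comp_measurable measurable_fst).aestronglyMeasurable.sub
      ((Lp.stronglyMeasurable f).comp_measurable measurable_snd).aestronglyMeasurable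
  have hL := memLp_two_of_lintegral hm (by simpa only [enorm_sq_differenceQuotient, slobodeckij] using hf)
  exact ⟨(⟨WithLp.toLp 2 (f, hL.toLp), hL.coeFn_toLp⟩ : halfSubmodule Ω), rfl⟩

theorem HHalf.enorm_sq {Ω : Set E3} (p : HHalf Ω) :
    ‖p‖ₑ ^ 2 = ∫⁻ x, ‖HHalf.toL2 Ω p x‖ₑ ^ 2 ∂surfaceMeasure Ω + slobodeckij Ω (HHalf.toL2 Ω p) := by
  obtain ⟨p, hp⟩ := p
  have h1 : ‖p‖ₑ ^ 2 = ‖p.fst‖ₑ ^ 2 + ‖p.snd‖ₑ ^ 2 := by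
    simp only [← ofReal_norm, ← ENNReal.ofReal_pow (norm_nonneg _)]
    rw [← ENNReal.ofReal_add (by positivity) (by positivity), WithLp.prod_norm_sq_eq_of_L2]
  have h2 : ‖p.snd‖ₑ ^ 2 = slobodeckij Ω p.fst := by
    rw [enorm_sq_Lp_two]
    refine lintegral_congr_ae ?_
    filter_upwards [hp] with z hz
    rw [hz, enorm_sq_differenceQuotient]
  change ‖p‖ₑ ^ 2 = _
  rw [h1, h2, enorm_sq_Lp_two]
  rfl

/-! ### The embedding of `H¹(Γ)` in `H^{1/2}(Γ)` -/

theorem norm_sum_mul_ofReal_le (a : EuclideanSpace ℂ (Fin 3)) (b : E3) :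
    ‖∑ i, a i * (b i : ℂ)‖ ≤ 3 * (‖a‖ * ‖b‖) := by
  refine (norm_sum_le _ _).trans ?_
  have : ∀ i ∈ (Finset.univ : Finset (Fin 3)), ‖a i * (b i : ℂ)‖ ≤ ‖a‖ * ‖b‖ := by
    intro i _
    rw [norm_mul, Complex.norm_real]
    exact mul_le_mul (PiLp.norm_apply_le _ i) (PiLp.norm_apply_le _ i) (norm_nonneg _)
      (norm_nonneg _)
  refine (Finset.sum_le_card_nsmul _ _ _ this).trans ?_
  simp

theorem measurable_gradient_graphMap {q : E3 → EuclideanSpace ℂ (Fin 3)} (hq : Measurable q)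
    {e : E3 ≃ₗᵢ[ℝ] WithLp 2 (E2 × ℝ)} {g : E2 → ℝ} (hG : Measurable (graphMap e g)) (h : E2) :
    Measurable fun y => ∑ i, q (graphMap e g y) i * (fderiv ℝ (graphMap e g) y h i : ℂ) := by
  refine Finset.measurable_sum _ fun i _ => Measurable.mul ?_ ?_
  · exact (EuclideanSpace.proj (𝕜 := ℂ) i).continuous.measurable.comp (hq.comp hG)
  · exact Complex.measurable_ofReal.comp ((EuclideanSpace.proj (𝕜 := ℝ) i).continuous.measurable.comp
      (measurable_fderiv_apply_const ℝ (graphMap e g) h))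

namespace ChartDisc

variable {Ω : Set E3} (d : ChartDisc Ω)

/-- The local parametrization of the boundary. -/
noncomputable abbrev param : E2 → E3 := graphMap d.e d.g

theorem continuous_param : Continuous d.param := continuous_graphMap d.chart

theorem memLp_comp_param {E : Type*} [NormedAddCommGroup E] {f : E3 → E}
    (hf : MemLp f 2 (surfaceMeasure Ω)) :
    MemLp (fun y => f (d.param y)) 2 (volume.restrict (Metric.ball d.c (3 * d.R))) := by
  have h1 : MemLp (f ∘ d.param) 2 (volume.restrict (d.param ⁻¹' d.U)) :=
    (hf.mono_measure (map_graphMap_le d.chart)).comp_of_map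
      d.continuous_param.measurable.aemeasurable
  exact h1.mono_measure (Measure.restrict_mono d.ball_subset le_rfl)

theorem exists_restrict_dom_le_map (hΩ : IsOpen Ω) :
    ∃ C : ℝ≥0, (surfaceMeasure Ω).restrict d.dom ≤
      (C : ℝ≥0∞) • (volume.restrict (Metric.ball d.c d.R)).map d.param := by
  obtain ⟨C, hC⟩ := exists_restrict_le_map hΩ d.chart
  refine ⟨C, ?_⟩
  have hm : MeasurableSet {x | (d.e x).fst ∈ Metric.ball d.c d.R} :=
    (Metric.isOpen_ball.preimage (continuous_fst_apply d.e)).measurableSet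
  have h1 : d.param ⁻¹' {x | (d.e x).fst ∈ Metric.ball d.c d.R} = Metric.ball d.c d.R := by
    ext y
    rw [mem_preimage, mem_ofPred_eq, fst_graphMap]
  have h2 := Measure.restrict_mono_measure hC {x | (d.e x).fst ∈ Metric.ball d.c d.R}
  rw [Measure.restrict_restrict hm, inter_comm, Measure.restrict_smul,
    Measure.restrict_map d.continuous_param.measurable hm, h1,
    Measure.restrict_restrict Metric.isOpen_ball.measurableSet] at h2
  rwa [inter_eq_left.2 ((Metric.ball_subset_ball (by linarith [d.R_pos])).trans d.ball_subset)] at h2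

/-- The directional derivative in the chart is bounded pointwise by 3C|h||q|, with C the Lipschitz
constant of the parametrization. Its squared L² norm supplies the factor |h|². Truncation to the
disc of radius 3R makes all functions integrable on the plane without affecting the weak identity
for tests supported there. -/
theorem lintegral_diff_le {f : L2 Ω} {q : L2Vec Ω} (hq : IsWeakTangentialGradient Ω f q) :
    ∃ K : ℝ≥0∞, K ≠ ⊤ ∧ ∀ h : E2, ‖h‖ < 2 * d.R →
      ∫⁻ y in Metric.ball d.c d.R, ‖(Metric.ball d.c (3 * d.R)).indicator (fun y => f (d.param y)) (y + h) -
        (Metric.ball d.c (3 * d.R)).indicator (fun y => f (d.param y)) y‖ₑ ^ 2 ≤ ENNReal.ofReal ‖h‖ ^ 2 * K := by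
  obtain ⟨C, hC⟩ := exists_lipschitz_graphMap d.chart
  set B := Metric.ball d.c (3 * d.R)
  have hB : MeasurableSet B := Metric.isOpen_ball.measurableSet
  have : IsFiniteMeasure (volume.restrict B) := ⟨by simpa using measure_ball_lt_top⟩
  have hfL := d.memLp_comp_param (Lp.memLp f)
  have hqL := d.memLp_comp_param (Lp.memLp q)
  have hqm : Measurable q := (Lp.stronglyMeasurable q).measurable
  have hGm := d.continuous_param.measurable
  set p : E2 → E2 → ℂ := fun h y => ∑ i, q (d.param y) i * (fderiv ℝ d.param y h i : ℂ) with hp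
  have hpm : ∀ h, Measurable (p h) := fun h => measurable_gradient_graphMap hqm hGm h
  have hpb : ∀ h y, ‖p h y‖ ≤ 3 * C * ‖h‖ * ‖q (d.param y)‖ := by
    intro h y
    refine (norm_sum_mul_ofReal_le _ _).trans ?_
    have : ‖fderiv ℝ d.param y h‖ ≤ C * ‖h‖ := by
      refine (ContinuousLinearMap.le_opNorm _ _).trans ?_
      gcongr
      exact norm_fderiv_le_of_lipschitz ℝ hC
    calc 3 * (‖q (d.param y)‖ * ‖fderiv ℝ d.param y h‖)
        ≤ 3 * (‖q (d.param y)‖ * (C * ‖h‖)) := by gcongr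
      _ = _ := by ring
  refine ⟨ENNReal.ofReal (3 * C) ^ 2 * ∫⁻ y in B, ‖q (d.param y)‖ₑ ^ 2,
    ENNReal.mul_ne_top (ENNReal.pow_ne_top ENNReal.ofReal_ne_top) (lintegral_enorm_sq_lt_top hqL).ne, fun h hh => ?_⟩
  have hPint : Integrable (B.indicator (p h)) := by
    rw [integrable_indicator_iff hB]
    exact ((hqL.integrable one_le_two).norm.const_mul (3 * C * ‖h‖)).mono'
      (hpm h).aestronglyMeasurable (Eventually.of_forall (hpb h))
  have hFint : Integrable (B.indicator fun y => f (d.param y)) := by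
    rw [integrable_indicator_iff hB]
    exact hfL.integrable one_le_two
  have hPm : Measurable (B.indicator (p h)) := (hpm h).indicator hB
  have hweak : ∀ η : E2 → ℝ, ContDiff ℝ ∞ η → HasCompactSupport η → tsupport η ⊆ B →
      ∫ y, B.indicator (fun y => f (d.param y)) y * (fderiv ℝ η y h : ℂ) =
        -∫ y, B.indicator (p h) y * (η y : ℂ) := by
    intro η hη hc hs
    have h1 := hq.weak d.e d.g d.U d.chart η hη hc (hs.trans d.ball_subset) h
    have h2 : ∀ y, B.indicator (fun y => f (d.param y)) y * (fderiv ℝ η y h : ℂ) =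
        f (graphMap d.e d.g y) * (fderiv ℝ η y h : ℂ) := by
      intro y
      by_cases hy : y ∈ B
      · simp [hy, param]
      · have : y ∉ tsupport (fderiv ℝ η) := fun hy' => hy (hs (tsupport_fderiv_subset ℝ hy'))
        simp [image_eq_zero_of_notMem_tsupport this]
    have h3 : ∀ y, B.indicator (p h) y * (η y : ℂ) =
        (∑ i, q (graphMap d.e d.g y) i * (fderiv ℝ (graphMap d.e d.g) y h i : ℂ)) * (η y : ℂ) := by
      intro y
      by_cases hy : y ∈ B
      · simp [hy, p, param]
      · have : y ∉ tsupport η := fun hy' => hy (hs hy')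
        simp [image_eq_zero_of_notMem_tsupport this]
    simp_rw [h2, h3]
    exact h1
  have hseg := ae_sub_eq_integral_segment hFint hPint hPm.stronglyMeasurable hh hweak
  refine (lintegral_sq_sub_le_of_segment hPm Metric.isOpen_ball.measurableSet hseg).trans ?_
  have h1 : ∀ y, ‖B.indicator (p h) y‖ₑ ^ 2 = B.indicator (fun y => ‖p h y‖ₑ ^ 2) y := by
    intro y
    by_cases hy : y ∈ B <;> simp [hy]
  simp_rw [h1]
  rw [lintegral_indicator hB, ← mul_assoc, ← mul_pow, ← ENNReal.ofReal_mul (norm_nonneg _),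
    ← lintegral_const_mul' _ _ (ENNReal.pow_ne_top ENNReal.ofReal_ne_top)]
  refine lintegral_mono fun y => ?_
  rw [← mul_pow]
  gcongr
  rw [← ofReal_norm, ← ofReal_norm, ← ENNReal.ofReal_mul (by positivity)]
  exact ENNReal.ofReal_le_ofReal ((hpb h y).trans_eq (by ring))

theorem exists_lintegral_dom_le (hΩ : IsOpen Ω) :
    ∃ C : ℝ≥0, ∀ k : E3 × E3 → ℝ≥0∞, Measurable k →
      ∫⁻ x in d.dom, ∫⁻ z in d.dom, k (x, z) ∂surfaceMeasure Ω ∂surfaceMeasure Ω ≤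
        C * ∫⁻ y in Metric.ball d.c d.R, C * ∫⁻ z in Metric.ball d.c d.R,
          k (d.param y, d.param z) := by
  obtain ⟨C, hC⟩ := d.exists_restrict_dom_le_map hΩ
  have hGm := d.continuous_param.measurable
  have hsub : ∀ w : E3 → ℝ≥0∞, Measurable w →
      ∫⁻ x in d.dom, w x ∂surfaceMeasure Ω ≤ C * ∫⁻ y in Metric.ball d.c d.R, w (d.param y) := by
    intro w hw
    refine (lintegral_mono' hC le_rfl).trans_eq ?_
    rw [lintegral_smul_measure, lintegral_map hw hGm, smul_eq_mul]
  refine ⟨C, fun k hk => ?_⟩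
  have hk' : Measurable fun z : E3 × E2 => k (z.1, d.param z.2) :=
    hk.comp (measurable_fst.prodMk (hGm.comp measurable_snd))
  refine (lintegral_mono fun x => hsub (fun z => k (x, z)) (hk.comp measurable_prodMk_left)).trans ?_
  exact hsub (fun x => C * ∫⁻ z in Metric.ball d.c d.R, k (x, d.param z))
    ((Measurable.lintegral_prod_right' hk').const_mul _)

/-- The parametrization does not decrease distances, so the planar kernel is the larger one. For y =
z both sides vanish. -/
theorem enorm_kernel_param_le (F : E2 → ℂ) (y z : E2) :
    ENNReal.ofReal (dist (d.param y) (d.param z) ^ 3)⁻¹ * ‖F y - F z‖ₑ ^ 2 ≤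
      ENNReal.ofReal (dist y z ^ 3)⁻¹ * ‖F y - F z‖ₑ ^ 2 := by
  rcases eq_or_ne y z with rfl | hyz
  · simp
  have := dist_pos.2 hyz
  gcongr
  exact dist_le_dist_graphMap d.e d.g y z

/-- The integrand of the Sobolev-Slobodeckij seminorm is integrable on a coordinate patch. -/
theorem lintegral_dom_lt_top (hΩ : IsOpen Ω) {f : L2 Ω} {q : L2Vec Ω}
    (hq : IsWeakTangentialGradient Ω f q) :
    ∫⁻ x in d.dom, ∫⁻ z in d.dom, ENNReal.ofReal (dist x z ^ 3)⁻¹ * ‖f x - f z‖ₑ ^ 2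
      ∂surfaceMeasure Ω ∂surfaceMeasure Ω < ⊤ := by
  obtain ⟨K, hK, hdiff⟩ := d.lintegral_diff_le hq
  obtain ⟨C, hC⟩ := d.exists_lintegral_dom_le hΩ
  have hfm : Measurable f := (Lp.stronglyMeasurable f).measurable
  have hGm := d.continuous_param.measurable
  have hFm : Measurable ((Metric.ball d.c (3 * d.R)).indicator (fun y => f (d.param y))) :=
    (hfm.comp hGm).indicator Metric.isOpen_ball.measurableSet
  have hball := lintegral_slobodeckij_ball_lt_top hFm d.R_pos hK hdiff
  have hk : Measurable fun z : E3 × E3 =>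
      ENNReal.ofReal (dist z.1 z.2 ^ 3)⁻¹ * ‖f z.1 - f z.2‖ₑ ^ 2 := by
    refine Measurable.mul (by fun_prop) (Measurable.pow_const (Measurable.enorm ?_) 2)
    exact (hfm.comp measurable_fst).sub (hfm.comp measurable_snd)
  refine (hC _ hk).trans_lt (ENNReal.mul_lt_top ENNReal.coe_lt_top ?_)
  rw [lintegral_const_mul' _ _ ENNReal.coe_ne_top]
  refine ENNReal.mul_lt_top ENNReal.coe_lt_top (lt_of_le_of_lt ?_ hball)
  refine setLIntegral_mono' Metric.isOpen_ball.measurableSet fun y hy => ?_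
  refine setLIntegral_mono' Metric.isOpen_ball.measurableSet fun z hz => ?_
  have hsub : Metric.ball d.c d.R ⊆ Metric.ball d.c (3 * d.R) :=
    Metric.ball_subset_ball (by linarith [d.R_pos])
  rw [indicator_of_mem (hsub hy), indicator_of_mem (hsub hz)]
  exact d.enorm_kernel_param_le (fun y => f (d.param y)) y z

end ChartDisc

theorem enorm_sub_sq_le {E : Type*} [NormedAddCommGroup E] (a b : E) :
    ‖a - b‖ₑ ^ 2 ≤ 2 * ‖a‖ₑ ^ 2 + 2 * ‖b‖ₑ ^ 2 := by
  have h : ‖a - b‖ ^ 2 ≤ 2 * ‖a‖ ^ 2 + 2 * ‖b‖ ^ 2 := by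
    have := norm_sub_le a b
    have h2 : ‖a - b‖ ^ 2 ≤ (‖a‖ + ‖b‖) ^ 2 := by gcongr
    nlinarith [sq_nonneg (‖a‖ - ‖b‖)]
  have h' := ENNReal.ofReal_le_ofReal h
  rw [ENNReal.ofReal_add (by positivity) (by positivity), ENNReal.ofReal_mul (by positivity),
    ENNReal.ofReal_mul (by positivity)] at h'
  simpa [ENNReal.ofReal_pow] using h'

/-- Two points closer than the Lebesgue number δ of the atlas lie in a common patch, where
`ChartDisc.lintegral_dom_lt_top` applies. For other pairs the kernel is at most δ⁻³, and Γ has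
finite measure. -/
theorem slobodeckij_lt_top {Ω : Set E3} (hΩ : IsLipschitzExteriorDomain Ω) {f : L2 Ω}
    {q : L2Vec Ω} (hq : IsWeakTangentialGradient Ω f q) : slobodeckij Ω f < ⊤ := by
  have := isFiniteMeasure_surfaceMeasure hΩ
  obtain ⟨t, ht⟩ := exists_finite_atlas hΩ
  obtain ⟨δ, hδ, hleb⟩ := exists_lebesgue_number hΩ ht
  set μ := surfaceMeasure Ω
  set k : E3 × E3 → ℝ≥0∞ := fun z => ENNReal.ofReal (dist z.1 z.2 ^ 3)⁻¹ * ‖f z.1 - f z.2‖ₑ ^ 2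
  have hfm : Measurable f := (Lp.stronglyMeasurable f).measurable
  have hk : Measurable k := by
    refine Measurable.mul (by fun_prop) (Measurable.pow_const (Measurable.enorm ?_) 2)
    exact (hfm.comp measurable_fst).sub (hfm.comp measurable_snd)
  have hdm : ∀ d : ChartDisc Ω, MeasurableSet (d.dom ×ˢ d.dom) := fun d =>
    d.isOpen_dom.measurableSet.prod d.isOpen_dom.measurableSet
  have hfin : ∫⁻ x, ‖f x‖ₑ ^ 2 ∂μ < ⊤ := lintegral_enorm_sq_lt_top (Lp.memLp f)
  set D : ℝ≥0∞ := ENNReal.ofReal (δ ^ 3)⁻¹ * 2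
  have hm1 : Measurable fun z : E3 × E3 => ‖f z.1‖ₑ ^ 2 := (hfm.comp measurable_fst).enorm.pow_const 2
  have hm2 : Measurable fun z : E3 × E3 => ‖f z.2‖ₑ ^ 2 := (hfm.comp measurable_snd).enorm.pow_const 2
  have hle : ∀ᵐ z ∂μ.prod μ, k z ≤ ∑ d ∈ t, (d.dom ×ˢ d.dom).indicator k z +
      D * (‖f z.1‖ₑ ^ 2 + ‖f z.2‖ₑ ^ 2) := by
    filter_upwards [Measure.quasiMeasurePreserving_fst (μ := μ) (ν := μ)
      |>.ae (ae_mem_frontier Ω)] with z hz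
    by_cases hzδ : dist z.2 z.1 < δ
    · obtain ⟨d, hd, hball⟩ := hleb z.1 hz
      have hmem : z ∈ d.dom ×ˢ d.dom := ⟨hball (Metric.mem_ball_self hδ), hball hzδ⟩
      refine le_add_right ?_
      rw [← indicator_of_mem hmem k]
      exact Finset.single_le_sum (f := fun d : ChartDisc Ω => (d.dom ×ˢ d.dom).indicator k z)
        (fun _ _ => bot_le) hd
    · refine le_add_left ?_
      rw [not_lt, dist_comm] at hzδ
      simp only [k, D, mul_assoc, mul_add]
      rw [← mul_add]
      gcongr
      exact enorm_sub_sq_le _ _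
  refine (lintegral_mono_ae hle).trans_lt ?_
  rw [lintegral_add_right _ (by fun_prop), lintegral_finsetSum _ fun d _ => hk.indicator (hdm d)]
  refine ENNReal.add_lt_top.2 ⟨ENNReal.sum_lt_top.2 fun d _ => ?_, ?_⟩
  · rw [lintegral_indicator (hdm d), ← Measure.prod_restrict, lintegral_prod _ hk.aemeasurable]
    exact d.lintegral_dom_lt_top hΩ.isOpen hq
  · rw [lintegral_const_mul _ (show Measurable fun z : E3 × E3 => ‖f z.1‖ₑ ^ 2 + ‖f z.2‖ₑ ^ 2
        from hm1.add hm2), lintegral_add_left hm1,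
      lintegral_prod _ hm1.aemeasurable, lintegral_prod _ hm2.aemeasurable]
    simp only [lintegral_const]
    refine ENNReal.mul_lt_top (ENNReal.mul_lt_top ENNReal.ofReal_lt_top (by simp)) ?_
    refine ENNReal.add_lt_top.2 ⟨?_, ENNReal.mul_lt_top hfin (measure_lt_top _ _)⟩
    rw [lintegral_mul_const' _ _ (measure_ne_top _ _)]
    exact ENNReal.mul_lt_top hfin (measure_lt_top _ _)

/-- Every function in `L²(Γ)` with a weak tangential gradient in `L²(Γ)³` belongs to `X = H¹(Γ)`. -/
theorem H1.mem_range_toL2 {Ω : Set E3} (hΩ : IsLipschitzExteriorDomain Ω) {ε : ℝ} (hε : 0 < ε)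
    {f : L2 Ω} {q : L2Vec Ω} (hq : IsWeakTangentialGradient Ω f q) :
    f ∈ range (H1.toL2 Ω ε) := by
  obtain ⟨p, rfl⟩ := HHalf.exists_toL2_eq (slobodeckij_lt_top hΩ hq)
  refine ⟨(⟨WithLp.toLp 2 (p, (√ε : ℂ) • q), ?_⟩ : h1Submodule Ω ε), rfl⟩
  have h0 : (√ε : ℂ) ≠ 0 := by
    rw [Complex.ofReal_ne_zero]
    positivity
  change IsWeakTangentialGradient Ω (HHalf.toL2 Ω p) (((√ε)⁻¹ : ℂ) • ((√ε : ℂ) • q) : L2Vec Ω)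
  rwa [smul_smul, inv_mul_cancel₀ h0, one_smul]

/-! ### Tangent vectors of a graph -/

section GraphTangent

variable {e : E3 ≃ₗᵢ[ℝ] WithLp 2 (E2 × ℝ)} {g : E2 → ℝ} {y : E2}

theorem hasFDerivAt_graphMap (hd : DifferentiableAt ℝ g y) :
    HasFDerivAt (graphMap e g) ((e.symm.toContinuousLinearEquiv.toContinuousLinearMap.comp
      (WithLp.prodContinuousLinearEquiv 2 ℝ E2 ℝ).symm.toContinuousLinearMap).comp
      ((ContinuousLinearMap.id ℝ E2).prod (fderiv ℝ g y))) y :=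
  (ContinuousLinearMap.hasFDerivAt (e.symm.toContinuousLinearEquiv.toContinuousLinearMap.comp
      (WithLp.prodContinuousLinearEquiv 2 ℝ E2 ℝ).symm.toContinuousLinearMap)).comp y
    ((hasFDerivAt_id y).prodMk hd.hasFDerivAt)

theorem fderiv_graphMap (hd : DifferentiableAt ℝ g y) (v : E2) :
    fderiv ℝ (graphMap e g) y v = e.symm (WithLp.toLp 2 (v, fderiv ℝ g y v)) := by
  rw [(hasFDerivAt_graphMap hd).fderiv]
  rfl

theorem inner_graphNormal (a : E3) :
    inner ℝ (graphNormal e g y) a = (e a).snd - fderiv ℝ g y (e a).fst := by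
  have h : graphNormal e g y = e.symm (WithLp.toLp 2 (-gradient g y, 1)) := rfl
  rw [h, ← e.inner_map_map, e.apply_symm_apply, WithLp.prod_inner_apply]
  simp only [inner_neg_left, inner_gradient_left]
  simp
  ring

theorem graphNormal_ne_zero : graphNormal e g y ≠ 0 := by
  intro h
  have h1 := inner_graphNormal (e := e) (g := g) (y := y) (e.symm (WithLp.toLp 2 (0, 1)))
  simp [h] at h1

/-- Normal and tangent vectors of the graph span the space. In coordinates e a = (p, t),
orthogonality to the normal gives t = ∂g(p), and the tangent vector in the direction p then gives
|p|² + t² = 0. -/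
theorem eq_zero_of_inner_eq_zero (hd : DifferentiableAt ℝ g y) {a : E3}
    (hn : inner ℝ (graphNormal e g y) a = 0)
    (ht : ∀ v, inner ℝ (fderiv ℝ (graphMap e g) y v) a = 0) : a = 0 := by
  rw [inner_graphNormal] at hn
  have h1 : ∀ v, inner ℝ v (e a).fst + (e a).snd * fderiv ℝ g y v = 0 := by
    intro v
    have := ht v
    rw [fderiv_graphMap hd, ← e.inner_map_map, e.apply_symm_apply, WithLp.prod_inner_apply] at this
    simpa using this
  have h2 := h1 (e a).fst
  have h3 : fderiv ℝ g y (e a).fst = (e a).snd := by linarith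
  rw [h3, real_inner_self_eq_norm_sq] at h2
  have h4 : (e a).fst = 0 := by
    rw [← norm_eq_zero]
    nlinarith [sq_nonneg (e a).snd, norm_nonneg (e a).fst]
  have h5 : (e a).snd = 0 := by rw [← h3, h4, map_zero]
  have h6 : e a = 0 := by
    rw [WithLp.ext_iff]
    exact Prod.ext h4 h5
  exact (map_eq_zero_iff e e.injective).1 h6

end GraphTangent

theorem sum_mul_ofReal_eq (q : EuclideanSpace ℂ (Fin 3)) (b : E3) :
    ∑ i, q i * (b i : ℂ) = ⟨inner ℝ b (WithLp.toLp 2 fun i => (q i).re : E3),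
      inner ℝ b (WithLp.toLp 2 fun i => (q i).im : E3)⟩ := by
  apply Complex.ext <;> simp [PiLp.inner_apply]

/-! ### Closedness of the weak tangential gradient -/

theorem tendsto_integral_graphMap {Ω : Set E3} {e g U} (h : IsGraphChart Ω e g U)
    {f : ℕ → E3 → ℂ} {f' : E3 → ℂ} (hf : ∀ n, MemLp (f n) 2 (surfaceMeasure Ω))
    (hf' : MemLp f' 2 (surfaceMeasure Ω))
    (hlim : Tendsto (fun n => eLpNorm (f n - f') 2 (surfaceMeasure Ω)) atTop (𝓝 0))
    {w : E2 → ℂ} (hw : MemLp w 2) (hsupp : ∀ y, graphMap e g y ∉ U → w y = 0) :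
    Tendsto (fun n => ∫ y, f n (graphMap e g y) * w y) atTop
      (𝓝 (∫ y, f' (graphMap e g y) * w y)) := by
  have hG := continuous_graphMap h
  refine tendsto_integral_of_L1' _ (integrable_graphMap h hf' hw hsupp).aestronglyMeasurable
    (Eventually.of_forall fun n => integrable_graphMap h (hf n) hw hsupp) ?_
  have hle : ∀ n, eLpNorm ((fun y => f n (graphMap e g y) * w y) -
      fun y => f' (graphMap e g y) * w y) 1 volume ≤
      eLpNorm (f n - f') 2 (surfaceMeasure Ω) * eLpNorm w 2 := by
    intro n
    have e1 : ((fun y => f n (graphMap e g y) * w y) - fun y => f' (graphMap e g y) * w y) =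
        ((f n - f') ∘ graphMap e g) • w := by
      ext y
      simp [sub_mul]
    have hs : Function.support (((f n - f') ∘ graphMap e g) • w) ⊆ graphMap e g ⁻¹' U := by
      intro y hy
      by_contra hn
      exact hy (by simp [hsupp y hn])
    have hm : MemLp (f n - f') 2 ((volume.restrict (graphMap e g ⁻¹' U)).map (graphMap e g)) :=
      ((hf n).sub hf').mono_measure (map_graphMap_le h)
    have hm' := hm.comp_of_map hG.measurable.aemeasurable
    rw [e1, ← eLpNorm_restrict_eq_of_support_subset hs]
    refine (eLpNorm_smul_le_mul_eLpNorm (p := 2) (q := 2) (r := 1) (hw.restrict _).1 hm'.1).trans ?_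
    gcongr
    · rw [← eLpNorm_map_measure hm.1 hG.measurable.aemeasurable]
      exact eLpNorm_mono_measure _ (map_graphMap_le h)
    · exact Measure.restrict_le_self
  refine tendsto_of_tendsto_of_tendsto_of_le_of_le tendsto_const_nhds ?_ (fun _ => bot_le) hle
  have := ENNReal.Tendsto.mul_const hlim (Or.inr hw.2.ne)
  rwa [zero_mul] at this

/-- The pointwise condition of tangency passes to the limit along a subsequence converging almost
everywhere, the weak identity by L² convergence against a fixed square-integrable weight. -/
theorem IsWeakTangentialGradient.of_tendsto {Ω : Set E3} {f : ℕ → L2 Ω} {f' : L2 Ω}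
    {q : ℕ → L2Vec Ω} {q' : L2Vec Ω} (h : ∀ n, IsWeakTangentialGradient Ω (f n) (q n))
    (hf : Tendsto f atTop (𝓝 f')) (hq : Tendsto q atTop (𝓝 q')) :
    IsWeakTangentialGradient Ω f' q' where
  tangential e g U hc := by
    obtain ⟨ns, -, hae⟩ := exists_subseq_ae_tendsto hq
    have h1 : ∀ᵐ y : E2, ∀ n, graphMap e g y ∈ U →
        ∑ i, q n (graphMap e g y) i * (graphNormal e g y i : ℂ) = 0 :=
      ae_all_iff.2 fun n => (h n).tangential e g U hc
    filter_upwards [h1, ae_graphMap hc hae] with y h1 h2 hy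
    have h3 : Tendsto (fun n => ∑ i, q (ns n) (graphMap e g y) i * (graphNormal e g y i : ℂ)) atTop
        (𝓝 (∑ i, q' (graphMap e g y) i * (graphNormal e g y i : ℂ))) :=
      tendsto_finsetSum _ fun i _ =>
        (((EuclideanSpace.proj (𝕜 := ℂ) i).continuous.tendsto _).comp (h2 hy)).mul_const _
    refine tendsto_nhds_unique h3 ?_
    simp only [h1 _ hy]
    exact tendsto_const_nhds
  weak e g U hc η hη hηc hs v := by
    have hf1 := (Lp.tendsto_Lp_iff_tendsto_eLpNorm' f f').1 hf
    have hq1 := (Lp.tendsto_Lp_iff_tendsto_eLpNorm' q q').1 hq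
    obtain ⟨C, hC⟩ := exists_lipschitz_graphMap hc
    have hw : MemLp (fun y => (fderiv ℝ η y v : ℂ)) 2 := by
      have hcont : Continuous fun y => fderiv ℝ η y v :=
        (hη.continuous_fderiv (by simp)).clm_apply continuous_const
      exact (Complex.continuous_ofReal.comp hcont).memLp_of_hasCompactSupport
        ((hηc.fderiv_apply ℝ v).comp_left Complex.ofReal_zero)
    have h1 := tendsto_integral_graphMap hc (fun n => Lp.memLp (f n)) (Lp.memLp f') hf1 hw
      fun y hy => by
        have : y ∉ tsupport (fderiv ℝ η) := fun hy' => hy (hs (tsupport_fderiv_subset ℝ hy'))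
        simp [image_eq_zero_of_notMem_tsupport this]
    have hproj : ∀ i, ∀ q : L2Vec Ω, MemLp (fun x => q x i) 2 (surfaceMeasure Ω) := fun i q =>
      (Lp.memLp q).continuousLinearMap_comp (EuclideanSpace.proj (𝕜 := ℂ) i)
    have hwi : ∀ i, MemLp (fun y => (fderiv ℝ (graphMap e g) y v i : ℂ) * (η y : ℂ)) 2 := by
      intro i
      refine memLp_mul_of_bounded (C := C * ‖v‖) hη.continuous hηc ?_ fun y => ?_
      · exact (EuclideanSpace.proj (𝕜 := ℝ) i).continuous.measurable.comp
          (measurable_fderiv_apply_const ℝ (graphMap e g) v)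
      · refine (PiLp.norm_apply_le _ i).trans ((ContinuousLinearMap.le_opNorm _ _).trans ?_)
        gcongr
        exact norm_fderiv_le_of_lipschitz ℝ hC
    have hwi0 : ∀ i, ∀ y, graphMap e g y ∉ U →
        (fderiv ℝ (graphMap e g) y v i : ℂ) * (η y : ℂ) = 0 := fun i y hy => by
      have : y ∉ tsupport η := fun hy' => hy (hs hy')
      simp [image_eq_zero_of_notMem_tsupport this]
    have h2 : ∀ i, Tendsto (fun n => ∫ y, q n (graphMap e g y) i *
        ((fderiv ℝ (graphMap e g) y v i : ℂ) * (η y : ℂ))) atTop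
        (𝓝 (∫ y, q' (graphMap e g y) i * ((fderiv ℝ (graphMap e g) y v i : ℂ) * (η y : ℂ)))) := by
      intro i
      refine tendsto_integral_graphMap (f := fun n x => q n x i) (f' := fun x => q' x i) hc
        (fun n => hproj i _) (hproj i _) ?_ (hwi i) (hwi0 i)
      refine tendsto_of_tendsto_of_tendsto_of_le_of_le tendsto_const_nhds hq1 (fun _ => bot_le)
        fun n => eLpNorm_mono fun x => ?_
      exact PiLp.norm_apply_le (q n x - q' x) i
    have hsum : ∀ q : L2Vec Ω, ∫ y, (∑ i, q (graphMap e g y) i *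
        (fderiv ℝ (graphMap e g) y v i : ℂ)) * (η y : ℂ) =
        ∑ i, ∫ y, q (graphMap e g y) i * ((fderiv ℝ (graphMap e g) y v i : ℂ) * (η y : ℂ)) := by
      intro q
      rw [← integral_finsetSum _ fun i _ =>
        integrable_graphMap (f := fun x => q x i) hc (hproj i q) (hwi i) (hwi0 i)]
      simp_rw [Finset.sum_mul, mul_assoc]
    have h3 := (tendsto_finsetSum Finset.univ fun i _ => h2 i).neg
    simp only [← hsum] at h3
    refine tendsto_nhds_unique h1 (h3.congr fun n => ?_)
    exact ((h n).weak e g U hc η hη hηc hs v).symm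

theorem isClosed_h1Submodule (Ω : Set E3) (ε : ℝ) :
    IsClosed (h1Submodule Ω ε : Set (WithLp 2 (HHalf Ω × L2Vec Ω))) := by
  refine IsSeqClosed.isClosed fun p q hp hpq => ?_
  have h1 : Tendsto (fun n => HHalf.toL2 Ω (p n).fst) atTop (𝓝 (HHalf.toL2 Ω q.fst)) :=
    (((HHalf.toL2 Ω).comp (WithLp.fstL 2 ℂ (HHalf Ω) (L2Vec Ω))).continuous.tendsto q).comp hpq
  have h2 : Tendsto (fun n => ((√ε)⁻¹ : ℂ) • (p n).snd) atTop (𝓝 (((√ε)⁻¹ : ℂ) • q.snd)) :=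
    (((WithLp.sndL 2 ℂ (HHalf Ω) (L2Vec Ω)).continuous.tendsto q).comp hpq).const_smul _
  exact IsWeakTangentialGradient.of_tendsto hp h1 h2

instance (Ω : Set E3) (ε : ℝ) : CompleteSpace (H1 Ω ε) :=
  have := (isClosed_h1Submodule Ω ε).isComplete.completeSpace_coe
  inferInstanceAs (CompleteSpace (h1Submodule Ω ε))

/-! ### Uniqueness of the weak tangential gradient -/

/-- The weak identity with f = 0 makes q orthogonal to the coordinate tangent vectors, and tangency
makes it orthogonal to the normal. By Rademacher's theorem these vectors span at almost every point.
The result makes the embedding of H¹(Γ) injective. -/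
theorem ae_eq_zero_of_isWeakTangentialGradient_zero {Ω : Set E3} {q : L2Vec Ω}
    (hq : IsWeakTangentialGradient Ω (0 : L2 Ω) q) {e g U} (hc : IsGraphChart Ω e g U) :
    ∀ᵐ y : E2, graphMap e g y ∈ U → q (graphMap e g y) = 0 := by
  obtain ⟨K, hK⟩ := hc.lipschitz
  obtain ⟨C, hC⟩ := exists_lipschitz_graphMap hc
  have hG := continuous_graphMap hc
  have hqm : Measurable q := (Lp.stronglyMeasurable q).measurable
  have hqL : MemLp (q ∘ graphMap e g) 2 (volume.restrict (graphMap e g ⁻¹' U)) :=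
    ((Lp.memLp q).mono_measure (map_graphMap_le hc)).comp_of_map hG.measurable.aemeasurable
  have hweak : ∀ v : E2, ∀ᵐ y : E2, graphMap e g y ∈ U →
      ∑ i, q (graphMap e g y) i * (fderiv ℝ (graphMap e g) y v i : ℂ) = 0 := by
    intro v
    have hm := measurable_gradient_graphMap hqm hG.measurable v
    have hL : MemLp (fun y => ∑ i, q (graphMap e g y) i * (fderiv ℝ (graphMap e g) y v i : ℂ)) 2
        (volume.restrict (graphMap e g ⁻¹' U)) := by
      refine (hqL.norm.const_mul (3 * (C * ‖v‖))).mono' hm.aestronglyMeasurable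
        (Eventually.of_forall fun y => ?_)
      refine (norm_sum_mul_ofReal_le _ _).trans ?_
      have : ‖fderiv ℝ (graphMap e g) y v‖ ≤ C * ‖v‖ := by
        refine (ContinuousLinearMap.le_opNorm _ _).trans ?_
        gcongr
        exact norm_fderiv_le_of_lipschitz ℝ hC
      calc 3 * (‖q (graphMap e g y)‖ * ‖fderiv ℝ (graphMap e g) y v‖)
          ≤ 3 * (‖q (graphMap e g y)‖ * (C * ‖v‖)) := by gcongr
        _ = _ := by simp only [Function.comp_apply]; ring
    refine (hc.isOpen.preimage hG).ae_eq_zero_of_integral_contDiff_smul_eq_zero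
      (locallyIntegrableOn_of_locallyIntegrable_restrict (hL.locallyIntegrable one_le_two)) ?_
    intro η hη hηc hs
    have h1 := hq.weak e g U hc η hη hηc hs v
    have h2 : ∫ y, (0 : L2 Ω) (graphMap e g y) * (fderiv ℝ η y v : ℂ) = 0 := by
      rw [← integral_zero E2 ℂ]
      refine integral_congr_ae ?_
      filter_upwards [ae_graphMap hc (Lp.coeFn_zero ℂ 2 (surfaceMeasure Ω))] with y h3
      by_cases hy : graphMap e g y ∈ U
      · rw [h3 hy, Pi.zero_apply, zero_mul]
      · have : y ∉ tsupport (fderiv ℝ η) := fun hy' => hy (hs (tsupport_fderiv_subset ℝ hy'))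
        simp [image_eq_zero_of_notMem_tsupport this]
    rw [h2, zero_eq_neg] at h1
    rw [← h1]
    refine integral_congr_ae (Eventually.of_forall fun y => ?_)
    simp only [Complex.real_smul]
    ring
  have hbasis : ∀ᵐ y : E2, ∀ j : Fin 2, graphMap e g y ∈ U →
      ∑ i, q (graphMap e g y) i *
        (fderiv ℝ (graphMap e g) y (EuclideanSpace.single j 1) i : ℂ) = 0 :=
    ae_all_iff.2 fun j => hweak _
  filter_upwards [hbasis, hq.tangential e g U hc, hK.ae_differentiableAt (μ := volume)]
    with y h1 h2 h3 hy
  have key : ∀ a : E3, inner ℝ (graphNormal e g y) a = 0 →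
      (∀ j : Fin 2, inner ℝ (fderiv ℝ (graphMap e g) y (EuclideanSpace.single j 1)) a = 0) →
      a = 0 := by
    intro a ha hb
    refine eq_zero_of_inner_eq_zero h3 ha fun v => ?_
    have hv : v = ∑ j, v j • EuclideanSpace.single j (1 : ℝ) := by
      ext i
      fin_cases i <;> simp
    rw [hv]
    simp [inner_add_left, inner_smul_left, hb]
  have h2 := h2 hy
  have h1 := fun j => h1 j hy
  simp only [sum_mul_ofReal_eq, Complex.ext_iff] at h1 h2
  have hre := key _ h2.1 fun j => (h1 j).1
  have him := key _ h2.2 fun j => (h1 j).2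
  ext i
  have hre := congrArg (fun a : E3 => a i) hre
  have him := congrArg (fun a : E3 => a i) him
  exact Complex.ext hre him

theorem eq_zero_of_isWeakTangentialGradient_zero {Ω : Set E3} (hΩ : IsLipschitzExteriorDomain Ω)
    {q : L2Vec Ω} (hq : IsWeakTangentialGradient Ω (0 : L2 Ω) q) : q = 0 := by
  obtain ⟨t, ht⟩ := exists_finite_atlas hΩ
  have h1 : ∀ᵐ x ∂surfaceMeasure Ω, ∀ d ∈ t, x ∈ d.U → q x = 0 :=
    (Finset.eventually_all t).2 fun d _ =>
      ae_of_ae_graphMap hΩ.isOpen d.chart (ae_eq_zero_of_isWeakTangentialGradient_zero hq d.chart)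
  rw [Lp.eq_zero_iff_ae_eq_zero]
  filter_upwards [h1, ae_mem_frontier Ω] with x hx hxΓ
  obtain ⟨d, hd, hxd⟩ := mem_iUnion₂.1 (ht hxΓ)
  exact hx d hd hxd.1

theorem H1.isAdmissibleSpace {Ω : Set E3} (hΩ : IsLipschitzExteriorDomain Ω) {ε : ℝ} (hε : 0 < ε)
    (hdense : DenseRange (H1.embed Ω ε)) : IsAdmissibleSpace (H1.embed Ω ε) (H1.seminorm Ω ε) where
  complete := inferInstance
  injective := by
    have h0 : ((√ε)⁻¹ : ℂ) ≠ 0 := by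
      rw [ne_eq, inv_eq_zero, Complex.ofReal_eq_zero]
      positivity
    refine (injective_iff_map_eq_zero _).2 ?_
    rintro ⟨p, hp⟩ h
    have h : p.fst = 0 := h
    have hp : IsWeakTangentialGradient Ω (HHalf.toL2 Ω p.fst)
      (((√ε)⁻¹ : ℂ) • p.snd : L2Vec Ω) := hp
    rw [h, map_zero] at hp
    have h2 := eq_zero_of_isWeakTangentialGradient_zero hΩ hp
    have h3 : p.snd = 0 := (smul_eq_zero.1 h2).resolve_left h0
    refine Subtype.ext ?_
    rw [WithLp.ext_iff]
    exact Prod.ext h h3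
  dense := hdense
  norm_sq := by
    intro ψ
    rw [H1.seminorm_apply]
    obtain ⟨p, hp⟩ := ψ
    change ‖p‖ ^ 2 = ‖p.fst‖ ^ 2 + (√ε * ‖((√ε)⁻¹ : ℂ) • p.snd‖) ^ 2
    have h0 : √ε ≠ 0 := by positivity
    rw [WithLp.prod_norm_sq_eq_of_L2, norm_smul, norm_inv, Complex.norm_real,
      Real.norm_of_nonneg (Real.sqrt_nonneg _), mul_inv_cancel_left₀ h0]

/-! ### Tangential gradients of continuously differentiable functions -/

theorem measurable_graphNormal (e : E3 ≃ₗᵢ[ℝ] WithLp 2 (E2 × ℝ)) (g : E2 → ℝ) :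
    Measurable (graphNormal e g) := by
  have h1 : Measurable (gradient g) :=
    (InnerProductSpace.toDual ℝ E2).symm.continuous.measurable.comp (measurable_fderiv ℝ g)
  have h2 : Continuous fun v : E2 => e.symm (WithLp.toLp 2 (-v, (1 : ℝ))) := by fun_prop
  exact h2.measurable.comp h1

/-- In the image of a second chart, the normal of the first chart is orthogonal to the tangent
vectors of the second one. -/
theorem ae_inner_graphNormal_fderiv {Ω : Set E3} (hΩ : IsOpen Ω) {e g U e' g' U'}
    (h : IsGraphChart Ω e g U) (h' : IsGraphChart Ω e' g' U') :
    ∀ᵐ y : E2, graphMap e' g' y ∈ U' → graphMap e' g' y ∈ U → ∀ v,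
      inner ℝ (graphNormal e g (e (graphMap e' g' y)).fst) (fderiv ℝ (graphMap e' g') y v) = 0 := by
  obtain ⟨K, hK⟩ := h.lipschitz
  obtain ⟨K', hK'⟩ := h'.lipschitz
  have hG' := continuous_graphMap h'
  -- Rademacher's theorem for g holds almost everywhere in the first parameter plane. It is carried
  -- to the surface and from there to the second parameter plane.
  have h1 : ∀ᵐ x ∂surfaceMeasure Ω, x ∈ U → DifferentiableAt ℝ g (e x).fst := by
    refine ae_of_ae_graphMap hΩ h ?_
    filter_upwards [hK.ae_differentiableAt (μ := volume)] with y hy _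
    rwa [fst_graphMap]
  filter_upwards [ae_graphMap h' h1, hK'.ae_differentiableAt (μ := volume)] with y hy hd' hU' hU v
  have hd := hy hU' hU
  have hG := hasFDerivAt_graphMap (e := e') hd'
  rw [inner_graphNormal]
  set L : E3 →L[ℝ] E2 := (WithLp.fstL 2 ℝ E2 ℝ).comp e.toContinuousLinearEquiv.toContinuousLinearMap
  set M : E3 →L[ℝ] ℝ := (WithLp.sndL 2 ℝ E2 ℝ).comp e.toContinuousLinearEquiv.toContinuousLinearMap
  have hD := hG.differentiableAt.hasFDerivAt
  have e1 : HasFDerivAt (fun z => M (graphMap e' g' z) - g (L (graphMap e' g' z)))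
      (M.comp (fderiv ℝ (graphMap e' g') y) - (fderiv ℝ g (L (graphMap e' g' y))).comp
        (L.comp (fderiv ℝ (graphMap e' g') y))) y :=
    (M.hasFDerivAt.comp y hD).sub (hd.hasFDerivAt.comp y (L.hasFDerivAt.comp y hD))
  -- Near y the second parametrization runs within the graph of g, so the defining function of that
  -- graph vanishes identically along it. Its derivative is the inner product in question.
  have e2 : (fun z => M (graphMap e' g' z) - g (L (graphMap e' g' z))) =ᶠ[𝓝 y] fun _ => 0 := by
    filter_upwards [hG'.continuousAt.preimage_mem_nhds (h.isOpen.mem_nhds hU),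
      hG'.continuousAt.preimage_mem_nhds (h'.isOpen.mem_nhds hU')] with z hz hz'
    have h2 := graphMap_fst_of_mem_frontier hΩ h (graphMap_mem_frontier h' hz') hz
    have h3 := congrArg (fun x => (e x).snd) h2
    simp only [graphMap, e.apply_symm_apply] at h3
    exact sub_eq_zero.2 h3.symm
  have e3 := e1.unique ((hasFDerivAt_const (0 : ℝ) y).congr_of_eventuallyEq e2)
  exact congrArg (fun A : E2 →L[ℝ] ℝ => A v) e3

/-- Each point takes the graph normal of the first chart, in some enumeration of the atlas, that
contains it; this keeps the field measurable. Normals of different charts need not agree. -/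
theorem exists_normal {Ω : Set E3} (t : Finset (ChartDisc Ω)) :
    ∃ n : E3 → E3, Measurable n ∧ ∀ d ∈ t, ∀ x ∈ d.dom, ∃ d' ∈ t, x ∈ d'.dom ∧
      n x = graphNormal d'.e d'.g (d'.e x).fst := by
  classical
  induction t using Finset.induction_on with
  | empty => exact ⟨fun _ => 0, measurable_const, by simp⟩
  | insert d t _ ih =>
    obtain ⟨n, hn, h⟩ := ih
    refine ⟨fun x => if x ∈ d.dom then graphNormal d.e d.g (d.e x).fst else n x,
      Measurable.ite d.isOpen_dom.measurableSet ((measurable_graphNormal _ _).comp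
        (continuous_fst_apply d.e).measurable) hn, fun d₁ hd₁ x hx => ?_⟩
    by_cases hxd : x ∈ d.dom
    · exact ⟨d, Finset.mem_insert_self _ _, hxd, if_pos hxd⟩
    · rcases Finset.mem_insert.1 hd₁ with rfl | h1
      · exact absurd hx hxd
      · obtain ⟨d', hd', h2, h3⟩ := h d₁ h1 x hx
        exact ⟨d', Finset.mem_insert_of_mem hd', h2, (if_neg hxd).trans h3⟩

/-- A measurable field of normal vectors of `∂Ω`. -/
theorem exists_normal_field {Ω : Set E3} (hΩ : IsLipschitzExteriorDomain Ω) :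
    ∃ n : E3 → E3, Measurable n ∧ ∀ e g U, IsGraphChart Ω e g U → ∀ᵐ y : E2, graphMap e g y ∈ U →
      n (graphMap e g y) ≠ 0 ∧ ∀ v,
        inner ℝ (n (graphMap e g y)) (fderiv ℝ (graphMap e g) y v) = 0 := by
  obtain ⟨t, ht⟩ := exists_finite_atlas hΩ
  obtain ⟨n, hn, h⟩ := exists_normal t
  refine ⟨n, hn, fun e g U hc => ?_⟩
  have h1 := (Finset.eventually_all t).2 fun d _ =>
    ae_inner_graphNormal_fderiv hΩ.isOpen d.chart hc
  filter_upwards [h1] with y hy hU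
  obtain ⟨d, hd, hxd⟩ := mem_iUnion₂.1 (ht (graphMap_mem_frontier hc hU))
  obtain ⟨d', hd', hx', hn'⟩ := h d hd _ hxd
  rw [hn']
  exact ⟨graphNormal_ne_zero, hy d' hd' hU hx'.1⟩

theorem Gibc.IsWeakTangentialGradient.congr {Ω : Set E3} {f f' : E3 → ℂ}
    {q q' : E3 → EuclideanSpace ℂ (Fin 3)} (h : IsWeakTangentialGradient Ω f q)
    (hf : f =ᵐ[surfaceMeasure Ω] f') (hq : q =ᵐ[surfaceMeasure Ω] q') :
    IsWeakTangentialGradient Ω f' q' where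
  tangential e g U hc := by
    filter_upwards [h.tangential e g U hc, ae_graphMap hc hq] with y h1 h2 hU
    rw [← h2 hU]
    exact h1 hU
  weak e g U hc η hη hηc hs v := by
    have e1 : ∫ y, f' (graphMap e g y) * (fderiv ℝ η y v : ℂ) =
        ∫ y, f (graphMap e g y) * (fderiv ℝ η y v : ℂ) := by
      refine integral_congr_ae ?_
      filter_upwards [ae_graphMap hc hf] with y h3
      by_cases hy : graphMap e g y ∈ U
      · rw [h3 hy]
      · have : y ∉ tsupport (fderiv ℝ η) := fun hy' => hy (hs (tsupport_fderiv_subset ℝ hy'))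
        simp [image_eq_zero_of_notMem_tsupport this]
    have e2 : ∫ y, (∑ i, q' (graphMap e g y) i * (fderiv ℝ (graphMap e g) y v i : ℂ)) * (η y : ℂ) =
        ∫ y, (∑ i, q (graphMap e g y) i * (fderiv ℝ (graphMap e g) y v i : ℂ)) * (η y : ℂ) := by
      refine integral_congr_ae ?_
      filter_upwards [ae_graphMap hc hq] with y h3
      by_cases hy : graphMap e g y ∈ U
      · rw [h3 hy]
      · have : y ∉ tsupport η := fun hy' => hy (hs hy')
        simp [image_eq_zero_of_notMem_tsupport this]
    rw [e1, e2, h.weak e g U hc η hη hηc hs v]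

theorem sum_ofReal_mul_ofReal (a b : E3) : ∑ i, (a i : ℂ) * (b i : ℂ) = (inner ℝ b a : ℝ) := by
  simp [PiLp.inner_apply]

/-- The gradient on Γ is the ambient gradient without its component along n. The field n is merely
nonzero and normal, hence the division by its squared length. -/
theorem isWeakTangentialGradient_of_contDiff {Ω : Set E3} {n : E3 → E3}
    (hn : ∀ e g U, IsGraphChart Ω e g U → ∀ᵐ y : E2, graphMap e g y ∈ U →
      n (graphMap e g y) ≠ 0 ∧ ∀ v,
        inner ℝ (n (graphMap e g y)) (fderiv ℝ (graphMap e g) y v) = 0)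
    {w : E3 → ℝ} (hw : ContDiff ℝ 1 w) (hwc : HasCompactSupport w) :
    IsWeakTangentialGradient Ω (fun x => (w x : ℂ)) fun x => WithLp.toLp 2 fun i =>
      (((gradient w x - (inner ℝ (n x) (gradient w x) / ‖n x‖ ^ 2) • n x : E3) i : ℝ) : ℂ) where
  tangential e g U hc := by
    obtain ⟨K, hK⟩ := hc.lipschitz
    filter_upwards [hn e g U hc, hK.ae_differentiableAt (μ := volume)] with y hy hd hU
    obtain ⟨h0, h1⟩ := hy hU
    simp only [sum_ofReal_mul_ofReal]
    set x := graphMap e g y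
    set N := graphNormal e g y
    have hNt : ∀ v, inner ℝ (fderiv ℝ (graphMap e g) y v) N = 0 := by
      intro v
      rw [real_inner_comm, inner_graphNormal, fderiv_graphMap hd, e.apply_symm_apply]
      simp
    have hN0 : N ≠ 0 := graphNormal_ne_zero
    -- The vectors n and N are parallel: the combination that is orthogonal to N is also orthogonal
    -- to all tangent vectors, hence zero.
    have hpar : (inner ℝ N N : ℝ) • n x - (inner ℝ N (n x) : ℝ) • N = 0 := by
      refine eq_zero_of_inner_eq_zero (e := e) (g := g) (y := y) hd ?_ fun v => ?_
      · rw [inner_sub_right, inner_smul_right, inner_smul_right]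
        ring
      · rw [inner_sub_right, inner_smul_right, inner_smul_right, hNt, real_inner_comm (n x), h1 v]
        ring
    have hNN : (inner ℝ N N : ℝ) ≠ 0 := by simpa using hN0
    have hcn : (inner ℝ N (n x) : ℝ) ≠ 0 := by
      intro hz
      rw [hz, zero_smul, sub_zero] at hpar
      rcases smul_eq_zero.1 hpar with h | h
      exacts [hNN h, h0 h]
    have hnn : inner ℝ (n x) (gradient w x - (inner ℝ (n x) (gradient w x) / ‖n x‖ ^ 2) • n x) =
        0 := by
      rw [inner_sub_right, inner_smul_right, real_inner_self_eq_norm_sq,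
        div_mul_cancel₀ _ (by simpa using h0), sub_self]
    rw [Complex.ofReal_eq_zero]
    have := congrArg (fun a : E3 => inner ℝ a
      (gradient w x - (inner ℝ (n x) (gradient w x) / ‖n x‖ ^ 2) • n x)) (sub_eq_zero.1 hpar)
    simp only [inner_smul_left, RCLike.conj_to_real] at this
    rw [hnn, mul_zero] at this
    exact (mul_eq_zero.1 this.symm).resolve_left hcn
  weak e g U hc η hη hηc hs v := by
    obtain ⟨K, hK⟩ := hc.lipschitz
    obtain ⟨C, hC⟩ := exists_lipschitz_graphMap hc
    obtain ⟨D, hD⟩ := ContDiff.lipschitzWith_of_hasCompactSupport hwc hw (by simp)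
    obtain ⟨D', hD'⟩ := ContDiff.lipschitzWith_of_hasCompactSupport hηc hη (by simp)
    -- Integration by parts for Lipschitz functions; the chain rule is then needed only at points
    -- where g is differentiable, that is almost everywhere.
    have h1 := (hD.comp hC).integral_lineDeriv_mul_eq (μ := volume) hD' hηc v
    have h2 : ∀ y, lineDeriv ℝ η y (-v) * (w ∘ graphMap e g) y =
        -(w (graphMap e g y) * fderiv ℝ η y v) := by
      intro y
      rw [(hη.differentiable (by simp)).differentiableAt.lineDeriv_eq_fderiv, map_neg]
      simp only [Function.comp_apply]
      ring
    simp_rw [h2] at h1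
    rw [integral_neg] at h1
    have h3 : ∫ y, w (graphMap e g y) * fderiv ℝ η y v =
        -∫ y, lineDeriv ℝ (w ∘ graphMap e g) y v * η y := by rw [h1, neg_neg]
    have h4 : ∫ y, (w (graphMap e g y) : ℂ) * (fderiv ℝ η y v : ℂ) =
        ((∫ y, w (graphMap e g y) * fderiv ℝ η y v : ℝ) : ℂ) := by
      rw [← integral_complex_ofReal]
      push_cast
      rfl
    rw [h4, h3, Complex.ofReal_neg, ← integral_complex_ofReal]
    congr 1
    refine integral_congr_ae ?_
    filter_upwards [hn e g U hc, hK.ae_differentiableAt (μ := volume)] with y hy hd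
    by_cases hU : graphMap e g y ∈ U
    · obtain ⟨-, h5⟩ := hy hU
      simp only [sum_ofReal_mul_ofReal]
      have hGd := (hasFDerivAt_graphMap (e := e) hd).differentiableAt
      have hwd : DifferentiableAt ℝ w (graphMap e g y) := (hw.differentiable (by simp)).differentiableAt
      have h6 : lineDeriv ℝ (w ∘ graphMap e g) y v =
          fderiv ℝ w (graphMap e g y) (fderiv ℝ (graphMap e g) y v) := by
        rw [(hwd.comp y hGd).lineDeriv_eq_fderiv, fderiv_comp y hwd hGd]
        rfl
      rw [h6, inner_sub_right, inner_smul_right, real_inner_comm (n _), h5, mul_zero, sub_zero,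
        real_inner_comm, inner_gradient_left]
      push_cast
      rfl
    · have : y ∉ tsupport η := fun hy' => hU (hs hy')
      simp [image_eq_zero_of_notMem_tsupport this]

theorem exists_isWeakTangentialGradient_of_real {Ω : Set E3} (hΩ : IsLipschitzExteriorDomain Ω)
    {w : E3 → ℝ} (hw : ContDiff ℝ 1 w) (hwc : HasCompactSupport w) :
    ∃ (f : L2 Ω) (q : L2Vec Ω), f =ᵐ[surfaceMeasure Ω] (fun x => (w x : ℂ)) ∧
      IsWeakTangentialGradient Ω f q := by
  have := isFiniteMeasure_surfaceMeasure hΩ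
  obtain ⟨n, hnm, hn⟩ := exists_normal_field hΩ
  have hG : Continuous (gradient w) :=
    (InnerProductSpace.toDual ℝ E3).symm.continuous.comp (hw.continuous_fderiv (by simp))
  obtain ⟨B, hB⟩ := hw.continuous.bounded_above_of_compact_support hwc
  have hGc : HasCompactSupport (gradient w) :=
    (hwc.fderiv ℝ).comp_left (g := (InnerProductSpace.toDual ℝ E3).symm) (map_zero _)
  obtain ⟨B', hB'⟩ := hG.bounded_above_of_compact_support hGc
  set Q : E3 → E3 := fun x => gradient w x - (inner ℝ (n x) (gradient w x) / ‖n x‖ ^ 2) • n x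
  have hQm : Measurable Q := by
    have hGm := hG.measurable
    exact hGm.sub (((hnm.inner hGm).div (hnm.norm.pow_const 2)).smul hnm)
  have hQb : ∀ x, ‖Q x‖ ≤ B' + B' := by
    intro x
    refine (norm_sub_le _ _).trans (add_le_add (hB' x) (le_trans ?_ (hB' x)))
    rcases eq_or_ne (n x) 0 with h0 | h0
    · simp [h0]
    have hpos := norm_pos_iff.2 h0
    rw [norm_smul, norm_div, norm_pow, norm_norm, div_mul_eq_mul_div, div_le_iff₀ (by positivity)]
    have := norm_inner_le_norm (𝕜 := ℝ) (n x) (gradient w x)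
    calc ‖(inner ℝ (n x) (gradient w x) : ℝ)‖ * ‖n x‖ ≤ (‖n x‖ * ‖gradient w x‖) * ‖n x‖ := by gcongr
      _ = _ := by ring
  set q : E3 → EuclideanSpace ℂ (Fin 3) := fun x => WithLp.toLp 2 fun i => ((Q x i : ℝ) : ℂ)
  have hfL : MemLp (fun x => (w x : ℂ)) 2 (surfaceMeasure Ω) :=
    MemLp.of_bound (Complex.continuous_ofReal.comp hw.continuous).aestronglyMeasurable B
      (Eventually.of_forall fun x => by simpa using hB x)
  have hqL : MemLp q 2 (surfaceMeasure Ω) := by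
    have hc : Continuous fun a : E3 => (WithLp.toLp 2 fun i => ((a i : ℝ) : ℂ) :
      EuclideanSpace ℂ (Fin 3)) := by fun_prop
    refine MemLp.of_bound (hc.measurable.comp hQm).aestronglyMeasurable (B' + B')
      (Eventually.of_forall fun x => (le_of_eq ?_).trans (hQb x))
    simp [q, EuclideanSpace.norm_eq]
  have hwk : IsWeakTangentialGradient Ω (fun x => (w x : ℂ)) q :=
    isWeakTangentialGradient_of_contDiff hn hw hwc
  exact ⟨hfL.toLp, hqL.toLp, hfL.coeFn_toLp,
    hwk.congr hfL.coeFn_toLp.symm hqL.coeFn_toLp.symm⟩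

theorem exists_isWeakTangentialGradient_of_contDiff {Ω : Set E3}
    (hΩ : IsLipschitzExteriorDomain Ω) {w : E3 → ℂ} (hw : ContDiff ℝ 1 w)
    (hwc : HasCompactSupport w) :
    ∃ (f : L2 Ω) (q : L2Vec Ω), f =ᵐ[surfaceMeasure Ω] w ∧ IsWeakTangentialGradient Ω f q := by
  obtain ⟨f₁, q₁, hf₁, h₁⟩ := exists_isWeakTangentialGradient_of_real hΩ
    (Complex.reCLM.contDiff.comp hw) (hwc.comp_left (g := Complex.re) rfl)
  obtain ⟨f₂, q₂, hf₂, h₂⟩ := exists_isWeakTangentialGradient_of_real hΩ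
    (Complex.imCLM.contDiff.comp hw) (hwc.comp_left (g := Complex.im) rfl)
  refine ⟨f₁ + Complex.I • f₂, q₁ + Complex.I • q₂, ?_, h₁.add (h₂.smul Complex.I)⟩
  filter_upwards [hf₁, hf₂, Lp.coeFn_add f₁ (Complex.I • f₂), Lp.coeFn_smul Complex.I f₂]
    with x h1 h2 h3 h4
  rw [h3, Pi.add_apply, h4, Pi.smul_apply, h1, h2]
  apply Complex.ext <;> simp

/-! ### Averages over small balls -/

/-- The part of the Sobolev-Slobodeckij integral of `u` at `x` that comes from a ball around `x`. -/
noncomputable def localEnergy (μ : Measure E3) (u : E3 → ℂ) (ρ : ℝ) (x : E3) : ℝ≥0∞ :=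
  ∫⁻ z in Metric.ball x ρ, ENNReal.ofReal (dist x z ^ 3)⁻¹ * ‖u x - u z‖ₑ ^ 2 ∂μ

/-- Cauchy–Schwarz on the ball of radius ρ, whose measure is at most Aρ², combined with 1 ≤ ρ³ |x −
z|⁻³ there; this is the source of the power ρ⁵. -/
theorem enorm_sq_integral_kernel_le {μ : Measure E3} {A : ℝ≥0}
    (hμ : ∀ x r, μ (Metric.ball x r) ≤ A * ENNReal.ofReal r ^ 2) {u : E3 → ℂ} (hu : Measurable u)
    {κ : E3 → ℝ} {M ρ : ℝ} (hM : 0 ≤ M) (hρ : 0 ≤ ρ) (x : E3) (hκ : ∀ z, |κ z| ≤ M)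
    (hκ0 : ∀ z, ρ ≤ dist x z → κ z = 0) :
    ‖∫ z, (κ z : ℂ) * (u z - u x) ∂μ‖ₑ ^ 2 ≤
      A * ENNReal.ofReal (M ^ 2 * ρ ^ 5) * localEnergy μ u ρ x := by
  have hB : MeasurableSet (Metric.ball x ρ) := Metric.isOpen_ball.measurableSet
  have h1 : ‖∫ z, (κ z : ℂ) * (u z - u x) ∂μ‖ₑ ≤
      ∫⁻ z in Metric.ball x ρ, ENNReal.ofReal M * ‖u x - u z‖ₑ ∂μ := by
    refine (enorm_integral_le_lintegral_enorm _).trans ?_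
    rw [← lintegral_indicator hB]
    refine lintegral_mono fun z => ?_
    by_cases hz : z ∈ Metric.ball x ρ
    · rw [indicator_of_mem hz, enorm_mul, ← enorm_neg (u z - u x), neg_sub]
      gcongr
      rw [← ofReal_norm, Complex.norm_real]
      exact ENNReal.ofReal_le_ofReal (hκ z)
    · rw [hκ0 z (by rw [dist_comm]; simpa using hz)]
      simp
  have h2 := sq_lintegral_le (μ.restrict (Metric.ball x ρ))
    (f := fun z => ENNReal.ofReal M * ‖u x - u z‖ₑ)
    ((measurable_const.sub hu).enorm.const_mul _).aemeasurable
  rw [Measure.restrict_apply_univ] at h2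
  have h3 : ∫⁻ z in Metric.ball x ρ, (ENNReal.ofReal M * ‖u x - u z‖ₑ) ^ 2 ∂μ ≤
      ENNReal.ofReal (M ^ 2 * ρ ^ 3) * localEnergy μ u ρ x := by
    rw [localEnergy, ← lintegral_const_mul' _ _ ENNReal.ofReal_ne_top]
    refine setLIntegral_mono' hB fun z hz => ?_
    rw [mul_pow, ← ENNReal.ofReal_pow hM, ENNReal.ofReal_mul (by positivity), mul_assoc, ← mul_assoc
      (ENNReal.ofReal (ρ ^ 3))]
    gcongr
    rcases (dist_nonneg (x := x) (y := z)).eq_or_lt with h0 | h0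
    · rw [dist_eq_zero.1 h0.symm]
      simp
    refine le_mul_of_one_le_left bot_le ?_
    rw [← ENNReal.ofReal_mul (by positivity), ← ENNReal.ofReal_one]
    refine ENNReal.ofReal_le_ofReal ?_
    rw [← div_eq_mul_inv, one_le_div (by positivity)]
    gcongr
    rw [dist_comm]
    exact hz.le
  calc _ ≤ (∫⁻ z in Metric.ball x ρ, ENNReal.ofReal M * ‖u x - u z‖ₑ ∂μ) ^ 2 := by gcongr
    _ ≤ _ := h2
    _ ≤ (A * ENNReal.ofReal ρ ^ 2) * (ENNReal.ofReal (M ^ 2 * ρ ^ 3) * localEnergy μ u ρ x) := by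
      gcongr
      exact hμ x ρ
    _ = _ := by
      rw [← mul_assoc, mul_assoc (A : ℝ≥0∞), ← ENNReal.ofReal_pow hρ,
        ← ENNReal.ofReal_mul (by positivity)]
      congr 3
      ring

/-- A cutoff function on the scale `r` with Lipschitz constant `L / r`. -/
structure IsCutoff (φ : E3 → ℝ) (r L : ℝ) : Prop where
  smooth : ContDiff ℝ 1 φ
  nonneg : ∀ z, 0 ≤ φ z
  le_one : ∀ z, φ z ≤ 1
  eq_one : ∀ z, ‖z‖ ≤ r → φ z = 1
  eq_zero : ∀ z, 2 * r ≤ ‖z‖ → φ z = 0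
  lipschitz : ∀ y z, |φ y - φ z| ≤ L / r * dist y z

/-- A single bump function is rescaled, so that L does not depend on r. -/
theorem exists_isCutoff : ∃ L : ℝ, 0 ≤ L ∧ ∀ r > 0, ∃ φ : E3 → ℝ, IsCutoff φ r L := by
  let b : ContDiffBump (0 : E3) := ⟨1, 2, one_pos, one_lt_two⟩
  obtain ⟨L, hL⟩ := ContDiff.lipschitzWith_of_hasCompactSupport b.hasCompactSupport
    (b.contDiff (n := 1)) (by simp)
  refine ⟨L, L.2, fun r hr => ⟨fun z => b (r⁻¹ • z), ?_, fun z => b.nonneg, fun z => b.le_one,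
    fun z hz => ?_, fun z hz => ?_, fun y z => ?_⟩⟩
  · exact b.contDiff.comp (contDiff_const_smul _)
  · refine b.one_of_mem_closedBall ?_
    rw [mem_closedBall_zero_iff, norm_smul, norm_inv, Real.norm_of_nonneg hr.le, inv_mul_le_iff₀ hr]
    change ‖z‖ ≤ r * 1
    linarith
  · refine b.zero_of_le_dist ?_
    rw [dist_zero_right, norm_smul, norm_inv, Real.norm_of_nonneg hr.le, le_inv_mul_iff₀ hr]
    change r * 2 ≤ ‖z‖
    linarith
  · have := hL.dist_le_mul (r⁻¹ • y) (r⁻¹ • z)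
    rw [Real.dist_eq, dist_smul₀, norm_inv, Real.norm_of_nonneg hr.le] at this
    refine this.trans_eq ?_
    ring

/-- The mass of the cutoff function centred at `x`. -/
noncomputable def cutoffMass (μ : Measure E3) (φ : E3 → ℝ) (x : E3) : ℝ := ∫ z, φ (x - z) ∂μ

/-- The average of `u` with respect to the cutoff function centred at `x`. -/
noncomputable def cutoffAverage (μ : Measure E3) (φ : E3 → ℝ) (u : E3 → ℂ) (x : E3) : ℂ :=
  (∫ z, (φ (x - z) : ℂ) * u z ∂μ) / cutoffMass μ φ x

section Average

variable {μ : Measure E3} {A : ℝ≥0} {a : ℝ} {u : E3 → ℂ} {φ : E3 → ℝ} {r L : ℝ}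

theorem measureReal_ball_le [IsFiniteMeasure μ] (hμ : ∀ x r, μ (Metric.ball x r) ≤ A * ENNReal.ofReal r ^ 2) (x : E3)
    {r : ℝ} (hr : 0 ≤ r) : μ.real (Metric.ball x r) ≤ A * r ^ 2 := by
  have h := ENNReal.toReal_mono (by finiteness) (hμ x r)
  simpa [Measure.real, ENNReal.toReal_mul, ENNReal.toReal_ofReal hr] using h

theorem IsCutoff.integrable [IsFiniteMeasure μ] (hφ : IsCutoff φ r L) (x : E3) : Integrable (fun z => φ (x - z)) μ := by
  have hc := hφ.smooth.continuous
  refine Integrable.of_bound (Continuous.aestronglyMeasurable (by fun_prop)) 1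
    (Eventually.of_forall fun z => ?_)
  rw [Real.norm_of_nonneg (hφ.nonneg _)]
  exact hφ.le_one _

theorem IsCutoff.integrable_mul (hφ : IsCutoff φ r L) (hu : Integrable u μ) (x : E3) :
    Integrable (fun z => (φ (x - z) : ℂ) * u z) μ := by
  have hc := hφ.smooth.continuous
  refine hu.bdd_mul (c := 1) (Continuous.aestronglyMeasurable (by fun_prop))
    (Eventually.of_forall fun z => ?_)
  rw [Complex.norm_real, Real.norm_of_nonneg (hφ.nonneg _)]
  exact hφ.le_one _

theorem IsCutoff.le_mass [IsFiniteMeasure μ] (hφ : IsCutoff φ r L) {x : E3}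
    (hx : a * r ^ 2 ≤ μ.real (Metric.ball x r)) : a * r ^ 2 ≤ cutoffMass μ φ x := by
  refine hx.trans ?_
  rw [← integral_indicator_one Metric.isOpen_ball.measurableSet]
  refine integral_mono ((integrable_const (1 : ℝ)).indicator Metric.isOpen_ball.measurableSet)
    (hφ.integrable x) fun z => ?_
  refine indicator_le' (fun z hz => ?_) (fun z _ => hφ.nonneg _) z
  rw [hφ.eq_one _ (by rw [← dist_eq_norm, dist_comm]; exact hz.le)]
  rfl

theorem IsCutoff.eq_zero_of_dist (hφ : IsCutoff φ r L) {x y z : E3} (hr : 0 < r)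
    (hxy : dist x y < r) (hz : 3 * r ≤ dist x z) : φ (x - z) = 0 ∧ φ (y - z) = 0 := by
  have := dist_triangle x y z
  refine ⟨hφ.eq_zero _ ?_, hφ.eq_zero _ ?_⟩ <;> rw [← dist_eq_norm] <;> linarith

theorem IsCutoff.abs_mass_sub_le [IsFiniteMeasure μ] (hφ : IsCutoff φ r L) (hr : 0 < r)
    (hμ : ∀ x r, μ (Metric.ball x r) ≤ A * ENNReal.ofReal r ^ 2) {x y : E3} (hxy : dist x y < r) :
    |cutoffMass μ φ x - cutoffMass μ φ y| ≤ L / r * dist x y * (A * (3 * r) ^ 2) := by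
  have hD : 0 ≤ L / r * dist x y := (abs_nonneg _).trans (hφ.lipschitz x y)
  rw [cutoffMass, cutoffMass, ← integral_sub (hφ.integrable x) (hφ.integrable y)]
  have h1 : ‖∫ z, (φ (x - z) - φ (y - z)) ∂μ‖ ≤
      ∫ z, (Metric.ball x (3 * r)).indicator (fun _ => L / r * dist x y) z ∂μ := by
    refine norm_integral_le_of_norm_le
      ((integrable_const _).indicator Metric.isOpen_ball.measurableSet)
      (Eventually.of_forall fun z => ?_)
    by_cases hz : z ∈ Metric.ball x (3 * r)
    · rw [indicator_of_mem hz]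
      refine (hφ.lipschitz _ _).trans_eq ?_
      rw [dist_sub_right]
    · obtain ⟨e1, e2⟩ := hφ.eq_zero_of_dist hr hxy (z := z) (by rw [dist_comm]; simpa using hz)
      rw [indicator_of_notMem hz, e1, e2, sub_self, norm_zero]
  refine h1.trans ?_
  rw [integral_indicator_const _ Metric.isOpen_ball.measurableSet, smul_eq_mul, mul_comm]
  exact mul_le_mul_of_nonneg_left (measureReal_ball_le hμ x (by positivity)) hD

theorem cutoffAverage_eq (x : E3) :
    cutoffAverage μ φ u x = ∫ z, ((φ (x - z) / cutoffMass μ φ x : ℝ) : ℂ) * u z ∂μ := by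
  rw [cutoffAverage, ← integral_div]
  refine integral_congr_ae (Eventually.of_forall fun z => ?_)
  simp only [Complex.ofReal_div]
  ring

theorem integral_cutoff_div_mass {x : E3} (hx : cutoffMass μ φ x ≠ 0) :
    ∫ z, ((φ (x - z) / cutoffMass μ φ x : ℝ) : ℂ) ∂μ = 1 := by
  rw [integral_complex_ofReal, integral_div, ← cutoffMass, div_self hx, Complex.ofReal_one]

theorem IsCutoff.integrable_kernel [IsFiniteMeasure μ] (hφ : IsCutoff φ r L) (x : E3) :
    Integrable (fun z => ((φ (x - z) / cutoffMass μ φ x : ℝ) : ℂ)) μ :=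
  ((hφ.integrable x).div_const _).ofReal

theorem IsCutoff.integrable_kernel_mul [IsFiniteMeasure μ] (hφ : IsCutoff φ r L) (hu : Integrable u μ) (x : E3) :
    Integrable (fun z => ((φ (x - z) / cutoffMass μ φ x : ℝ) : ℂ) * u z) μ := by
  refine ((hφ.integrable_mul hu x).div_const (cutoffMass μ φ x : ℂ)).congr
    (Eventually.of_forall fun z => ?_)
  simp only [Complex.ofReal_div]
  ring

theorem IsCutoff.average_sub [IsFiniteMeasure μ] (hφ : IsCutoff φ r L) (hu : Integrable u μ) {x : E3}
    (hx : cutoffMass μ φ x ≠ 0) : cutoffAverage μ φ u x - u x =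
      ∫ z, ((φ (x - z) / cutoffMass μ φ x : ℝ) : ℂ) * (u z - u x) ∂μ := by
  simp_rw [mul_sub]
  rw [integral_sub (hφ.integrable_kernel_mul hu x) ((hφ.integrable_kernel x).mul_const _),
    integral_mul_const, integral_cutoff_div_mass hx, one_mul, cutoffAverage_eq]

/-- The difference of two normalized kernels has total mass zero, which permits subtracting u(x).
The difference of averages is then controlled by the energy of u around x alone. -/
theorem IsCutoff.average_sub_average [IsFiniteMeasure μ] (hφ : IsCutoff φ r L) (hu : Integrable u μ) {x y : E3}
    (hx : cutoffMass μ φ x ≠ 0) (hy : cutoffMass μ φ y ≠ 0) :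
    cutoffAverage μ φ u x - cutoffAverage μ φ u y =
      ∫ z, ((φ (x - z) / cutoffMass μ φ x - φ (y - z) / cutoffMass μ φ y : ℝ) : ℂ) *
        (u z - u x) ∂μ := by
  have i1 : Integrable (fun z => ((φ (x - z) / cutoffMass μ φ x : ℝ) : ℂ) * (u z - u x)) μ :=
    ((hφ.integrable_kernel_mul hu x).sub ((hφ.integrable_kernel x).mul_const (u x))).congr
      (Eventually.of_forall fun z => by simp only [Pi.sub_apply]; ring)
  have i2 : Integrable (fun z => ((φ (y - z) / cutoffMass μ φ y : ℝ) : ℂ) * (u z - u x)) μ :=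
    ((hφ.integrable_kernel_mul hu y).sub ((hφ.integrable_kernel y).mul_const (u x))).congr
      (Eventually.of_forall fun z => by simp only [Pi.sub_apply]; ring)
  have e2 : ∫ z, ((φ (y - z) / cutoffMass μ φ y : ℝ) : ℂ) * (u z - u x) ∂μ =
      cutoffAverage μ φ u y - u x := by
    simp_rw [mul_sub]
    rw [integral_sub (hφ.integrable_kernel_mul hu y) ((hφ.integrable_kernel y).mul_const _),
      integral_mul_const, integral_cutoff_div_mass hy, one_mul, cutoffAverage_eq]
  simp_rw [Complex.ofReal_sub, sub_mul]
  rw [integral_sub i1 i2, ← hφ.average_sub hu hx, e2]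
  ring

theorem IsCutoff.abs_kernel_le [IsFiniteMeasure μ] (hφ : IsCutoff φ r L) {x : E3} (ha : 0 < a) (hr : 0 < r)
    (hx : a * r ^ 2 ≤ μ.real (Metric.ball x r)) (z : E3) :
    |φ (x - z) / cutoffMass μ φ x| ≤ 1 / (a * r ^ 2) := by
  have h1 := hφ.le_mass hx
  have h2 : 0 < a * r ^ 2 := by positivity
  rw [abs_of_nonneg (div_nonneg (hφ.nonneg _) (h2.le.trans h1))]
  exact div_le_div₀ zero_le_one (hφ.le_one _) h2 h1

theorem IsCutoff.abs_kernel_sub_le [IsFiniteMeasure μ] (hφ : IsCutoff φ r L) {x y : E3} (ha : 0 < a) (hr : 0 < r)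
    (hμ : ∀ x r, μ (Metric.ball x r) ≤ A * ENNReal.ofReal r ^ 2) (hxy : dist x y < r)
    (hx : a * r ^ 2 ≤ μ.real (Metric.ball x r)) (hy : a * r ^ 2 ≤ μ.real (Metric.ball y r))
    (z : E3) :
    |φ (x - z) / cutoffMass μ φ x - φ (y - z) / cutoffMass μ φ y| ≤
      L * (1 + 9 * A / a) / a * dist x y / r ^ 3 := by
  have hmx := hφ.le_mass hx
  have hmy := hφ.le_mass hy
  have h2 : 0 < a * r ^ 2 := by positivity
  have hsub := hφ.abs_mass_sub_le hr hμ hxy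
  have hD : 0 ≤ L / r * dist x y := (abs_nonneg _).trans (hφ.lipschitz x y)
  have hlip := hφ.lipschitz (x - z) (y - z)
  rw [dist_sub_right] at hlip
  set P := cutoffMass μ φ x
  set Q := cutoffMass μ φ y
  have hP : 0 < P := h2.trans_le hmx
  have hQ : 0 < Q := h2.trans_le hmy
  -- A discrete quotient rule: one term from the variation of φ, one from the variation of the mass.
  -- The second carries A(3r)², the bound for the measure of the ball in which both cutoffs live,
  -- hence the 9A/a in the constant.
  have e1 : φ (x - z) / P - φ (y - z) / Q =
      (φ (x - z) - φ (y - z)) / P - φ (y - z) * ((P - Q) / (P * Q)) := by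
    field_simp
    ring
  have b1 : |(φ (x - z) - φ (y - z)) / P| ≤ L / r * dist x y / (a * r ^ 2) := by
    rw [abs_div, abs_of_pos hP]
    exact div_le_div₀ hD hlip h2 hmx
  have b2 : |φ (y - z) * ((P - Q) / (P * Q))| ≤
      1 * (L / r * dist x y * (A * (3 * r) ^ 2) / (a * r ^ 2 * (a * r ^ 2))) := by
    rw [abs_mul, abs_div, abs_of_pos (mul_pos hP hQ), abs_of_nonneg (hφ.nonneg _)]
    refine mul_le_mul (hφ.le_one _) ?_ (by positivity) zero_le_one
    exact div_le_div₀ (by positivity) hsub (by positivity) (by gcongr)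
  rw [e1]
  refine (abs_sub _ _).trans ((add_le_add b1 b2).trans_eq ?_)
  field_simp
  ring

/-- The kernel is at most 1/(ar²) and lives at scale 3r, so M²ρ⁵ = 3⁵ r/a²; the gained factor r
compensates for ∫|x − y|⁻³ ~ 1/r away from the diagonal. -/
theorem IsCutoff.enorm_sq_average_sub_le [IsFiniteMeasure μ] (hφ : IsCutoff φ r L) (hum : Measurable u)
    (hu : Integrable u μ) {x : E3} (ha : 0 < a) (hr : 0 < r)
    (hμ : ∀ x r, μ (Metric.ball x r) ≤ A * ENNReal.ofReal r ^ 2)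
    (hx : a * r ^ 2 ≤ μ.real (Metric.ball x r)) :
    ‖cutoffAverage μ φ u x - u x‖ₑ ^ 2 ≤
      A * ENNReal.ofReal (243 / a ^ 2 * r) * localEnergy μ u (3 * r) x := by
  have h2 : 0 < a * r ^ 2 := by positivity
  rw [hφ.average_sub hu (h2.trans_le (hφ.le_mass hx)).ne']
  refine (enorm_sq_integral_kernel_le hμ hum (M := 1 / (a * r ^ 2)) (ρ := 3 * r) (by positivity)
    (by positivity) x (hφ.abs_kernel_le ha hr hx) fun z hz => ?_).trans_eq ?_
  · rw [(hφ.eq_zero_of_dist (y := x) hr (by simpa using hr) hz).1, zero_div]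
  · congr 3
    field_simp
    ring

/-- Here M is of order |x − y|/r³, so M²ρ⁵ is of order |x − y|²/r; the factor |x − y|² makes the
kernel |x − y|⁻³ integrable at the diagonal. -/
theorem IsCutoff.enorm_sq_average_sub_average_le [IsFiniteMeasure μ] (hφ : IsCutoff φ r L) (hum : Measurable u)
    (hu : Integrable u μ) {x y : E3} (hL : 0 ≤ L) (ha : 0 < a) (hr : 0 < r)
    (hμ : ∀ x r, μ (Metric.ball x r) ≤ A * ENNReal.ofReal r ^ 2) (hxy : dist x y < r)
    (hx : a * r ^ 2 ≤ μ.real (Metric.ball x r)) (hy : a * r ^ 2 ≤ μ.real (Metric.ball y r)) :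
    ‖cutoffAverage μ φ u x - cutoffAverage μ φ u y‖ₑ ^ 2 ≤
      A * ENNReal.ofReal (243 * (L * (1 + 9 * A / a) / a) ^ 2 * dist x y ^ 2 / r) *
        localEnergy μ u (3 * r) x := by
  have h2 : 0 < a * r ^ 2 := by positivity
  rw [hφ.average_sub_average hu (h2.trans_le (hφ.le_mass hx)).ne' (h2.trans_le (hφ.le_mass hy)).ne']
  refine (enorm_sq_integral_kernel_le hμ hum (M := L * (1 + 9 * A / a) / a * dist x y / r ^ 3)
    (ρ := 3 * r) (by positivity) (by positivity) x (hφ.abs_kernel_sub_le ha hr hμ hxy hx hy)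
    fun z hz => ?_).trans_eq ?_
  · obtain ⟨e1, e2⟩ := hφ.eq_zero_of_dist hr hxy hz
    rw [e1, e2, zero_div, zero_div, sub_self]
  · congr 3
    field_simp
    ring

end Average

/-! ### Density of `H¹(Γ)` in `H^{1/2}(Γ)` -/

/-- The average is a quotient of two C¹ convolutions, but its denominator can vanish away from Γ. It
is modified where it is below c, that is, off the set where the average is needed. -/
theorem exists_contDiff_eq_cutoffAverage {μ : Measure E3} [IsFiniteMeasure μ] {u : E3 → ℂ}
    {φ : E3 → ℝ} {r L R c : ℝ} (hφ : IsCutoff φ r L) (hu : Integrable u μ)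
    (hR : ∀ᵐ z ∂μ, ‖z‖ ≤ R) (hc : 0 < c) :
    ∃ U : E3 → ℂ, ContDiff ℝ 1 U ∧ HasCompactSupport U ∧
      ∀ x, c ≤ cutoffMass μ φ x → U x = cutoffAverage μ φ u x := by
  have hφc : HasCompactSupport φ := by
    refine HasCompactSupport.intro (isCompact_closedBall 0 (2 * r)) fun z hz => hφ.eq_zero z ?_
    rw [mem_closedBall_zero_iff, not_le] at hz
    exact hz.le
  have hN : ContDiff ℝ 1 fun x => ∫ z, (φ (x - z) : ℂ) * u z ∂μ :=
    hφc.contDiff_convolution_right (n := 1) (ContinuousLinearMap.lsmul ℝ ℝ (E := ℂ)).flip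
      hu.locallyIntegrable hφ.smooth
  have hM : ContDiff ℝ 1 (cutoffMass μ φ) := by
    have := hφc.contDiff_convolution_right (n := 1) (μ := μ) (f := fun _ => (1 : ℝ))
      (ContinuousLinearMap.mul ℝ ℝ) (integrable_const 1).locallyIntegrable hφ.smooth
    have e1 : cutoffMass μ φ = convolution (fun _ => (1 : ℝ)) φ (ContinuousLinearMap.mul ℝ ℝ) μ := by
      ext x
      simp [cutoffMass, convolution]
    rw [e1]
    exact this
  have hM0 : ∀ x, 0 ≤ cutoffMass μ φ x := fun x => integral_nonneg fun z => hφ.nonneg _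
  -- Equal to s for s ≥ c and positive for all s ≥ 0, with value c at s = 0.
  set d : ℝ → ℝ := fun s => s + c * Real.smoothTransition (1 - s / c) with hd
  have hdc : ContDiff ℝ 1 d := by
    have := Real.smoothTransition.contDiff (n := 1)
    exact contDiff_id.add (contDiff_const.mul (this.comp (contDiff_const.sub (contDiff_id.div_const c))))
  have hdpos : ∀ s, 0 ≤ s → 0 < d s := by
    intro s hs
    rcases hs.eq_or_lt with rfl | h0
    · simpa [hd] using hc
    · exact add_pos_of_pos_of_nonneg h0 (mul_nonneg hc.le (Real.smoothTransition.nonneg _))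
  have hdeq : ∀ s, c ≤ s → d s = s := by
    intro s hs
    have : 1 - s / c ≤ 0 := by
      rw [sub_nonpos, one_le_div hc]
      exact hs
    simp only [hd, Real.smoothTransition.zero_of_nonpos this, mul_zero, add_zero]
  have hdM : ContDiff ℝ 1 fun x => (((d (cutoffMass μ φ x))⁻¹ : ℝ) : ℂ) :=
    Complex.ofRealCLM.contDiff.comp ((hdc.comp hM).inv fun x => (hdpos _ (hM0 x)).ne')
  refine ⟨fun x => (∫ z, (φ (x - z) : ℂ) * u z ∂μ) * (((d (cutoffMass μ φ x))⁻¹ : ℝ) : ℂ),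
    hN.mul hdM, ?_, fun x hx => ?_⟩
  · refine HasCompactSupport.intro (isCompact_closedBall 0 (R + 2 * r)) fun x hx => ?_
    rw [mem_closedBall_zero_iff, not_le] at hx
    rw [integral_eq_zero_of_ae, zero_mul]
    filter_upwards [hR] with z hz
    have := norm_sub_norm_le x z
    rw [hφ.eq_zero (x - z) (by linarith)]
    simp
  · simp only [hdeq _ hx, cutoffAverage, div_eq_mul_inv, Complex.ofReal_inv]

/-! ### Energy near the diagonal. -/

theorem measurable_slobodeckij_kernel {u : E3 → ℂ} (hu : Measurable u) :
    Measurable fun z : E3 × E3 => ENNReal.ofReal (dist z.1 z.2 ^ 3)⁻¹ * ‖u z.1 - u z.2‖ₑ ^ 2 := by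
  refine Measurable.mul (by fun_prop) (Measurable.pow_const (Measurable.enorm ?_) 2)
  exact (hu.comp measurable_fst).sub (hu.comp measurable_snd)

theorem measurableSet_dist_lt (ρ : ℝ) : MeasurableSet {z : E3 × E3 | dist z.1 z.2 < ρ} :=
  (isOpen_lt (by fun_prop) continuous_const).measurableSet

section Energy

variable {μ : Measure E3} {u : E3 → ℂ}

theorem localEnergy_eq (ρ : ℝ) (x : E3) : localEnergy μ u ρ x =
    ∫⁻ z, {z : E3 × E3 | dist z.1 z.2 < ρ}.indicator
      (fun z => ENNReal.ofReal (dist z.1 z.2 ^ 3)⁻¹ * ‖u z.1 - u z.2‖ₑ ^ 2) (x, z) ∂μ := by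
  rw [localEnergy, ← lintegral_indicator Metric.isOpen_ball.measurableSet]
  refine lintegral_congr fun z => ?_
  have : z ∈ Metric.ball x ρ ↔ (x, z) ∈ {z : E3 × E3 | dist z.1 z.2 < ρ} := by
    rw [Metric.mem_ball, dist_comm, mem_ofPred_eq]
  by_cases h : z ∈ Metric.ball x ρ
  · rw [indicator_of_mem h, indicator_of_mem (this.1 h)]
  · rw [indicator_of_notMem h, indicator_of_notMem (mt this.2 h)]

theorem measurable_localEnergy [IsFiniteMeasure μ] (hu : Measurable u) (ρ : ℝ) : Measurable (localEnergy μ u ρ) := by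
  rw [funext (localEnergy_eq ρ)]
  exact Measurable.lintegral_prod_right'
    ((measurable_slobodeckij_kernel hu).indicator (measurableSet_dist_lt ρ))

/-- Dominated convergence on Γ × Γ: the strips |x − y| < ρ shrink to the diagonal, where the
integrand is zero by the convention for the inverse of zero. -/
theorem tendsto_lintegral_localEnergy [IsFiniteMeasure μ] (hu : Measurable u)
    (hfin : ∫⁻ z, ENNReal.ofReal (dist z.1 z.2 ^ 3)⁻¹ * ‖u z.1 - u z.2‖ₑ ^ 2 ∂μ.prod μ ≠ ⊤)
    {ρ : ℕ → ℝ} (hρ : Tendsto ρ atTop (𝓝 0)) :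
    Tendsto (fun n => ∫⁻ x, localEnergy μ u (ρ n) x ∂μ) atTop (𝓝 0) := by
  have hk := measurable_slobodeckij_kernel hu
  have h1 : ∀ n, ∫⁻ x, localEnergy μ u (ρ n) x ∂μ =
      ∫⁻ z, {z : E3 × E3 | dist z.1 z.2 < ρ n}.indicator
      (fun z => ENNReal.ofReal (dist z.1 z.2 ^ 3)⁻¹ * ‖u z.1 - u z.2‖ₑ ^ 2) z ∂μ.prod μ := by
    intro n
    rw [lintegral_prod _ (hk.indicator (measurableSet_dist_lt _)).aemeasurable]
    exact lintegral_congr fun x => localEnergy_eq _ x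
  simp_rw [h1]
  rw [← lintegral_zero (μ := μ.prod μ)]
  refine tendsto_lintegral_of_dominated_convergence _
    (fun n => hk.indicator (measurableSet_dist_lt _))
    (fun n => Eventually.of_forall fun z => indicator_le_self _ _ z) hfin
    (Eventually.of_forall fun z => ?_)
  rcases (dist_nonneg (x := z.1) (y := z.2)).eq_or_lt with h0 | h0
  · refine tendsto_const_nhds.congr fun n => ?_
    rw [indicator_apply]
    simp [← h0]
  · refine tendsto_const_nhds.congr' ?_
    filter_upwards [hρ.eventually (gt_mem_nhds h0)] with n hn
    rw [indicator_of_notMem]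
    rw [mem_ofPred_eq, not_lt]
    exact hn.le

theorem lintegral_compl_ball_swap [IsFiniteMeasure μ] {w : E3 → ℂ} (hw : Measurable w) (r : ℝ) :
    ∫⁻ x, ∫⁻ y in (Metric.ball x r)ᶜ, ENNReal.ofReal (dist x y ^ 3)⁻¹ * ‖w y‖ₑ ^ 2 ∂μ ∂μ =
      ∫⁻ y, ‖w y‖ₑ ^ 2 * ∫⁻ x in (Metric.ball y r)ᶜ, ENNReal.ofReal (dist x y ^ 3)⁻¹ ∂μ ∂μ := by
  have hm : Measurable fun z : E3 × E3 => {z : E3 × E3 | dist z.1 z.2 < r}ᶜ.indicator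
      (fun z => ENNReal.ofReal (dist z.1 z.2 ^ 3)⁻¹ * ‖w z.2‖ₑ ^ 2) z := by
    refine Measurable.indicator ?_ (measurableSet_dist_lt r).compl
    exact Measurable.mul (by fun_prop) ((hw.comp measurable_snd).enorm.pow_const 2)
  have e1 : ∀ x, ∫⁻ y in (Metric.ball x r)ᶜ, ENNReal.ofReal (dist x y ^ 3)⁻¹ * ‖w y‖ₑ ^ 2 ∂μ =
      ∫⁻ y, {z : E3 × E3 | dist z.1 z.2 < r}ᶜ.indicator
      (fun z => ENNReal.ofReal (dist z.1 z.2 ^ 3)⁻¹ * ‖w z.2‖ₑ ^ 2) (x, y) ∂μ := by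
    intro x
    rw [← lintegral_indicator Metric.isOpen_ball.measurableSet.compl]
    refine lintegral_congr fun y => ?_
    have : y ∈ (Metric.ball x r)ᶜ ↔ (x, y) ∈ {z : E3 × E3 | dist z.1 z.2 < r}ᶜ := by
      rw [mem_compl_iff, mem_compl_iff, Metric.mem_ball, dist_comm, mem_ofPred_eq]
    by_cases h : y ∈ (Metric.ball x r)ᶜ
    · rw [indicator_of_mem h, indicator_of_mem (this.1 h)]
    · rw [indicator_of_notMem h, indicator_of_notMem (mt this.2 h)]
  have e2 : ∀ y, ‖w y‖ₑ ^ 2 * ∫⁻ x in (Metric.ball y r)ᶜ, ENNReal.ofReal (dist x y ^ 3)⁻¹ ∂μ =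
      ∫⁻ x, {z : E3 × E3 | dist z.1 z.2 < r}ᶜ.indicator
      (fun z => ENNReal.ofReal (dist z.1 z.2 ^ 3)⁻¹ * ‖w z.2‖ₑ ^ 2) (x, y) ∂μ := by
    intro y
    rw [mul_comm, ← lintegral_mul_const _ (by fun_prop),
      ← lintegral_indicator Metric.isOpen_ball.measurableSet.compl]
    refine lintegral_congr fun x => ?_
    have : x ∈ (Metric.ball y r)ᶜ ↔ (x, y) ∈ {z : E3 × E3 | dist z.1 z.2 < r}ᶜ := by
      rw [mem_compl_iff, mem_compl_iff, Metric.mem_ball, mem_ofPred_eq]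
    by_cases h : x ∈ (Metric.ball y r)ᶜ
    · rw [indicator_of_mem h, indicator_of_mem (this.1 h)]
    · rw [indicator_of_notMem h, indicator_of_notMem (mt this.2 h)]
  simp_rw [e1, e2]
  exact lintegral_lintegral_swap hm.aemeasurable

end Energy

theorem ofReal_inv_cube_mul_le {d r : ℝ} (hd : 0 ≤ d) :
    ENNReal.ofReal (d ^ 3)⁻¹ * ENNReal.ofReal (d ^ 2 / r) ≤
      ENNReal.ofReal d⁻¹ * ENNReal.ofReal (1 / r) := by
  rw [← ENNReal.ofReal_mul (by positivity), ← ENNReal.ofReal_mul (by positivity)]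
  refine ENNReal.ofReal_le_ofReal (le_of_eq ?_)
  rcases hd.eq_or_lt with rfl | h
  · simp
  · field_simp

theorem kernel_mul_sub_le {a b : ℂ} {d r : ℝ} (hd : 0 ≤ d) {C S : ℝ≥0∞}
    (h : ‖a‖ₑ ^ 2 ≤ C * ENNReal.ofReal (d ^ 2 / r) * S) :
    ENNReal.ofReal (d ^ 3)⁻¹ * ‖a - b‖ₑ ^ 2 ≤
      ENNReal.ofReal d⁻¹ * (2 * C * ENNReal.ofReal (1 / r) * S) +
        2 * (ENNReal.ofReal (d ^ 3)⁻¹ * ‖b‖ₑ ^ 2) := by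
  calc ENNReal.ofReal (d ^ 3)⁻¹ * ‖a - b‖ₑ ^ 2
      ≤ ENNReal.ofReal (d ^ 3)⁻¹ * (2 * (C * ENNReal.ofReal (d ^ 2 / r) * S) + 2 * ‖b‖ₑ ^ 2) := by
        gcongr
        exact (enorm_sub_sq_le _ _).trans (by gcongr)
    _ = (ENNReal.ofReal (d ^ 3)⁻¹ * ENNReal.ofReal (d ^ 2 / r)) * (2 * C * S) +
        2 * (ENNReal.ofReal (d ^ 3)⁻¹ * ‖b‖ₑ ^ 2) := by ring
    _ ≤ (ENNReal.ofReal d⁻¹ * ENNReal.ofReal (1 / r)) * (2 * C * S) +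
        2 * (ENNReal.ofReal (d ^ 3)⁻¹ * ‖b‖ₑ ^ 2) := by
        gcongr ?_ * _ + _
        exact ofReal_inv_cube_mul_le hd
    _ = _ := by ring

section Combine

variable {μ : Measure E3} {A : ℝ≥0} {Γ : Set E3} {u U : E3 → ℂ} {r : ℝ}
  {C₁ C₂ : ℝ≥0}

/-- Close to x the averages and u are separated. The bound |x − y|²/r for the averages leaves |x −
y|⁻¹/r, whose integral over the ball is at most 16A, while u contributes its own local energy; both
are doubled by |a − b|² ≤ 2|a|² + 2|b|². -/
theorem lintegral_ball_difference_le (hμ : ∀ x r, μ (Metric.ball x r) ≤ A * ENNReal.ofReal r ^ 2)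
    (hΓ : ∀ᵐ x ∂μ, x ∈ Γ) (hu : Measurable u) (hr : 0 < r)
    (h₂ : ∀ x ∈ Γ, ∀ y ∈ Γ, dist x y < r → ‖U x - U y‖ₑ ^ 2 ≤
      C₂ * ENNReal.ofReal (dist x y ^ 2 / r) * localEnergy μ u (3 * r) x) {x : E3} (hx : x ∈ Γ) :
    ∫⁻ y in Metric.ball x r, ENNReal.ofReal (dist x y ^ 3)⁻¹ *
      ‖(U x - u x) - (U y - u y)‖ₑ ^ 2 ∂μ ≤ (32 * A * C₂ + 2) * localEnergy μ u (3 * r) x := by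
  have hB : MeasurableSet (Metric.ball x r) := Metric.isOpen_ball.measurableSet
  have hku : Measurable fun y => ENNReal.ofReal (dist x y ^ 3)⁻¹ * ‖u x - u y‖ₑ ^ 2 :=
    Measurable.mul (by fun_prop) ((measurable_const.sub hu).enorm.pow_const 2)
  have hS : localEnergy μ u r x ≤ localEnergy μ u (3 * r) x :=
    lintegral_mono_set (Metric.ball_subset_ball (by linarith))
  have h₂x := h₂ x hx
  clear h₂
  generalize localEnergy μ u (3 * r) x = S at *
  have step1 : ∫⁻ y in Metric.ball x r, ENNReal.ofReal (dist x y ^ 3)⁻¹ *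
      ‖(U x - u x) - (U y - u y)‖ₑ ^ 2 ∂μ ≤
      ∫⁻ y in Metric.ball x r, (ENNReal.ofReal (dist y x)⁻¹ *
          (2 * C₂ * ENNReal.ofReal (1 / r) * S) +
          2 * (ENNReal.ofReal (dist x y ^ 3)⁻¹ * ‖u x - u y‖ₑ ^ 2)) ∂μ := by
    refine setLIntegral_mono_ae' hB ?_
    filter_upwards [hΓ] with y hy hyB
    have e1 : (U x - u x) - (U y - u y) = (U x - U y) - (u x - u y) := by ring
    rw [e1, dist_comm y x]
    exact kernel_mul_sub_le dist_nonneg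
      (h₂x y hy (by rw [dist_comm]; exact Metric.mem_ball.1 hyB))
  have step2 : ∫⁻ y in Metric.ball x r, (ENNReal.ofReal (dist y x)⁻¹ *
          (2 * C₂ * ENNReal.ofReal (1 / r) * S) +
          2 * (ENNReal.ofReal (dist x y ^ 3)⁻¹ * ‖u x - u y‖ₑ ^ 2)) ∂μ =
      (∫⁻ y in Metric.ball x r, ENNReal.ofReal (dist y x)⁻¹ ∂μ) *
          (2 * C₂ * ENNReal.ofReal (1 / r) * S) + 2 * localEnergy μ u r x := by
    rw [lintegral_add_right _ (hku.const_mul 2), lintegral_const_mul _ hku,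
      lintegral_mul_const _ (by fun_prop), localEnergy]
  rw [step2] at step1
  refine step1.trans ((add_le_add (mul_le_mul_left (setLIntegral_ball_inv_dist_le hμ x hr) _)
    (mul_le_mul_right hS 2)).trans_eq ?_)
  have h16 : ENNReal.ofReal (16 * r) * ENNReal.ofReal (1 / r) = 16 := by
    rw [← ENNReal.ofReal_mul (by positivity)]
    have : 16 * r * (1 / r) = 16 := by field_simp
    rw [this]
    simp
  calc A * ENNReal.ofReal (16 * r) * (2 * C₂ * ENNReal.ofReal (1 / r) * S) + 2 * S
      = (ENNReal.ofReal (16 * r) * ENNReal.ofReal (1 / r)) * (2 * A * C₂ * S) + 2 * S := by ring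
    _ = _ := by
        rw [h16]
        ring

/-- Away from x no cancellation is needed: the kernel has integral at most 8A/r, and the factor r in
the bound for w(x) compensates for it. The term with w(y) is left for `lintegral_compl_ball_le`,
where Tonelli exchanges the roles of x and y. -/
theorem lintegral_compl_ball_difference_le
    (hμ : ∀ x r, μ (Metric.ball x r) ≤ A * ENNReal.ofReal r ^ 2)
    (hr : 0 < r) {w : E3 → ℂ} (hw : Measurable w) {S : ℝ≥0∞} {x : E3}
    (h₁ : ‖w x‖ₑ ^ 2 ≤ C₁ * ENNReal.ofReal r * S) :
    ∫⁻ y in (Metric.ball x r)ᶜ, ENNReal.ofReal (dist x y ^ 3)⁻¹ * ‖w x - w y‖ₑ ^ 2 ∂μ ≤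
      16 * A * C₁ * S +
        2 * ∫⁻ y in (Metric.ball x r)ᶜ, ENNReal.ofReal (dist x y ^ 3)⁻¹ * ‖w y‖ₑ ^ 2 ∂μ := by
  have hm : Measurable fun y => ENNReal.ofReal (dist x y ^ 3)⁻¹ * ‖w y‖ₑ ^ 2 :=
    Measurable.mul (by fun_prop) (hw.enorm.pow_const 2)
  calc _ ≤ ∫⁻ y in (Metric.ball x r)ᶜ, (ENNReal.ofReal (dist y x ^ 3)⁻¹ * (2 * ‖w x‖ₑ ^ 2) +
          2 * (ENNReal.ofReal (dist x y ^ 3)⁻¹ * ‖w y‖ₑ ^ 2)) ∂μ := by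
        refine lintegral_mono fun y => ?_
        calc ENNReal.ofReal (dist x y ^ 3)⁻¹ * ‖w x - w y‖ₑ ^ 2
            ≤ ENNReal.ofReal (dist x y ^ 3)⁻¹ * (2 * ‖w x‖ₑ ^ 2 + 2 * ‖w y‖ₑ ^ 2) := by
              gcongr
              exact enorm_sub_sq_le _ _
          _ = _ := by
              rw [dist_comm y x]
              ring
    _ = (∫⁻ y in (Metric.ball x r)ᶜ, ENNReal.ofReal (dist y x ^ 3)⁻¹ ∂μ) * (2 * ‖w x‖ₑ ^ 2) +
          2 * ∫⁻ y in (Metric.ball x r)ᶜ, ENNReal.ofReal (dist x y ^ 3)⁻¹ * ‖w y‖ₑ ^ 2 ∂μ := by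
        rw [lintegral_add_right _ (hm.const_mul 2), lintegral_const_mul _ hm,
          lintegral_mul_const _ (by fun_prop)]
    _ ≤ (A * ENNReal.ofReal (8 / r)) * (2 * (C₁ * ENNReal.ofReal r * S)) +
          2 * ∫⁻ y in (Metric.ball x r)ᶜ, ENNReal.ofReal (dist x y ^ 3)⁻¹ * ‖w y‖ₑ ^ 2 ∂μ := by
        gcongr
        exact setLIntegral_compl_ball_inv_dist_le hμ x hr
    _ = (ENNReal.ofReal (8 / r) * ENNReal.ofReal r) * (2 * A * C₁ * S) +
          2 * ∫⁻ y in (Metric.ball x r)ᶜ, ENNReal.ofReal (dist x y ^ 3)⁻¹ * ‖w y‖ₑ ^ 2 ∂μ := by ring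
    _ = _ := by
        rw [← ENNReal.ofReal_mul (by positivity), div_mul_cancel₀ _ hr.ne',
          show ENNReal.ofReal 8 = 8 by simp]
        ring

theorem lintegral_compl_ball_le [IsFiniteMeasure μ] (hμ : ∀ x r, μ (Metric.ball x r) ≤ A * ENNReal.ofReal r ^ 2)
    (hr : 0 < r) {w : E3 → ℂ} (hw : Measurable w) {S : E3 → ℝ≥0∞} (hS : Measurable S)
    (h₁ : ∀ᵐ x ∂μ, ‖w x‖ₑ ^ 2 ≤ C₁ * ENNReal.ofReal r * S x) :
    ∫⁻ x, ∫⁻ y in (Metric.ball x r)ᶜ, ENNReal.ofReal (dist x y ^ 3)⁻¹ * ‖w y‖ₑ ^ 2 ∂μ ∂μ ≤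
      8 * A * C₁ * ∫⁻ x, S x ∂μ := by
  rw [lintegral_compl_ball_swap hw, ← lintegral_const_mul _ hS]
  refine lintegral_mono_ae ?_
  filter_upwards [h₁] with y hy
  calc _ ≤ (C₁ * ENNReal.ofReal r * S y) * (A * ENNReal.ofReal (8 / r)) := by
        gcongr
        exact setLIntegral_compl_ball_inv_dist_le hμ y hr
    _ = (ENNReal.ofReal (8 / r) * ENNReal.ofReal r) * (A * C₁ * S y) := by ring
    _ = _ := by
        rw [← ENNReal.ofReal_mul (by positivity), div_mul_cancel₀ _ hr.ne',
          show ENNReal.ofReal 8 = 8 by simp]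
        ring

/-- The constant collects 32AC₂ + 2 from the ball around x, 16AC₁ from w(x) outside it and 2 · 8AC₁
from w(y). It does not depend on r. -/
theorem lintegral_slobodeckij_difference_le [IsFiniteMeasure μ]
    (hμ : ∀ x r, μ (Metric.ball x r) ≤ A * ENNReal.ofReal r ^ 2)
    (hΓ : ∀ᵐ x ∂μ, x ∈ Γ) (hu : Measurable u) (hU : Measurable U) (hr : 0 < r)
    (h₁ : ∀ x ∈ Γ, ‖U x - u x‖ₑ ^ 2 ≤ C₁ * ENNReal.ofReal r * localEnergy μ u (3 * r) x)
    (h₂ : ∀ x ∈ Γ, ∀ y ∈ Γ, dist x y < r → ‖U x - U y‖ₑ ^ 2 ≤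
      C₂ * ENNReal.ofReal (dist x y ^ 2 / r) * localEnergy μ u (3 * r) x) :
    ∫⁻ z, ENNReal.ofReal (dist z.1 z.2 ^ 3)⁻¹ *
      ‖(U z.1 - u z.1) - (U z.2 - u z.2)‖ₑ ^ 2 ∂μ.prod μ ≤
      (32 * A * C₂ + 2 + 32 * A * C₁ : ℝ≥0) * ∫⁻ x, localEnergy μ u (3 * r) x ∂μ := by
  have hw : Measurable fun x => U x - u x := hU.sub hu
  have hS := measurable_localEnergy (μ := μ) hu (3 * r)
  set S := localEnergy μ u (3 * r)
  rw [lintegral_prod _ (measurable_slobodeckij_kernel hw).aemeasurable]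
  calc _ ≤ ∫⁻ x, (((32 * A * C₂ + 2) * S x + 16 * A * C₁ * S x) +
        2 * ∫⁻ y in (Metric.ball x r)ᶜ, ENNReal.ofReal (dist x y ^ 3)⁻¹ *
          ‖U y - u y‖ₑ ^ 2 ∂μ) ∂μ := by
        refine lintegral_mono_ae ?_
        filter_upwards [hΓ] with x hx
        rw [← lintegral_add_compl _ (Metric.isOpen_ball (x := x) (ε := r)).measurableSet, add_assoc]
        exact add_le_add (lintegral_ball_difference_le hμ hΓ hu hr h₂ hx)
          (lintegral_compl_ball_difference_le (w := fun x => U x - u x) hμ hr hw (h₁ x hx))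
    _ = ((32 * A * C₂ + 2) * ∫⁻ x, S x ∂μ + 16 * A * C₁ * ∫⁻ x, S x ∂μ) +
        2 * ∫⁻ x, ∫⁻ y in (Metric.ball x r)ᶜ, ENNReal.ofReal (dist x y ^ 3)⁻¹ *
          ‖U y - u y‖ₑ ^ 2 ∂μ ∂μ := by
        have hS' : Measurable fun x => (32 * A * C₂ + 2) * S x + 16 * A * C₁ * S x :=
          (hS.const_mul _).add (hS.const_mul _)
        rw [lintegral_add_left hS', lintegral_add_left (hS.const_mul _), lintegral_const_mul _ hS, lintegral_const_mul _ hS,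
          lintegral_const_mul' _ _ (by simp)]
    _ ≤ ((32 * A * C₂ + 2) * ∫⁻ x, S x ∂μ + 16 * A * C₁ * ∫⁻ x, S x ∂μ) +
        2 * (8 * A * C₁ * ∫⁻ x, S x ∂μ) := by
        gcongr
        exact lintegral_compl_ball_le hμ hr hw hS (hΓ.mono h₁)
    _ = _ := by
        push_cast
        ring

end Combine

theorem slobodeckij_congr {Ω : Set E3} {f f' : E3 → ℂ} (hf : f =ᵐ[surfaceMeasure Ω] f') :
    slobodeckij Ω f = slobodeckij Ω f' := by
  refine lintegral_congr_ae ?_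
  filter_upwards [Measure.quasiMeasurePreserving_fst (μ := surfaceMeasure Ω)
      (ν := surfaceMeasure Ω) |>.ae hf, Measure.quasiMeasurePreserving_snd
      (μ := surfaceMeasure Ω) (ν := surfaceMeasure Ω) |>.ae hf] with z h1 h2
  rw [h1, h2]

theorem HHalf.enorm_sub_sq {Ω : Set E3} (p' p : HHalf Ω) {w : E3 → ℂ}
    (hw : HHalf.toL2 Ω p' =ᵐ[surfaceMeasure Ω] w) :
    ‖p' - p‖ₑ ^ 2 = ∫⁻ x, ‖w x - HHalf.toL2 Ω p x‖ₑ ^ 2 ∂surfaceMeasure Ω +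
      slobodeckij Ω (fun x => w x - HHalf.toL2 Ω p x) := by
  have h : HHalf.toL2 Ω (p' - p) =ᵐ[surfaceMeasure Ω] fun x => w x - HHalf.toL2 Ω p x := by
    rw [map_sub]
    filter_upwards [hw, Lp.coeFn_sub (HHalf.toL2 Ω p') (HHalf.toL2 Ω p)] with x h1 h2
    rw [h2, Pi.sub_apply, h1]
  rw [HHalf.enorm_sq, slobodeckij_congr h]
  congr 1
  refine lintegral_congr_ae ?_
  filter_upwards [h] with x hx
  rw [hx]

theorem HHalf.slobodeckij_lt_top {Ω : Set E3} (p : HHalf Ω) :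
    slobodeckij Ω (HHalf.toL2 Ω p) < ⊤ := by
  have h : ‖p‖ₑ ^ 2 < ⊤ := by finiteness
  rw [HHalf.enorm_sq] at h
  exact (ENNReal.add_lt_top.1 h).2

/-- The approximant is the restriction to Γ of the averaged function, which is C¹ with compact
support in space and so has a tangential gradient. K and r₀ are fixed before r, so the error is
controlled by the energy near the diagonal alone. -/
theorem H1.exists_enorm_embed_sub_le {Ω : Set E3} (hΩ : IsLipschitzExteriorDomain Ω) {ε : ℝ}
    (hε : 0 < ε) (p : HHalf Ω) : ∃ K : ℝ≥0, ∃ r₀ > 0, ∀ r ∈ Ioc 0 r₀, ∃ ψ : H1 Ω ε,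
      ‖H1.embed Ω ε ψ - p‖ₑ ^ 2 ≤
        K * ∫⁻ x, localEnergy (surfaceMeasure Ω) (HHalf.toL2 Ω p) (3 * r) x ∂surfaceMeasure Ω := by
  have := isFiniteMeasure_surfaceMeasure hΩ
  obtain ⟨A, hμ⟩ := exists_measure_ball_le hΩ
  obtain ⟨a, ha, r₀, hr₀, hlow⟩ := exists_le_measure_ball hΩ
  obtain ⟨L, hL, hcut⟩ := exists_isCutoff
  obtain ⟨R, hR⟩ := (isCompact_frontier hΩ).isBounded.exists_norm_le
  have hum : Measurable (HHalf.toL2 Ω p) := (Lp.stronglyMeasurable _).measurable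
  have hui : Integrable (HHalf.toL2 Ω p) (surfaceMeasure Ω) := (Lp.memLp _).integrable one_le_two
  set u : L2 Ω := HHalf.toL2 Ω p
  set C₁ : ℝ≥0 := A * (243 / (a : ℝ) ^ 2).toNNReal with hC₁
  set C₂ : ℝ≥0 := A * (243 * (L * (1 + 9 * A / a) / a) ^ 2).toNNReal with hC₂
  -- The first summand bounds the L² part of the error, using r ≤ r₀; the rest bounds its seminorm.
  refine ⟨C₁ * r₀.toNNReal + (32 * A * C₂ + 2 + 32 * A * C₁), r₀, hr₀, fun r hr => ?_⟩
  have hr0 : 0 < r := hr.1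
  have hlow' : ∀ x ∈ frontier Ω, (a : ℝ) * r ^ 2 ≤ (surfaceMeasure Ω).real (Metric.ball x r) := by
    intro x hx
    have h := ENNReal.toReal_mono (measure_ne_top _ _) (hlow x hx r hr)
    simpa [Measure.real, ENNReal.toReal_mul, ENNReal.toReal_ofReal hr0.le] using h
  obtain ⟨φ, hφ⟩ := hcut r hr0
  have ha' : (0 : ℝ) < a := ha
  obtain ⟨U, hU, hUc, hUeq⟩ := exists_contDiff_eq_cutoffAverage (c := a * r ^ 2) hφ hui
    ((ae_mem_frontier Ω).mono hR) (by positivity)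
  obtain ⟨f, q, hf, hq⟩ := exists_isWeakTangentialGradient_of_contDiff hΩ hU hUc
  obtain ⟨ψ, hψ⟩ := H1.mem_range_toL2 hΩ hε hq
  refine ⟨ψ, ?_⟩
  have hUΓ : ∀ x ∈ frontier Ω, U x = cutoffAverage (surfaceMeasure Ω) φ u x := fun x hx =>
    hUeq x (hφ.le_mass (hlow' x hx))
  have h₁ : ∀ x ∈ frontier Ω, ‖U x - u x‖ₑ ^ 2 ≤
      C₁ * ENNReal.ofReal r * localEnergy (surfaceMeasure Ω) u (3 * r) x := by
    intro x hx
    rw [hUΓ x hx]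
    refine (hφ.enorm_sq_average_sub_le hum hui ha' hr0 hμ (hlow' x hx)).trans_eq ?_
    rw [hC₁, ENNReal.coe_mul, ENNReal.ofReal_mul (by positivity), ← mul_assoc]
    rfl
  have h₂ : ∀ x ∈ frontier Ω, ∀ y ∈ frontier Ω, dist x y < r → ‖U x - U y‖ₑ ^ 2 ≤
      C₂ * ENNReal.ofReal (dist x y ^ 2 / r) * localEnergy (surfaceMeasure Ω) u (3 * r) x := by
    intro x hx y hy hxy
    rw [hUΓ x hx, hUΓ y hy]
    refine (hφ.enorm_sq_average_sub_average_le hum hui hL ha' hr0 hμ hxy (hlow' x hx)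
      (hlow' y hy)).trans_eq ?_
    rw [hC₂, ENNReal.coe_mul, mul_div_assoc, ENNReal.ofReal_mul (by positivity), ← mul_assoc]
    rfl
  have h₃ := lintegral_slobodeckij_difference_le hμ (ae_mem_frontier Ω) hum hU.continuous.measurable
    hr0 h₁ h₂
  have hS := measurable_localEnergy (μ := surfaceMeasure Ω) hum (3 * r)
  have h₄ : ∫⁻ x, ‖U x - u x‖ₑ ^ 2 ∂surfaceMeasure Ω ≤
      (C₁ * r₀.toNNReal : ℝ≥0) *
        ∫⁻ x, localEnergy (surfaceMeasure Ω) u (3 * r) x ∂surfaceMeasure Ω := by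
    rw [← lintegral_const_mul _ hS]
    refine lintegral_mono_ae ?_
    filter_upwards [ae_mem_frontier Ω] with x hx
    refine (h₁ x hx).trans ?_
    rw [ENNReal.coe_mul]
    exact mul_le_mul_left (mul_le_mul_right (ENNReal.ofReal_le_ofReal hr.2) _) _
  have hψ' : HHalf.toL2 Ω (H1.embed Ω ε ψ) =ᵐ[surfaceMeasure Ω] U := by
    have : HHalf.toL2 Ω (H1.embed Ω ε ψ) = f := hψ
    rw [this]
    exact hf
  rw [HHalf.enorm_sub_sq _ _ hψ', ENNReal.coe_add, add_mul]
  exact add_le_add h₄ h₃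

theorem H1.denseRange_embed {Ω : Set E3} (hΩ : IsLipschitzExteriorDomain Ω) {ε : ℝ}
    (hε : 0 < ε) : DenseRange (H1.embed Ω ε) := by
  intro p
  have := isFiniteMeasure_surfaceMeasure hΩ
  obtain ⟨K, r₀, hr₀, hK⟩ := H1.exists_enorm_embed_sub_le hΩ hε p
  rw [Metric.mem_closure_iff]
  intro θ hθ
  have hum : Measurable (HHalf.toL2 Ω p) := (Lp.stronglyMeasurable _).measurable
  -- The scales r₀/(n + 1) are admissible for every n, and the corresponding energy strips have
  -- width three times that.
  have hρ : Tendsto (fun n : ℕ => 3 * (r₀ * (1 / ((n : ℝ) + 1)))) atTop (𝓝 0) := by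
    simpa using (tendsto_one_div_add_atTop_nhds_zero_nat.const_mul r₀).const_mul (3 : ℝ)
  have h1 := ENNReal.Tendsto.const_mul (a := (K : ℝ≥0∞)) (tendsto_lintegral_localEnergy
    (μ := surfaceMeasure Ω) hum (HHalf.slobodeckij_lt_top p).ne hρ) (Or.inr ENNReal.coe_ne_top)
  rw [mul_zero] at h1
  obtain ⟨n, hn⟩ := (h1.eventually (gt_mem_nhds (show (0 : ℝ≥0∞) < ENNReal.ofReal (θ ^ 2) by
    rw [ENNReal.ofReal_pos]; positivity))).exists
  have hn1 : (1 : ℝ) / ((n : ℝ) + 1) ≤ 1 := by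
    rw [div_le_one (by positivity)]
    linarith [(Nat.cast_nonneg n : (0 : ℝ) ≤ n)]
  obtain ⟨ψ, hψ⟩ := hK (r₀ * (1 / ((n : ℝ) + 1))) ⟨by positivity, mul_le_of_le_one_right hr₀.le hn1⟩
  refine ⟨_, ⟨ψ, rfl⟩, ?_⟩
  have h2 := hψ.trans_lt hn
  rw [← ofReal_norm, ← ENNReal.ofReal_pow (norm_nonneg _),
    ENNReal.ofReal_lt_ofReal_iff (by positivity)] at h2
  rw [dist_comm, dist_eq_norm]
  exact lt_of_pow_lt_pow_left₀ 2 hθ.le h2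

/-! ### Assembly of the four boundary conditions. -/

theorem lemma2p1 (Ω : Set E3) (hΩ : IsLipschitzExteriorDomain Ω) :
    (∀ ε : ℝ, 0 < ε →
      (∀ f : L2 Ω, (∃ q : L2Vec Ω, IsWeakTangentialGradient Ω f q) → f ∈ range (H1.toL2 Ω ε)) ∧
      IsGeneralizedImpedanceCondition (H1.embed Ω ε) (H1.seminorm Ω ε)
        (thinCoating Ω ε) (thinCoatingTransfer Ω ε) 1 0) ∧
    (∀ ε κ : ℝ, 0 < ε → 0 ≤ κ →
      IsGeneralizedImpedanceCondition (HHalfWeighted.embed Ω κ)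
        (HHalfWeighted.seminorm Ω κ) (absorbing1 Ω κ ε) (absorbing1Transfer Ω κ ε) 0 0) ∧
    (∀ (ρ : E3 → ℝ) (hρ : IsSmoothDefiningFunction Ω ρ) (ε κ : ℝ), 0 < ε → 0 ≤ κ →
      IsGeneralizedImpedanceCondition (HHalfWeighted.embed Ω κ)
        (HHalfWeighted.seminorm Ω κ) (absorbing2 hΩ hρ κ ε)
        (absorbing2Transfer hΩ hρ κ ε) 0 ((ε * max 0 (maxMeanCurvature Ω ρ)) ^ 2)) ∧
    (∀ m α k : ℝ, 0 < m → 0 ≤ α → 0 < k →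
      IsGeneralizedImpedanceCondition (HHalfWeighted.embed Ω 0)
        (HHalfWeighted.seminorm Ω 0) (acoustic Ω m α k) (acousticTransfer Ω m α k)
        (-1) 0) := by
  -- `H1` is built inside H^{1/2}(Γ). Its first property shows that nothing is lost: every L²
  -- function with a square-integrable tangential gradient belongs to it.
  refine ⟨fun ε hε => ⟨fun f ⟨q, hq⟩ => H1.mem_range_toL2 hΩ hε hq,
      H1.isAdmissibleSpace hΩ hε (H1.denseRange_embed hΩ hε), isTransferOperator_thinCoating Ω hε,
      fun n σ T hn hσ _ u dnu hu hu0 => ?_⟩,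
    fun ε κ hε hκ => ⟨HHalfWeighted.isAdmissibleSpace Ω hκ, isTransferOperator_absorbing1 Ω hε hκ,
      fun n σ T hn hσ _ u dnu hu hu0 => ?_⟩,
    fun ρ hρ ε κ hε hκ => ⟨HHalfWeighted.isAdmissibleSpace Ω hκ,
      isTransferOperator_absorbing2 hΩ hρ hε hκ, fun n σ T hn hσ _ u dnu hu hu0 => ?_⟩,
    fun m α k hm hα hk => ⟨HHalfWeighted.isAdmissibleSpace Ω le_rfl,
      isTransferOperator_acoustic Ω hm hα hk, fun n σ T hn hσ _ u dnu hu hu0 => ?_⟩⟩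
  -- The condition n > μ + 1 reads n > 2 for μ = 1, and n > 1 or n > 0 in the cases below; there n ≥
  -- 1 is all that is used.
  · have hn' : 3 ≤ n := by
      have : ((2 : ℕ) : ℝ) < n := by
        push_cast
        linarith
      exact Nat.cast_lt.1 this
    exact thinCoating_iff Ω ε hn' hσ hu hu0
  · have hn' : 1 ≤ n := by
      have : ((0 : ℕ) : ℝ) < n := by
        push_cast
        linarith
      exact Nat.cast_lt.1 this
    exact absorbing1_iff Ω κ ε hn' hσ hu hu0
  · have hn' : 1 ≤ n := by
      have : ((0 : ℕ) : ℝ) < n := by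
        push_cast
        linarith
      exact Nat.cast_lt.1 this
    exact absorbing2_iff hΩ hρ κ ε hn' hσ hu hu0
  · have hn' : 0 < n := by
      have : ((0 : ℕ) : ℝ) < n := by
        push_cast
        linarith
      exact Nat.cast_lt.1 this
    exact acoustic_iff Ω hm hα hk hn' hσ hu hu0
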